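/- **Proposition 4.3.** Let $d\in\mathbb N$ and let $\mathscr S=\mathscr S(\mathbb R^d)$, $\mathscr S'=\mathscr S'(\mathbb R^d)$ be the (complex-valued) Schwartz functions and the tempered distributions. Let $\psi:\mathbb R^d\to\mathbb R$ be smooth, $\psi=0$ outside $[-3/4,3/4]^d$, and $\sum_{k\in\mathbb Z^d}\psi(\xi-k)=1$ for all $\xi\in\mathbb R^d$. For $j\in\mathbb Z$, $k\in\mathbb Z^d$ put $\Box_{j,k}=\mathscr F^{-1}\psi(2^{-j}\,\cdot-k)\mathscr F$ on $\mathscr S'$, where $\mathscr F$ is the Fourier transform with kernel $e^{-ix\cdot\xi}$, and for $f\in\mathscr S'$ let $$\|f\|_{M^{[j]}_{p,q}}=\Big(\sum_{k\in\mathbb Z^d}\|\Box_{j,k}f\|_{L^p(\mathbb R^d)}^q\Big)^{1/q}\in[0,\infty],$$ with $\|u\|_{L^p}=\infty$ if $u\in\mathscr S'$ is not a function in $L^p$. For $\varrho,\mu\in\mathbb R$ let $$\|f\|_{\mathfrak M^{\varrho}_{p,q,r}}=\Big(\sum_{j\le 0}2^{jr\varrho}\|f\|^r_{M^{[j]}_{p,q}}\Big)^{1/r},\qquad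 \|f\|_{\mathscr M^{\mu}_{p,q,r}}=\inf\Big(\sum_{j\le 0}2^{jr\mu}\|f_j\|^r_{M^{[j]}_{p,q}}\Big)^{1/r},$$ the infimum being over all families $(f_j)_{j\le 0}$ in $\mathscr S'$ with $f=\sum_{j\le0}f_j$ in $\mathscr S'$; $\mathfrak M^{\varrho}_{p,q,r}$ and $\mathscr M^{\mu}_{p,q,r}$ are the spaces of all $f\in\mathscr S'$ for which the respective norm is finite. Let $1<p,q,r<\infty$, let $p',q',r'$ be the conjugate exponents, and let $\mu\in\mathbb R$ satisfy $$\min\Big(0,\,d\Big(\frac1q-\frac1p\Big)\Big)\le\mu<d\Big(\frac1p+\frac1q-1\Big).$$ Then, with equivalent norms, $$(\mathscr M^{\mu}_{p,q,r})^*=\mathfrak M^{-\mu}_{p',q',r'}\qquad\text{and}\qquad(\mathfrak M^{-\mu}_{p',q',r'})^*=\mathscr M^{\mu}_{p,q,r}.$$ Here, for spaces $X,Y$ of tempered distributions, $X^*=Y$ with equivalent norms means: $\mathscr S$ is contained and dense in $X$, and there is a linear bijection $T$ from $Y$ onto the space $X^*$ of bounded linear functionals on $X$, bounded with bounded inverse,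 such that $(Tg)(\varphi)=\langle g,\varphi\rangle$ for all $g\in Y$ and $\varphi\in\mathscr S$, where $\langle\cdot,\cdot\rangle$ is the (bilinear) pairing of $\mathscr S'$ and $\mathscr S$. -/

import Mathlib

open MeasureTheory Filter Topology
open scoped ENNReal SchwartzMap

noncomputable section

namespace ScalingLimit

/-! ### Extended seminorms and the spaces of vectors of finite norm -/

/-- The `ℓ^r` norm `(∑ a_i ^ r) ^ (1/r)` of a family of extended nonnegative numbers. -/
def ellNorm {ι : Type*} (r : ℝ) (a : ι → ℝ≥0∞) : ℝ≥0∞ := (∑' i, a i ^ r) ^ (1 / r)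

/-- A seminorm on a complex vector space which may take the value `∞`. -/
structure ExtSeminorm (V : Type*) [AddCommGroup V] [Module ℂ V] where
  toFun : V → ℝ≥0∞
  zero' : toFun 0 = 0
  add_le' : ∀ f g, toFun (f + g) ≤ toFun f + toFun g
  smul_le' : ∀ (c : ℂ) f, toFun (c • f) ≤ ‖c‖ₑ * toFun f

namespace ExtSeminorm

variable {V : Type*} [AddCommGroup V] [Module ℂ V] (N : ExtSeminorm V)

/-- The vectors at which an extended seminorm is finite. -/
def finite : Submodule ℂ V where
  carrier := {f | N.toFun f < ⊤}
  zero_mem' := by simp [N.zero']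
  add_mem' := fun {f g} hf hg => (N.add_le' f g).trans_lt (ENNReal.add_lt_top.2 ⟨hf, hg⟩)
  smul_mem' := fun c f hf =>
    (N.smul_le' c f).trans_lt (ENNReal.mul_lt_top enorm_lt_top hf)

/-- The space `{f : N f < ⊤}`, topologized by the seminorm `N` alone.  (It is a type synonym of the
submodule, so it does not inherit the topology of the ambient space.) -/
def Space : Type _ := N.finite

instance : AddCommGroup N.Space := inferInstanceAs (AddCommGroup N.finite)

instance : Module ℂ N.Space := inferInstanceAs (Module ℂ N.finite)

/-- The inclusion of the space of vectors of finite norm into the ambient space. -/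
def incl : N.Space →ₗ[ℂ] V := N.finite.subtype

theorem incl_injective : Function.Injective N.incl := Subtype.val_injective

theorem incl_lt_top (f : N.Space) : N.toFun (N.incl f) < ⊤ := f.2

/-- A vector of finite norm, as an element of the space. -/
def ofLt (f : V) (hf : N.toFun f < ⊤) : N.Space := ⟨f, hf⟩

@[simp]
theorem incl_ofLt (f : V) (hf : N.toFun f < ⊤) : N.incl (N.ofLt f hf) = f := rfl

theorem neg_le (f : V) : N.toFun (-f) ≤ N.toFun f := by
  simpa using N.smul_le' (-1) f

instance : SeminormedAddCommGroup N.Space :=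
  AddGroupSeminorm.toSeminormedAddCommGroup
    { toFun := fun f => (N.toFun (N.incl f)).toReal
      map_zero' := by simp [N.zero']
      add_le' := fun f g => by
        rw [map_add, ← ENNReal.toReal_add (N.incl_lt_top f).ne (N.incl_lt_top g).ne]
        exact ENNReal.toReal_mono
          (ENNReal.add_lt_top.2 ⟨N.incl_lt_top f, N.incl_lt_top g⟩).ne (N.add_le' _ _)
      neg' := fun f => by
        rw [map_neg]
        congr 1
        refine le_antisymm (N.neg_le _) ?_
        simpa using N.neg_le (-(N.incl f)) }

theorem norm_def (f : N.Space) : ‖f‖ = (N.toFun (N.incl f)).toReal := rfl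

instance : NormedSpace ℂ N.Space where
  norm_smul_le := fun c f => by
    rw [norm_def, norm_def, map_smul, ← toReal_enorm c, ← ENNReal.toReal_mul]
    exact ENNReal.toReal_mono (ENNReal.mul_lt_top enorm_lt_top (N.incl_lt_top f)).ne
      (N.smul_le' _ _)

end ExtSeminorm

/-! ### Frequency decompositions -/

/-- `ψ` is a smooth cut-off function adapted to the unit cube `[-1/2, 1/2]^d`: it vanishes outside
`[-3/4, 3/4]^d` and its integer translates form a partition of unity. -/
structure IsCutoff {d : ℕ} (ψ : EuclideanSpace ℝ (Fin d) → ℝ) : Prop where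
  smooth : ContDiff ℝ ((⊤ : ℕ∞) : WithTop ℕ∞) ψ
  support : ∀ ξ, (∃ i, 3 / 4 < |ξ i|) → ψ ξ = 0
  sum_eq_one : ∀ ξ, HasSum
    (fun k : Fin d → ℤ => ψ (ξ - WithLp.toLp 2 (fun i => (k i : ℝ)))) 1

variable {d : ℕ}

/-- The operator `□_{j,k} = 𝓕⁻¹ ψ(2^{-j} · - k) 𝓕`, where `𝓕` is the Fourier transform with the
kernel `exp(-i x·ξ)`.  Mathlib's Fourier transform has the kernel `exp(-2πi x·ξ)`, hence the
factor `2π` in the symbol. -/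
def box (ψ : EuclideanSpace ℝ (Fin d) → ℝ) (j : ℤ) (k : Fin d → ℤ) :
    𝓢'(EuclideanSpace ℝ (Fin d), ℂ) →L[ℂ] 𝓢'(EuclideanSpace ℝ (Fin d), ℂ) :=
  TemperedDistribution.fourierMultiplierCLM ℂ fun ξ =>
    ((ψ ((2 : ℝ) ^ (-j) • (2 * Real.pi) • ξ - WithLp.toLp 2 (fun i => (k i : ℝ))) : ℝ) : ℂ)

/-- The function `h` represents the tempered distribution `u`. -/
def Represents (h : EuclideanSpace ℝ (Fin d) → ℂ) (u : 𝓢'(EuclideanSpace ℝ (Fin d), ℂ)) : Prop :=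
  ∀ φ : 𝓢(EuclideanSpace ℝ (Fin d), ℂ), u φ = ∫ x, φ x • h x

/-- The `L^p` norm of a tempered distribution; it is `∞` if the distribution is not (given by) a
function in `L^p`. -/
def lpNorm (p : ℝ) (u : 𝓢'(EuclideanSpace ℝ (Fin d), ℂ)) : ℝ≥0∞ :=
  ⨅ (h : EuclideanSpace ℝ (Fin d) → ℂ)
    (_ : MemLp h (ENNReal.ofReal p) volume ∧ Represents h u),
    eLpNorm h (ENNReal.ofReal p) volume

/-- `‖f‖_{M^{[j]}_{p,q}}`, the `ℓ^q` norm in `k` of `‖□_{j,k} f‖_{L^p}`. -/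
def levelNorm (ψ : EuclideanSpace ℝ (Fin d) → ℝ) (p q : ℝ) (j : ℤ)
    (f : 𝓢'(EuclideanSpace ℝ (Fin d), ℂ)) : ℝ≥0∞ :=
  ellNorm q fun k : Fin d → ℤ => lpNorm p (box ψ j k f)

/-- The weighted norm `(∑_{j ≤ 0} 2^{jrs} ‖f_j‖^r_{M^{[j]}_{p,q}})^{1/r}` of a family
`(f_j)_{j ≤ 0}`. -/
def familyNorm (ψ : EuclideanSpace ℝ (Fin d) → ℝ) (s p q r : ℝ)
    (F : Set.Iic (0 : ℤ) → 𝓢'(EuclideanSpace ℝ (Fin d), ℂ)) : ℝ≥0∞ :=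
  ellNorm r fun j : Set.Iic (0 : ℤ) => (2 : ℝ≥0∞) ^ (((j : ℤ) : ℝ) * s) * levelNorm ψ p q j (F j)

/-- The norm of `𝔐^ϱ_{p,q,r}`. -/
def frakNorm (ψ : EuclideanSpace ℝ (Fin d) → ℝ) (ϱ p q r : ℝ)
    (f : 𝓢'(EuclideanSpace ℝ (Fin d), ℂ)) : ℝ≥0∞ :=
  familyNorm ψ ϱ p q r fun _ => f

/-- The norm of `𝓜^μ_{p,q,r}`: the infimum over all decompositions `f = ∑_{j ≤ 0} f_j` in the space
of tempered distributions. -/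
def scrNorm (ψ : EuclideanSpace ℝ (Fin d) → ℝ) (μ p q r : ℝ)
    (f : 𝓢'(EuclideanSpace ℝ (Fin d), ℂ)) : ℝ≥0∞ :=
  ⨅ (F : Set.Iic (0 : ℤ) → 𝓢'(EuclideanSpace ℝ (Fin d), ℂ)) (_ : HasSum F f),
    familyNorm ψ μ p q r F

/-! ### These are extended seminorms -/

section Laws

variable {ι : Type*} {p q r : ℝ}

theorem ellNorm_mono (hr : 0 < r) {a b : ι → ℝ≥0∞} (h : ∀ i, a i ≤ b i) :
    ellNorm r a ≤ ellNorm r b :=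
  ENNReal.rpow_le_rpow
    (ENNReal.tsum_le_tsum fun i => ENNReal.rpow_le_rpow (h i) hr.le) (by positivity)

theorem ellNorm_zero (hr : 0 < r) : ellNorm r (fun _ : ι => 0) = 0 := by
  simp [ellNorm, hr]

theorem ellNorm_add_le (hr : 1 ≤ r) (a b : ι → ℝ≥0∞) :
    ellNorm r (fun i => a i + b i) ≤ ellNorm r a + ellNorm r b := by
  have hr0 : 0 < r := by linarith
  have key : (∑' i, (a i + b i) ^ r) ≤ (ellNorm r a + ellNorm r b) ^ r := by
    rw [ENNReal.tsum_eq_iSup_sum]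
    refine iSup_le fun s => ?_
    have h1 := ENNReal.Lp_add_le s a b hr
    have h2 : (∑ i ∈ s, (a i + b i) ^ r) ^ (1 / r) ≤ ellNorm r a + ellNorm r b :=
      h1.trans (add_le_add
        (ENNReal.rpow_le_rpow (ENNReal.sum_le_tsum s) (by positivity))
        (ENNReal.rpow_le_rpow (ENNReal.sum_le_tsum s) (by positivity)))
    rw [one_div] at h2
    exact (ENNReal.rpow_inv_le_iff hr0).1 h2
  rw [ellNorm, one_div]
  exact (ENNReal.rpow_inv_le_iff hr0).2 key

theorem ellNorm_const_mul (hr : 0 < r) (c : ℝ≥0∞) (a : ι → ℝ≥0∞) :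
    ellNorm r (fun i => c * a i) = c * ellNorm r a := by
  simp only [ellNorm, ENNReal.mul_rpow_of_nonneg _ _ hr.le, ENNReal.tsum_mul_left]
  rw [ENNReal.mul_rpow_of_nonneg _ _ (by positivity), ← ENNReal.rpow_mul,
    mul_one_div_cancel hr.ne', ENNReal.rpow_one]

theorem integrable_schwartz_smul (hp : 1 ≤ p) (φ : 𝓢(EuclideanSpace ℝ (Fin d), ℂ))
    {h : EuclideanSpace ℝ (Fin d) → ℂ} (hh : MemLp h (ENNReal.ofReal p) volume) :
    Integrable (fun x => φ x • h x) volume := by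
  have hp' : 1 ≤ ENNReal.ofReal p := by simpa using hp
  have := ENNReal.HolderConjugate.inv_one_sub_inv' hp'
  have hsymm : ENNReal.HolderConjugate (1 - (ENNReal.ofReal p)⁻¹)⁻¹ (ENNReal.ofReal p) :=
    ENNReal.HolderConjugate.symm
  exact (φ.memLp (1 - (ENNReal.ofReal p)⁻¹)⁻¹ volume).integrable_mul hh

theorem lpNorm_zero : lpNorm p (0 : 𝓢'(EuclideanSpace ℝ (Fin d), ℂ)) = 0 := by
  refine le_antisymm (iInf₂_le_of_le 0 ⟨MemLp.zero, fun φ => ?_⟩ (by simp)) (by simp)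
  simp

theorem lpNorm_add_le (hp : 1 ≤ p) (u v : 𝓢'(EuclideanSpace ℝ (Fin d), ℂ)) :
    lpNorm p (u + v) ≤ lpNorm p u + lpNorm p v := by
  simp only [lpNorm, ENNReal.iInf_add, ENNReal.add_iInf]
  refine le_iInf₂ fun h hh => le_iInf₂ fun g hg => ?_
  refine iInf₂_le_of_le (g + h) ⟨hg.1.add hh.1, fun φ => ?_⟩
    (eLpNorm_add_le hg.1.1 hh.1.1 (ENNReal.one_le_ofReal.2 hp))
  have : (u + v) φ = u φ + v φ := rfl
  rw [this, hg.2 φ, hh.2 φ, ← integral_add (integrable_schwartz_smul hp φ hg.1)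
    (integrable_schwartz_smul hp φ hh.1)]
  simp [mul_add]

theorem lpNorm_smul_le (c : ℂ) (u : 𝓢'(EuclideanSpace ℝ (Fin d), ℂ)) :
    lpNorm p (c • u) ≤ ‖c‖ₑ * lpNorm p u := by
  rcases eq_or_ne c 0 with rfl | hc
  · have h0 : (0 : ℂ) • u = 0 := zero_smul ℂ u
    rw [h0, lpNorm_zero]
    simp
  simp only [lpNorm, ENNReal.mul_iInf_of_ne (enorm_ne_zero.2 hc) enorm_ne_top]
  refine le_iInf₂ fun g hg => ?_
  refine iInf₂_le_of_le (c • g) ⟨hg.1.const_smul c, fun φ => ?_⟩ (eLpNorm_const_smul_le)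
  have : (c • u) φ = c • u φ := rfl
  rw [this, hg.2 φ, ← integral_smul]
  exact integral_congr_ae (Eventually.of_forall fun x => by simp [mul_left_comm])

variable (ψ : EuclideanSpace ℝ (Fin d) → ℝ)

theorem levelNorm_zero (hq : 1 ≤ q) (j : ℤ) : levelNorm ψ p q j 0 = 0 := by
  simp only [levelNorm, map_zero, lpNorm_zero]
  exact ellNorm_zero (by linarith)

theorem levelNorm_add_le (hp : 1 ≤ p) (hq : 1 ≤ q) (j : ℤ)
    (f g : 𝓢'(EuclideanSpace ℝ (Fin d), ℂ)) :
    levelNorm ψ p q j (f + g) ≤ levelNorm ψ p q j f + levelNorm ψ p q j g := by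
  refine le_trans (ellNorm_mono (by linarith) fun k => ?_) (ellNorm_add_le hq _ _)
  rw [map_add]
  exact lpNorm_add_le hp _ _

theorem levelNorm_smul_le (hq : 1 ≤ q) (j : ℤ) (c : ℂ)
    (f : 𝓢'(EuclideanSpace ℝ (Fin d), ℂ)) :
    levelNorm ψ p q j (c • f) ≤ ‖c‖ₑ * levelNorm ψ p q j f := by
  have hq0 : 0 < q := by linarith
  rw [levelNorm, levelNorm, ← ellNorm_const_mul hq0]
  refine ellNorm_mono hq0 fun k => ?_
  rw [map_smul]
  exact lpNorm_smul_le _ _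

variable (s : ℝ)

theorem familyNorm_zero (hq : 1 ≤ q) (hr : 1 ≤ r) : familyNorm ψ s p q r (fun _ => 0) = 0 := by
  simp only [familyNorm, levelNorm_zero ψ hq, mul_zero]
  exact ellNorm_zero (by linarith)

theorem familyNorm_add_le (hp : 1 ≤ p) (hq : 1 ≤ q) (hr : 1 ≤ r)
    (F G : Set.Iic (0 : ℤ) → 𝓢'(EuclideanSpace ℝ (Fin d), ℂ)) :
    familyNorm ψ s p q r (fun j => F j + G j) ≤
      familyNorm ψ s p q r F + familyNorm ψ s p q r G := by
  refine le_trans (ellNorm_mono (by linarith) fun j => ?_) (ellNorm_add_le hr _ _)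
  rw [← mul_add]
  exact mul_le_mul_right (levelNorm_add_le ψ hp hq _ _ _) _

theorem familyNorm_smul_le (hq : 1 ≤ q) (hr : 1 ≤ r) (c : ℂ)
    (F : Set.Iic (0 : ℤ) → 𝓢'(EuclideanSpace ℝ (Fin d), ℂ)) :
    familyNorm ψ s p q r (fun j => c • F j) ≤ ‖c‖ₑ * familyNorm ψ s p q r F := by
  have hr0 : 0 < r := by linarith
  rw [familyNorm, familyNorm, ← ellNorm_const_mul hr0]
  refine ellNorm_mono hr0 fun j => ?_
  rw [mul_left_comm]
  exact mul_le_mul_right (levelNorm_smul_le ψ hq _ _ _) _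

end Laws

/-! ### The spaces and their duality -/

/-- `‖·‖_{𝔐^ϱ_{p,q,r}}` as an extended seminorm on tempered distributions; its `Space` is
the space `𝔐^ϱ_{p,q,r}`. -/
def frakSeminorm (ψ : EuclideanSpace ℝ (Fin d) → ℝ) (ϱ : ℝ) {p q r : ℝ}
    (hp : 1 ≤ p) (hq : 1 ≤ q) (hr : 1 ≤ r) :
    ExtSeminorm 𝓢'(EuclideanSpace ℝ (Fin d), ℂ) where
  toFun := frakNorm ψ ϱ p q r
  zero' := familyNorm_zero ψ ϱ hq hr
  add_le' := fun _ _ => familyNorm_add_le ψ ϱ hp hq hr _ _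
  smul_le' := fun c _ => familyNorm_smul_le ψ ϱ hq hr c _

/-- `‖·‖_{𝓜^μ_{p,q,r}}` as an extended seminorm on tempered distributions; its `Space` is
the space `𝓜^μ_{p,q,r}`. -/
def scrSeminorm (ψ : EuclideanSpace ℝ (Fin d) → ℝ) (μ : ℝ) {p q r : ℝ}
    (hp : 1 ≤ p) (hq : 1 ≤ q) (hr : 1 ≤ r) :
    ExtSeminorm 𝓢'(EuclideanSpace ℝ (Fin d), ℂ) where
  toFun := scrNorm ψ μ p q r
  zero' := le_antisymm
    (iInf₂_le_of_le (fun _ => 0) hasSum_zero (familyNorm_zero ψ μ hq hr).le) (by simp)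
  add_le' := fun f g => by
    simp only [scrNorm, ENNReal.iInf_add, ENNReal.add_iInf]
    exact le_iInf₂ fun G hG => le_iInf₂ fun F hF =>
      iInf₂_le_of_le (fun j => F j + G j) (hF.add hG) (familyNorm_add_le ψ μ hp hq hr _ _)
  smul_le' := fun c f => by
    rcases eq_or_ne c 0 with rfl | hc
    · refine le_trans (iInf₂_le_of_le (fun _ => 0) ?_ (familyNorm_zero ψ μ hq hr).le) (by simp)
      have h0 : (0 : ℂ) • f = 0 := zero_smul ℂ f
      rw [h0]
      exact hasSum_zero
    simp only [scrNorm, ENNReal.mul_iInf_of_ne (enorm_ne_zero.2 hc) enorm_ne_top]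
    exact le_iInf₂ fun F hF =>
      iInf₂_le_of_le (fun j => c • F j) (hF.const_smul c) (familyNorm_smul_le ψ μ hq hr c _)

/-- The tempered distribution `φ ↦ ∫ φ η` given by a Schwartz function `η`. -/
abbrev ofSchwartz (η : 𝓢(EuclideanSpace ℝ (Fin d), ℂ)) : 𝓢'(EuclideanSpace ℝ (Fin d), ℂ) :=
  SchwartzMap.toTemperedDistributionCLM (EuclideanSpace ℝ (Fin d)) ℂ volume η

/-- The Schwartz functions are contained and dense in the space `{f : N f < ⊤}`. -/
def SchwartzDense (N : ExtSeminorm 𝓢'(EuclideanSpace ℝ (Fin d), ℂ)) : Prop :=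
  (∀ φ : 𝓢(EuclideanSpace ℝ (Fin d), ℂ), N.toFun (ofSchwartz φ) < ⊤) ∧
    Dense {f : N.Space | ∃ φ : 𝓢(EuclideanSpace ℝ (Fin d), ℂ), N.incl f = ofSchwartz φ}

/-- `X* = Y` with equivalent norms, for the spaces `X`, `Y` of tempered distributions on which `N`
and `L` are finite: the Schwartz functions are dense in `X` (so that a continuous functional on `X`
is determined by its values on them), and there is an isomorphism `T` of topological vector spaces
from `Y` onto the dual of `X` (linear, bijective, bounded with bounded inverse) such that the
functional `T g` is the extension of the tempered distribution `g` to `X`. -/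
def DualEq (N L : ExtSeminorm 𝓢'(EuclideanSpace ℝ (Fin d), ℂ)) : Prop :=
  SchwartzDense N ∧
    ∃ T : L.Space ≃L[ℂ] StrongDual ℂ N.Space,
      ∀ (g : L.Space) (f : N.Space) (φ : 𝓢(EuclideanSpace ℝ (Fin d), ℂ)),
        N.incl f = ofSchwartz φ → T g f = L.incl g φ

end ScalingLimit

end

open MeasureTheory Filter Topology
open scoped ENNReal SchwartzMap

noncomputable section

namespace ScalingLimit

/-! ### Sequence norms -/

section SequenceNorms

variable {ι κ : Type*} {p q r : ℝ}

theorem ellNorm_rpow (hr : 0 < r) (a : ι → ℝ≥0∞) : ellNorm r a ^ r = ∑' i, a i ^ r := by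
  rw [ellNorm, ← ENNReal.rpow_mul, one_div_mul_cancel hr.ne', ENNReal.rpow_one]

theorem ellNorm_le_iff (hr : 0 < r) {a : ι → ℝ≥0∞} {C : ℝ≥0∞} :
    ellNorm r a ≤ C ↔ ∑' i, a i ^ r ≤ C ^ r := by
  rw [← ellNorm_rpow hr, ENNReal.rpow_le_rpow_iff hr]

theorem ellNorm_eq_top_iff (hr : 0 < r) {a : ι → ℝ≥0∞} :
    ellNorm r a = ⊤ ↔ ∑' i, a i ^ r = ⊤ := by
  rw [← ellNorm_rpow hr, ENNReal.rpow_eq_top_iff_of_pos hr]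

theorem le_ellNorm (hr : 0 < r) (a : ι → ℝ≥0∞) (i : ι) : a i ≤ ellNorm r a := by
  rw [← ENNReal.rpow_le_rpow_iff hr, ellNorm_rpow hr]
  exact ENNReal.le_tsum i

theorem tsum_mul_le_ellNorm (hpq : p.HolderConjugate q) (a b : ι → ℝ≥0∞) :
    ∑' i, a i * b i ≤ ellNorm p a * ellNorm q b := by
  rw [ENNReal.tsum_eq_iSup_sum]
  refine iSup_le fun s => (ENNReal.inner_le_Lp_mul_Lq s a b hpq).trans ?_
  have hp := hpq.pos
  have hq := hpq.symm.pos
  exact mul_le_mul' (ENNReal.rpow_le_rpow (ENNReal.sum_le_tsum s) (by positivity))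
    (ENNReal.rpow_le_rpow (ENNReal.sum_le_tsum s) (by positivity))

/-- A matrix of zeros and ones with at most `n` ones in each row and at most `m` ones in each
column is bounded on `ℓ^q` with norm at most `(n ^ (q - 1) * m) ^ (1 / q)`. -/
theorem ellNorm_le_of_overlap (hq : 1 ≤ q) {a : ι → ℝ≥0∞} {b : κ → ℝ≥0∞} {C n m : ℝ≥0∞}
    (N : ι → Finset κ) (M : κ → Finset ι) (hN : ∀ i, ((N i).card : ℝ≥0∞) ≤ n)
    (hM : ∀ k, ((M k).card : ℝ≥0∞) ≤ m) (hNM : ∀ i k, k ∈ N i → i ∈ M k)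
    (hab : ∀ i, a i ≤ C * ∑ k ∈ N i, b k) :
    ellNorm q a ≤ C * (n ^ (q - 1) * m) ^ (1 / q) * ellNorm q b := by
  classical
  have hq0 : 0 < q := by linarith
  rw [ellNorm_le_iff hq0, ENNReal.mul_rpow_of_nonneg _ _ hq0.le,
    ENNReal.mul_rpow_of_nonneg _ _ hq0.le, ← ENNReal.rpow_mul, one_div_mul_cancel hq0.ne',
    ENNReal.rpow_one, ellNorm_rpow hq0]
  have h1 : ∀ i, a i ^ q ≤ C ^ q * n ^ (q - 1) * ∑' k, if k ∈ N i then b k ^ q else 0 := by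
    intro i
    have hs : ∑' k, (if k ∈ N i then b k ^ q else 0) = ∑ k ∈ N i, b k ^ q := by
      rw [tsum_eq_sum (s := N i) (fun k hk => by simp [hk])]
      exact Finset.sum_congr rfl fun k hk => by simp [hk]
    rw [hs]
    calc a i ^ q ≤ (C * ∑ k ∈ N i, b k) ^ q := ENNReal.rpow_le_rpow (hab i) hq0.le
      _ = C ^ q * (∑ k ∈ N i, b k) ^ q := ENNReal.mul_rpow_of_nonneg _ _ hq0.le
      _ ≤ C ^ q * (((N i).card : ℝ≥0∞) ^ (q - 1) * ∑ k ∈ N i, b k ^ q) := by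
          gcongr
          exact ENNReal.rpow_sum_le_const_mul_sum_rpow _ _ hq
      _ ≤ C ^ q * (n ^ (q - 1) * ∑ k ∈ N i, b k ^ q) := by
          gcongr C ^ q * (?_ * _)
          exact ENNReal.rpow_le_rpow (hN i) (by linarith)
      _ = _ := by rw [mul_assoc]
  calc ∑' i, a i ^ q
      ≤ ∑' i, C ^ q * n ^ (q - 1) * ∑' k, if k ∈ N i then b k ^ q else 0 :=
        ENNReal.tsum_le_tsum h1
    _ = C ^ q * n ^ (q - 1) * ∑' k, ∑' i, if k ∈ N i then b k ^ q else 0 := by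
        rw [ENNReal.tsum_mul_left, ENNReal.tsum_comm]
    _ ≤ C ^ q * n ^ (q - 1) * ∑' k, m * b k ^ q := by
        gcongr with k
        calc ∑' i, (if k ∈ N i then b k ^ q else 0)
            ≤ ∑' i, (if i ∈ M k then b k ^ q else 0) := by
              refine ENNReal.tsum_le_tsum fun i => ?_
              by_cases h : k ∈ N i
              · simp [h, hNM i k h]
              · simp [h]
          _ = ∑ i ∈ M k, b k ^ q := by
              rw [tsum_eq_sum (s := M k) (fun i hi => by simp [hi])]
              exact Finset.sum_congr rfl fun i hi => by simp [hi]
          _ = (M k).card * b k ^ q := by simp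
          _ ≤ m * b k ^ q := by gcongr; exact hM k
    _ = _ := by rw [ENNReal.tsum_mul_left]; ring

/-- Dominated convergence for `ℓ^r` norms. -/
theorem tendsto_ellNorm_zero {α : Type*} {l : Filter α} (hr : 0 < r) {a : α → ι → ℝ≥0∞}
    {b : ι → ℝ≥0∞} (hb : ellNorm r b ≠ ⊤) (hab : ∀ᶠ n in l, ∀ i, a n i ≤ b i)
    (ha : ∀ i, Tendsto (fun n => a n i) l (𝓝 0)) :
    Tendsto (fun n => ellNorm r (a n)) l (𝓝 0) := by
  have key : Tendsto (fun n => ∑' i, a n i ^ r) l (𝓝 0) := by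
    rw [ENNReal.tendsto_nhds_zero]
    intro ε hε
    have hb' : ∑' i, b i ^ r ≠ ⊤ := fun h => hb ((ellNorm_eq_top_iff hr).2 h)
    have htail := ENNReal.tendsto_tsum_compl_atTop_zero hb'
    have hε2 : 0 < ε / 2 := ENNReal.half_pos hε.ne'
    obtain ⟨s, hs⟩ := ((ENNReal.tendsto_nhds_zero.1 htail) _ hε2).exists
    have hfin : Tendsto (fun n => ∑ i ∈ s, a n i ^ r) l (𝓝 0) := by
      have : Tendsto (fun n => ∑ i ∈ s, a n i ^ r) l (𝓝 (∑ i ∈ s, (0 : ℝ≥0∞) ^ r)) :=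
        tendsto_finsetSum _ fun i _ => (ENNReal.continuous_rpow_const.tendsto 0).comp (ha i)
      simpa [hr] using this
    filter_upwards [hab, (ENNReal.tendsto_nhds_zero.1 hfin) _ hε2] with n hn hn2
    rw [← ENNReal.sum_add_tsum_compl s, ← ENNReal.add_halves ε]
    refine add_le_add hn2 (le_trans ?_ hs)
    exact ENNReal.tsum_le_tsum fun i => ENNReal.rpow_le_rpow (hn i) hr.le
  have := (ENNReal.continuous_rpow_const (y := 1 / r)).tendsto 0 |>.comp key
  rw [ENNReal.zero_rpow_of_pos (by positivity)] at this
  exact this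

theorem ellNorm_le_of_forall_finset (hr : 0 < r) {a : ι → ℝ≥0∞} {C : ℝ≥0∞}
    (h : ∀ s : Finset ι, (∑ i ∈ s, a i ^ r) ^ (1 / r) ≤ C) : ellNorm r a ≤ C := by
  rw [ellNorm_le_iff hr, ENNReal.tsum_eq_iSup_sum]
  refine iSup_le fun s => ?_
  rw [← ENNReal.rpow_le_rpow_iff (z := 1 / r) (by positivity), ← ENNReal.rpow_mul,
    mul_one_div_cancel hr.ne', ENNReal.rpow_one]
  exact h s

theorem ellNorm_eq_of_support (hr : 0 < r) {a : ι → ℝ≥0∞} (s : Finset ι)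
    (h : ∀ i ∉ s, a i = 0) : ellNorm r a = (∑ i ∈ s, a i ^ r) ^ (1 / r) := by
  rw [ellNorm, tsum_eq_sum (s := s)]
  intro i hi
  simp [h i hi, hr]

theorem ellNorm_single_le [DecidableEq ι] (hr : 0 < r) (i : ι) (c : ℝ≥0∞) :
    ellNorm r (fun j => if j = i then c else 0) = c := by
  rw [ellNorm_eq_of_support hr {i} (by simp +contextual)]
  simp [← ENNReal.rpow_mul, hr.ne']

/-- The finite form of the duality between `ℓ^p` and `ℓ^q`. -/
theorem exists_dual_family (hpq : p.HolderConjugate q) (s : Finset ι) {b : ι → ℝ≥0∞}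
    (hb : ∀ i, b i ≠ ⊤) : ∃ t : ι → ℝ≥0∞, (∀ i, t i ≠ ⊤) ∧ ∑ i ∈ s, t i ^ q ≤ 1 ∧
      ∑ i ∈ s, b i * t i = (∑ i ∈ s, b i ^ p) ^ (1 / p) := by
  obtain ⟨t, ht, hbt⟩ := (NNReal.isGreatest_Lp s (fun i => (b i).toNNReal) hpq).1
  have hp := hpq.pos
  have hq := hpq.symm.pos
  refine ⟨fun i => t i, by simp, ?_, ?_⟩
  · have : ((∑ i ∈ s, t i ^ q : NNReal) : ℝ≥0∞) ≤ 1 := by exact_mod_cast ht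
    simpa [ENNReal.coe_rpow_of_nonneg _ hq.le] using this
  · have h := congrArg (fun x : NNReal => (x : ℝ≥0∞)) hbt
    simp only [ENNReal.ofNNReal_finsetSum, ENNReal.coe_mul,
      ENNReal.coe_rpow_of_nonneg _ hp.le,
      ENNReal.coe_rpow_of_nonneg _ (show (0 : ℝ) ≤ 1 / p by positivity), ENNReal.coe_toNNReal (hb _)] at h
    exact h

end SequenceNorms

/-! ### Duality for mixed sequence norms -/

section MixedDual

variable {I K V : Type*} [AddCommGroup V] [Module ℂ V] {q q' r r' : ℝ}

/-- The norm of a linear functional with respect to `ν`. -/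
def dualNorm (ν : V → ℝ≥0∞) (Λ : V →ₗ[ℂ] ℂ) : ℝ≥0∞ := ⨆ (v : V) (_ : ν v ≤ 1), ‖Λ v‖ₑ

theorem enorm_le_dualNorm_mul {ν : V → ℝ≥0∞} (hν : ∀ v, ν v ≠ ⊤)
    (hνs : ∀ (c : ℂ) v, ν (c • v) ≤ ‖c‖ₑ * ν v) {Λ : V →ₗ[ℂ] ℂ}
    (h0 : ∀ v, ν v = 0 → Λ v = 0) (v : V) : ‖Λ v‖ₑ ≤ dualNorm ν Λ * ν v := by
  rcases eq_or_ne (ν v) 0 with hv | hv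
  · simp [h0 v hv]
  set c : ℂ := (((ν v).toReal⁻¹ : ℝ) : ℂ) with hc
  have hpos : 0 < (ν v).toReal := ENNReal.toReal_pos hv (hν v)
  have hce : ‖c‖ₑ = (ν v)⁻¹ := by
    rw [hc, ← ofReal_norm, Complex.norm_real, Real.norm_of_nonneg (by positivity),
      ENNReal.ofReal_inv_of_pos hpos, ENNReal.ofReal_toReal (hν v)]
  have h1 : ν (c • v) ≤ 1 := (hνs c v).trans (by rw [hce, ENNReal.inv_mul_cancel hv (hν v)])
  have h2 : ‖Λ (c • v)‖ₑ ≤ dualNorm ν Λ := le_iSup₂_of_le (c • v) h1 le_rfl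
  rw [map_smul, smul_eq_mul, enorm_mul, hce] at h2
  calc ‖Λ v‖ₑ = (ν v)⁻¹ * ‖Λ v‖ₑ * ν v := by
        rw [mul_right_comm, ENNReal.inv_mul_cancel hv (hν v), one_mul]
    _ ≤ _ := by gcongr

theorem exists_seq_tendsto_dualNorm {ν : V → ℝ≥0∞} (h0 : ν 0 = 0) (Λ : V →ₗ[ℂ] ℂ) :
    ∃ v : ℕ → V, (∀ n, ν (v n) ≤ 1) ∧
      Tendsto (fun n => ‖Λ (v n)‖ₑ) atTop (𝓝 (dualNorm ν Λ)) := by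
  have hne : ((fun v => ‖Λ v‖ₑ) '' {v | ν v ≤ 1}).Nonempty := ⟨_, 0, by simp [h0], rfl⟩
  obtain ⟨u, -, hu, hmem⟩ := exists_seq_tendsto_sSup hne (OrderTop.bddAbove _)
  choose v hv hvu using hmem
  refine ⟨v, hv, ?_⟩
  rw [sSup_image] at hu
  exact hu.congr fun n => (hvu n).symm

variable {ν : V → ℝ≥0∞} {w : I → ℝ≥0∞} {Λ : I → K → V →ₗ[ℂ] ℂ} {C : ℝ≥0∞}

open scoped Classical in
theorem sum_dualNorm_mul_le (hνs : ∀ (c : ℂ) v, ν (c • v) ≤ ‖c‖ₑ * ν v) (hq : 0 < q) (hr : 0 < r)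
    (h : ∀ (s : Finset I) (t : Finset K) (x : I → K → V), (∀ i k, i ∉ s ∨ k ∉ t → x i k = 0) →
      ‖∑ i ∈ s, ∑ k ∈ t, Λ i k (x i k)‖ₑ ≤
        C * ellNorm r fun i => w i * ellNorm q fun k => ν (x i k))
    (s : Finset I) (t : Finset K) (τ : I → K → ℝ≥0∞) (hτ : ∀ i k, τ i k ≠ ⊤) :
    ∑ i ∈ s, ∑ k ∈ t, dualNorm ν (Λ i k) * τ i k ≤
      C * ellNorm r fun i => w i * ellNorm q fun k => if i ∈ s ∧ k ∈ t then τ i k else 0 := by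
  have h0 : ν 0 = 0 := by simpa using hνs 0 0
  choose v hv hlim using fun i k => exists_seq_tendsto_dualNorm h0 (Λ i k)
  have hT : Tendsto (fun n => ∑ i ∈ s, ∑ k ∈ t, ‖Λ i k (v i k n)‖ₑ * τ i k) atTop
      (𝓝 (∑ i ∈ s, ∑ k ∈ t, dualNorm ν (Λ i k) * τ i k)) :=
    tendsto_finsetSum _ fun i _ => tendsto_finsetSum _ fun k _ =>
      ENNReal.Tendsto.mul_const (hlim i k) (Or.inr (hτ i k))
  refine le_of_tendsto' hT fun n => ?_
  choose θ hθ hθ' using fun i k => RCLike.exists_norm_eq_mul_self (Λ i k (v i k n))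
  set x : I → K → V := fun i k =>
    if i ∈ s ∧ k ∈ t then (((τ i k).toReal : ℂ) * θ i k) • v i k n else 0 with hx
  have hsum : ∑ i ∈ s, ∑ k ∈ t, Λ i k (x i k) =
      ((∑ i ∈ s, ∑ k ∈ t, (τ i k).toReal * ‖Λ i k (v i k n)‖ : ℝ) : ℂ) := by
    push_cast
    refine Finset.sum_congr rfl fun i hi => Finset.sum_congr rfl fun k hk => ?_
    simp only [hx, hi, hk, and_self, if_true, map_smul, smul_eq_mul]
    rw [mul_assoc, ← hθ' i k]
    rfl
  have hle := h s t x fun i k hik => by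
    have : ¬ (i ∈ s ∧ k ∈ t) := by tauto
    simp [hx, this]
  rw [hsum, ← ofReal_norm, Complex.norm_real, Real.norm_of_nonneg (by positivity),
    ENNReal.ofReal_sum_of_nonneg (fun i _ => by positivity)] at hle
  calc ∑ i ∈ s, ∑ k ∈ t, ‖Λ i k (v i k n)‖ₑ * τ i k
      = ∑ i ∈ s, ENNReal.ofReal (∑ k ∈ t, (τ i k).toReal * ‖Λ i k (v i k n)‖) := by
        refine Finset.sum_congr rfl fun i _ => ?_
        rw [ENNReal.ofReal_sum_of_nonneg (fun k _ => by positivity)]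
        refine Finset.sum_congr rfl fun k _ => ?_
        rw [ENNReal.ofReal_mul (by positivity), ENNReal.ofReal_toReal (hτ i k), ofReal_norm,
          mul_comm]
    _ ≤ _ := hle
    _ ≤ _ := by
        gcongr
        refine ellNorm_mono hr fun i => ?_
        gcongr
        refine ellNorm_mono hq fun k => ?_
        by_cases hik : i ∈ s ∧ k ∈ t
        · simp only [hx, hik, and_self, if_true]
          refine (hνs _ _).trans ?_
          rw [enorm_mul, ← ofReal_norm (θ i k), hθ, ← ofReal_norm, Complex.norm_real,
            Real.norm_of_nonneg (by positivity), ENNReal.ofReal_toReal (hτ i k)]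
          calc _ ≤ τ i k * ENNReal.ofReal 1 * 1 := by gcongr; exact hv i k n
            _ = _ := by simp
        · simp [hx, hik, h0]

/-- The dual norms of the components of a functional which is bounded for a mixed norm of
`ℓ^r(ℓ^q)` type have a finite mixed norm of `ℓ^{r'}(ℓ^{q'})` type. -/
theorem mixed_dualNorm_le (hν : ∀ v, ν v ≠ ⊤) (hνs : ∀ (c : ℂ) v, ν (c • v) ≤ ‖c‖ₑ * ν v)
    (hw0 : ∀ i, w i ≠ 0) (hwt : ∀ i, w i ≠ ⊤) (hq : q.HolderConjugate q')
    (hr : r.HolderConjugate r') (hC : C ≠ ⊤)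
    (h : ∀ (s : Finset I) (t : Finset K) (x : I → K → V), (∀ i k, i ∉ s ∨ k ∉ t → x i k = 0) →
      ‖∑ i ∈ s, ∑ k ∈ t, Λ i k (x i k)‖ₑ ≤
        C * ellNorm r fun i => w i * ellNorm q fun k => ν (x i k)) :
    (∀ i k v, ‖Λ i k v‖ₑ ≤ dualNorm ν (Λ i k) * ν v) ∧
      ellNorm r' (fun i => (w i)⁻¹ * ellNorm q' fun k => dualNorm ν (Λ i k)) ≤ C := by
  classical
  have hq0 := hq.pos
  have hr0 := hr.pos
  have hq0' := hq.symm.pos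
  have hr0' := hr.symm.pos
  have h0 : ν 0 = 0 := by simpa using hνs 0 0
  have hsingle : ∀ i k v, ‖Λ i k v‖ₑ ≤ C * (w i * ν v) := by
    intro i k v
    have := h {i} {k} (fun i' k' => if i' = i then (if k' = k then v else 0) else 0) (by
      intro i' k' hik
      rcases hik with hik | hik
      · simp only [Finset.mem_singleton] at hik; simp [hik]
      · simp only [Finset.mem_singleton] at hik; simp [hik])
    refine (le_of_eq ?_).trans (this.trans ?_)
    · simp
    · gcongr
      refine le_of_eq ?_
      rw [← ellNorm_single_le hr0 i (w i * ν v)]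
      congr 1
      ext i'
      by_cases hi : i' = i
      · subst hi
        simp only [if_true]
        congr 1
        rw [← ellNorm_single_le hq0 k (ν v)]
        congr 1
        ext k'
        split_ifs <;> simp [h0]
      · simp [hi, h0, ellNorm_zero hq0]
  have hfin : ∀ i k, dualNorm ν (Λ i k) ≠ ⊤ := by
    intro i k
    refine ne_top_of_le_ne_top (ENNReal.mul_ne_top hC (hwt i)) (iSup₂_le fun v hv => ?_)
    refine (hsingle i k v).trans ?_
    gcongr
    exact mul_le_of_le_one_right' hv
  refine ⟨fun i k v => enorm_le_dualNorm_mul hν hνs (fun u hu => ?_) v, ?_⟩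
  · simpa [hu] using hsingle i k u
  have hst : ∀ (s : Finset I) (t : Finset K),
      (∑ i ∈ s, ((w i)⁻¹ * (∑ k ∈ t, dualNorm ν (Λ i k) ^ q') ^ (1 / q')) ^ r') ^ (1 / r') ≤ C := by
    intro s t
    choose τ hτ hτ1 hτs using fun i => exists_dual_family hq.symm t (hfin i)
    have hB : ∀ i, (w i)⁻¹ * (∑ k ∈ t, dualNorm ν (Λ i k) ^ q') ^ (1 / q') ≠ ⊤ := fun i =>
      ENNReal.mul_ne_top (ENNReal.inv_ne_top.2 (hw0 i))
        (ENNReal.rpow_ne_top_of_nonneg (by positivity)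
          (ENNReal.sum_ne_top.2 fun k _ => ENNReal.rpow_ne_top_of_nonneg hq0'.le (hfin i k)))
    obtain ⟨σ, hσ, hσ1, hσs⟩ := exists_dual_family hr.symm s hB
    rw [← hσs]
    calc ∑ i ∈ s, (w i)⁻¹ * (∑ k ∈ t, dualNorm ν (Λ i k) ^ q') ^ (1 / q') * σ i
        = ∑ i ∈ s, ∑ k ∈ t, dualNorm ν (Λ i k) * (σ i * (w i)⁻¹ * τ i k) := by
          refine Finset.sum_congr rfl fun i _ => ?_
          rw [← hτs i, Finset.mul_sum, Finset.sum_mul]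
          exact Finset.sum_congr rfl fun k _ => by ring
      _ ≤ _ := sum_dualNorm_mul_le hνs hq0 hr0 h s t _ fun i k =>
          ENNReal.mul_ne_top (ENNReal.mul_ne_top (hσ i) (ENNReal.inv_ne_top.2 (hw0 i))) (hτ i k)
      _ ≤ C * 1 := by
          gcongr
          rw [ellNorm_le_iff hr0, ENNReal.one_rpow]
          calc ∑' i, (w i * ellNorm q fun k =>
                if i ∈ s ∧ k ∈ t then σ i * (w i)⁻¹ * τ i k else 0) ^ r
              ≤ ∑' i, (if i ∈ s then σ i ^ r else 0) := by
                refine ENNReal.tsum_le_tsum fun i => ?_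
                by_cases hi : i ∈ s
                · simp only [hi, true_and, if_true]
                  refine ENNReal.rpow_le_rpow ?_ hr0.le
                  have : ∀ k, (if k ∈ t then σ i * (w i)⁻¹ * τ i k else 0) =
                      σ i * (w i)⁻¹ * (if k ∈ t then τ i k else 0) := fun k => by
                    split_ifs <;> simp
                  simp only [this]
                  rw [ellNorm_const_mul hq0]
                  have h1 : ellNorm q (fun k => if k ∈ t then τ i k else 0) ≤ 1 := by
                    rw [ellNorm_le_iff hq0, ENNReal.one_rpow,
                      tsum_eq_sum (s := t) (fun k hk => by simp [hk, hq0])]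
                    refine le_trans (le_of_eq ?_) (hτ1 i)
                    exact Finset.sum_congr rfl fun k hk => by simp [hk]
                  calc w i * (σ i * (w i)⁻¹ * ellNorm q fun k => if k ∈ t then τ i k else 0)
                      ≤ w i * (σ i * (w i)⁻¹ * 1) := by gcongr
                    _ = σ i * (w i * (w i)⁻¹) := by ring
                    _ = σ i := by rw [ENNReal.mul_inv_cancel (hw0 i) (hwt i), mul_one]
                · simp [hi, ellNorm_zero hq0, hr0]
            _ = ∑ i ∈ s, σ i ^ r := by
                rw [tsum_eq_sum (s := s) (fun k hk => by simp [hk])]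
                exact Finset.sum_congr rfl fun k hk => by simp [hk]
            _ ≤ 1 := hσ1
      _ = C := mul_one C
  refine ellNorm_le_of_forall_finset hr0' fun s => ?_
  refine le_of_tendsto' (x := (atTop : Filter (Finset K))) (f := fun t =>
    (∑ i ∈ s, ((w i)⁻¹ * (∑ k ∈ t, dualNorm ν (Λ i k) ^ q') ^ (1 / q')) ^ r') ^ (1 / r')) ?_
    fun t => hst s t
  refine (ENNReal.continuous_rpow_const.tendsto _).comp (tendsto_finsetSum _ fun i _ => ?_)
  refine (ENNReal.continuous_rpow_const.tendsto _).comp ?_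
  refine ENNReal.Tendsto.const_mul ?_ (Or.inr (ENNReal.inv_ne_top.2 (hw0 i)))
  exact (ENNReal.continuous_rpow_const.tendsto _).comp ENNReal.summable.hasSum

end MixedDual

/-! ### The dual of `L^p` -/

section LpDual

variable {α : Type*} [MeasurableSpace α] {μ : Measure α}

/-- Dominated convergence in `L^p`. -/
theorem tendsto_eLpNorm_zero_of_dominated {β : Type*} {l : Filter β} [l.IsCountablyGenerated]
    {p : ℝ≥0∞} (hp0 : p ≠ 0) (hp : p ≠ ⊤) {F : β → α → ℂ} {G : α → ℂ}
    (hF : ∀ n, AEStronglyMeasurable (F n) μ) (hG : MemLp G p μ)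
    (hFG : ∀ n, ∀ᵐ x ∂μ, ‖F n x‖ₑ ≤ ‖G x‖ₑ)
    (hlim : ∀ᵐ x ∂μ, Tendsto (fun n => F n x) l (𝓝 0)) :
    Tendsto (fun n => eLpNorm (F n) p μ) l (𝓝 0) := by
  have hpos : 0 < p.toReal := ENNReal.toReal_pos hp0 hp
  have key : Tendsto (fun n => ∫⁻ x, ‖F n x‖ₑ ^ p.toReal ∂μ) l (𝓝 (∫⁻ _, 0 ∂μ)) := by
    refine tendsto_lintegral_filter_of_dominated_convergence' (fun x => ‖G x‖ₑ ^ p.toReal)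
      (Eventually.of_forall fun n => ((hF n).enorm.pow_const _))
      (Eventually.of_forall fun n => ?_) ?_ ?_
    · filter_upwards [hFG n] with x hx using ENNReal.rpow_le_rpow hx hpos.le
    · exact (lintegral_rpow_enorm_lt_top_of_eLpNorm_lt_top hp0 hp hG.2).ne
    · filter_upwards [hlim] with x hx
      have := (ENNReal.continuous_rpow_const (y := p.toReal)).tendsto 0
      rw [ENNReal.zero_rpow_of_pos hpos] at this
      refine this.comp ?_
      simpa using hx.enorm
  have h2 := ((ENNReal.continuous_rpow_const (y := 1 / p.toReal)).tendsto _).comp key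
  rw [lintegral_zero, ENNReal.zero_rpow_of_pos (by positivity)] at h2
  refine h2.congr fun n => ?_
  rw [eLpNorm_eq_lintegral_rpow_enorm_toReal hp0 hp]
  rfl

theorem MemLp.mul_of_bound {p : ℝ≥0∞} {φ w : α → ℂ} (hφ : AEStronglyMeasurable φ μ) {c : ℝ}
    (hc : ∀ x, ‖φ x‖ ≤ c) (hw : MemLp w p μ) : MemLp (fun x => φ x * w x) p μ := by
  refine hw.of_le_mul (c := c) (hφ.mul hw.1) (Eventually.of_forall fun x => ?_)
  rw [norm_mul]
  gcongr
  exact hc x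

variable {p : ℝ≥0∞} [Fact (1 ≤ p)]

theorem hasSum_toLp_indicator (hp : p ≠ ⊤) {w : α → ℂ} (hw : MemLp w p μ) {f : ℕ → Set α}
    (hf : ∀ i, MeasurableSet (f i)) (hd : Pairwise (Function.onFun Disjoint f)) :
    HasSum (fun i => (hw.indicator (hf i)).toLp _)
      ((hw.indicator (MeasurableSet.iUnion hf)).toLp _) := by
  have hp0 : p ≠ 0 := (zero_lt_one.trans_le (Fact.out : 1 ≤ p)).ne'
  have hs : ∀ s : Finset ℕ, MeasurableSet (⋃ i ∈ s, f i) := fun s =>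
    s.measurableSet_biUnion fun i _ => hf i
  have h1 : ∀ s : Finset ℕ, ∑ i ∈ s, (hw.indicator (hf i)).toLp _ =
      (hw.indicator (hs s)).toLp _ := by
    intro s
    have h : ∀ᵐ x ∂μ, ∀ i, (hw.indicator (hf i)).toLp _ x = (f i).indicator w x :=
      ae_all_iff.2 fun i => (hw.indicator (hf i)).coeFn_toLp
    ext1
    filter_upwards [h, Lp.coeFn_finsetSum s (fun i => (hw.indicator (hf i)).toLp _),
      (hw.indicator (hs s)).coeFn_toLp] with x hx h2 h3
    rw [h2, h3, Finset.sum_apply, Finset.indicator_biUnion_apply]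
    · exact Finset.sum_congr rfl fun i _ => hx i
    · exact fun i _ j _ hij => hd hij
  have hsub : ∀ (s : Finset ℕ) x, x ∉ ⋃ i, f i → x ∉ ⋃ i ∈ s, f i := fun s x hx h => hx (by
    simp only [Set.mem_iUnion] at h ⊢
    obtain ⟨i, _, hi⟩ := h
    exact ⟨i, hi⟩)
  have hU := hw.indicator (MeasurableSet.iUnion hf)
  have key : Tendsto (fun s : Finset ℕ =>
      eLpNorm ((⋃ i ∈ s, f i).indicator w - (⋃ i, f i).indicator w) p μ) atTop (𝓝 0) := by
    refine tendsto_eLpNorm_zero_of_dominated hp0 hp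
      (fun s => (hw.indicator (hs s)).1.sub hU.1) hw
      (fun s => Eventually.of_forall fun x => ?_) (Eventually.of_forall fun x => ?_)
    · by_cases hx : x ∈ ⋃ i, f i
      · by_cases hx2 : x ∈ ⋃ i ∈ s, f i
        · rw [Pi.sub_apply, Set.indicator_of_mem hx, Set.indicator_of_mem hx2, sub_self]
          simp
        · rw [Pi.sub_apply, Set.indicator_of_mem hx, Set.indicator_of_notMem hx2]
          simp
      · rw [Pi.sub_apply, Set.indicator_of_notMem hx, Set.indicator_of_notMem (hsub s x hx)]
        simp
    · refine tendsto_const_nhds.congr' ?_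
      by_cases hx : x ∈ ⋃ i, f i
      · obtain ⟨i, hi⟩ := Set.mem_iUnion.1 hx
        filter_upwards [eventually_ge_atTop {i}] with s hsi
        have hx2 : x ∈ ⋃ i ∈ s, f i := Set.mem_biUnion (by simpa using hsi) hi
        rw [Pi.sub_apply, Set.indicator_of_mem hx, Set.indicator_of_mem hx2, sub_self]
      · refine Eventually.of_forall fun s => ?_
        dsimp only
        rw [Pi.sub_apply, Set.indicator_of_notMem hx, Set.indicator_of_notMem (hsub s x hx),
          sub_self]
  have h2 := (Lp.tendsto_Lp_iff_tendsto_eLpNorm'' (fun s => (⋃ i ∈ s, f i).indicator w)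
    (fun s => hw.indicator (hs s)) _ hU).2 key
  rw [HasSum, SummationFilter.unconditional_filter]
  exact h2.congr fun s => (h1 s).symm

open scoped Classical in
/-- The complex measure `A ↦ Λ (1_A w)` for a functional `Λ` on `L^p` and `w ∈ L^p`. -/
def functionalMeasure (hp : p ≠ ⊤) (Λ : StrongDual ℂ (Lp ℂ p μ)) {w : α → ℂ}
    (hw : MemLp w p μ) : ComplexMeasure α where
  measureOf' A := if hA : MeasurableSet A then Λ ((hw.indicator hA).toLp _) else 0
  empty' := by
    rw [dif_pos MeasurableSet.empty]
    have : (hw.indicator MeasurableSet.empty).toLp _ = 0 := by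
      rw [Lp.eq_zero_iff_ae_eq_zero]
      filter_upwards [(hw.indicator MeasurableSet.empty).coeFn_toLp] with x hx
      rw [hx, Set.indicator_empty]
      rfl
    rw [this, map_zero]
  not_measurable' A hA := dif_neg hA
  m_iUnion' f hf hd := by
    rw [dif_pos (MeasurableSet.iUnion hf)]
    simp only [hf, dif_pos]
    exact Λ.hasSum (hasSum_toLp_indicator hp hw hf hd)

theorem exists_density [SigmaFinite μ] (hp : p ≠ ⊤) (Λ : StrongDual ℂ (Lp ℂ p μ)) {w : α → ℂ}
    (hw : MemLp w p μ) : ∃ y : α → ℂ, Integrable y μ ∧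
      ∀ (A : Set α) (hA : MeasurableSet A), Λ ((hw.indicator hA).toLp _) = ∫ x in A, y x ∂μ := by
  set ν := functionalMeasure hp Λ hw with hν
  have hνA : ∀ (A : Set α) (hA : MeasurableSet A), ν A = Λ ((hw.indicator hA).toLp _) :=
    fun A hA => dif_pos hA
  have hac : ∀ A, μ.toENNRealVectorMeasure A = 0 → ν A = 0 := by
    intro A h
    by_cases hA : MeasurableSet A
    · rw [Measure.toENNRealVectorMeasure_apply_measurable hA] at h
      rw [hνA A hA]
      have : (hw.indicator hA).toLp _ = 0 := by
        rw [Lp.eq_zero_iff_ae_eq_zero]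
        filter_upwards [(hw.indicator hA).coeFn_toLp, measure_eq_zero_iff_ae_notMem.1 h]
          with x hx hx2
        simp [hx, hx2]
      rw [this, map_zero]
    · exact ν.not_measurable hA
  have hre : ComplexMeasure.re ν ≪ᵥ μ.toENNRealVectorMeasure := fun A h => by
    change (ν A).re = 0
    simp [hac A h]
  have him : ComplexMeasure.im ν ≪ᵥ μ.toENNRealVectorMeasure := fun A h => by
    change (ν A).im = 0
    simp [hac A h]
  have hy := ν.integrable_rnDeriv μ
  refine ⟨ν.rnDeriv μ, hy, fun A hA => ?_⟩
  rw [← hνA A hA]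
  have h1 : (ν A).re = ∫ x in A, (ComplexMeasure.re ν).rnDeriv μ x ∂μ := by
    rw [← withDensityᵥ_apply (SignedMeasure.integrable_rnDeriv _ _) hA,
      SignedMeasure.withDensityᵥ_rnDeriv_eq _ _ hre]
    rfl
  have h2 : (ν A).im = ∫ x in A, (ComplexMeasure.im ν).rnDeriv μ x ∂μ := by
    rw [← withDensityᵥ_apply (SignedMeasure.integrable_rnDeriv _ _) hA,
      SignedMeasure.withDensityᵥ_rnDeriv_eq _ _ him]
    rfl
  apply Complex.ext
  · rw [h1, ← RCLike.re_eq_complex_re, ← integral_re hy.integrableOn]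
    rfl
  · rw [h2, ← RCLike.im_eq_complex_im, ← integral_im hy.integrableOn]
    rfl

/-- The density represents the functional on the bounded multiples of `w`. -/
theorem functional_eq_integral_of_bound (hp : p ≠ ⊤) (Λ : StrongDual ℂ (Lp ℂ p μ)) {w : α → ℂ}
    (hw : MemLp w p μ) {y : α → ℂ} (hy : Integrable y μ)
    (h : ∀ (A : Set α) (hA : MeasurableSet A), Λ ((hw.indicator hA).toLp _) = ∫ x in A, y x ∂μ)
    {φ : α → ℂ} (hφ : StronglyMeasurable φ) {c : ℝ} (hc : ∀ x, ‖φ x‖ ≤ c) :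
    Λ ((MemLp.mul_of_bound hφ.aestronglyMeasurable hc hw).toLp _) = ∫ x, φ x * y x ∂μ := by
  have hp0 : p ≠ 0 := (zero_lt_one.trans_le (Fact.out : 1 ≤ p)).ne'
  have hmem : ∀ φ : SimpleFunc α ℂ, MemLp (fun x => φ x * w x) p μ := fun φ => by
    obtain ⟨C, hC⟩ := φ.exists_forall_norm_le
    exact MemLp.mul_of_bound φ.stronglyMeasurable.aestronglyMeasurable hC hw
  have hint : ∀ φ : SimpleFunc α ℂ, Integrable (fun x => φ x * y x) μ := fun φ => by
    obtain ⟨C, hC⟩ := φ.exists_forall_norm_le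
    exact hy.bdd_mul φ.stronglyMeasurable.aestronglyMeasurable (Eventually.of_forall hC)
  have hsimple : ∀ φ : SimpleFunc α ℂ, Λ ((hmem φ).toLp _) = ∫ x, φ x * y x ∂μ := by
    intro φ
    induction φ using SimpleFunc.induction with
    | const a hs =>
      rename_i s
      have h1 : (hmem (SimpleFunc.piecewise s hs (SimpleFunc.const _ a)
          (SimpleFunc.const _ 0))).toLp _ = a • (hw.indicator hs).toLp _ := by
        rw [← MemLp.toLp_const_smul]
        congr 1
        ext x
        by_cases hx : x ∈ s <;> simp [hx]
      rw [h1, map_smul, h s hs, smul_eq_mul, ← integral_const_mul, ← integral_indicator hs]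
      congr 1
      ext x
      by_cases hx : x ∈ s <;> simp [hx]
    | @add f g hd hf hg =>
      have h1 : (hmem (f + g)).toLp _ = (hmem f).toLp _ + (hmem g).toLp _ := by
        rw [← MemLp.toLp_add]
        congr 1
        ext x
        simp [add_mul]
      rw [h1, map_add, hf, hg, ← integral_add (hint f) (hint g)]
      congr 1
      ext x
      simp [add_mul]
  rcases isEmpty_or_nonempty α with hα | ⟨⟨x0⟩⟩
  · have : (MemLp.mul_of_bound hφ.aestronglyMeasurable hc hw).toLp _ = 0 := by
      rw [Lp.eq_zero_iff_ae_eq_zero]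
      exact Eventually.of_forall fun x => (hα.false x).elim
    rw [this, map_zero, μ.eq_zero_of_isEmpty, integral_zero_measure]
  have hc0 : 0 ≤ c := (norm_nonneg _).trans (hc x0)
  have hlim : ∀ x, Tendsto (fun n => hφ.approxBounded c n x) atTop (𝓝 (φ x)) := fun x =>
    hφ.tendsto_approxBounded_of_norm_le (hc x)
  have hb := fun n x => hφ.norm_approxBounded_le hc0 n x
  have hL : Tendsto (fun n => Λ ((hmem (hφ.approxBounded c n)).toLp _)) atTop
      (𝓝 (Λ ((MemLp.mul_of_bound hφ.aestronglyMeasurable hc hw).toLp _))) := by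
    refine (Λ.continuous.tendsto _).comp ?_
    rw [Lp.tendsto_Lp_iff_tendsto_eLpNorm'' _ (fun n => hmem (hφ.approxBounded c n)) _
      (MemLp.mul_of_bound hφ.aestronglyMeasurable hc hw)]
    refine tendsto_eLpNorm_zero_of_dominated hp0 hp (G := fun x => ((2 * c : ℝ) : ℂ) * w x)
      (fun n => ((hmem _).1.sub (MemLp.mul_of_bound hφ.aestronglyMeasurable hc hw).1))
      (hw.const_mul _)
      (fun n => Eventually.of_forall fun x => ?_) (Eventually.of_forall fun x => ?_)
    · rw [Pi.sub_apply, ← sub_mul, enorm_mul, enorm_mul]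
      gcongr
      rw [enorm_le_iff_norm_le, Complex.norm_real, Real.norm_of_nonneg (by positivity)]
      exact (norm_sub_le _ _).trans (by linarith [hb n x, hc x])
    · have := ((hlim x).sub_const (φ x)).mul_const (w x)
      simp only [sub_self, zero_mul] at this
      exact this.congr fun n => by simp [sub_mul]
  have hR : Tendsto (fun n => ∫ x, hφ.approxBounded c n x * y x ∂μ) atTop
      (𝓝 (∫ x, φ x * y x ∂μ)) := by
    refine tendsto_integral_of_dominated_convergence (fun x => c * ‖y x‖)
      (fun n => (hint _).1) (hy.norm.const_mul c) (fun n => Eventually.of_forall fun x => ?_)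
      (Eventually.of_forall fun x => (hlim x).mul_const _)
    rw [norm_mul]
    gcongr
    exact hb n x
  exact tendsto_nhds_unique (hL.congr fun n => hsimple _) hR

end LpDual

section LpDualReal

variable {α : Type*} [MeasurableSpace α] {μ : Measure α} {p p' : ℝ}

theorem eLpNorm_ofReal (hp : 0 < p) (f : α → ℂ) :
    eLpNorm f (ENNReal.ofReal p) μ = (∫⁻ x, ‖f x‖ₑ ^ p ∂μ) ^ (1 / p) := by
  rw [eLpNorm_eq_lintegral_rpow_enorm_toReal (by simpa using hp) (by simp),
    ENNReal.toReal_ofReal hp.le]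

theorem exists_pos_memLp [SigmaFinite μ] (hp : 0 < p) :
    ∃ w : α → ℝ, Measurable w ∧ (∀ x, 0 < w x) ∧
      MemLp (fun x => (w x : ℂ)) (ENNReal.ofReal p) μ := by
  obtain ⟨g, hg0, hgm, hg⟩ := exists_pos_lintegral_lt_of_sigmaFinite μ one_ne_zero
  refine ⟨fun x => (g x : ℝ) ^ (1 / p), (hgm.coe_nnreal_real.pow_const _),
    fun x => Real.rpow_pos_of_pos (hg0 x) _, ?_, ?_⟩
  · exact (Complex.measurable_ofReal.comp (hgm.coe_nnreal_real.pow_const _)).aestronglyMeasurable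
  · rw [eLpNorm_ofReal hp]
    refine ENNReal.rpow_lt_top_of_nonneg (by positivity) (ne_of_lt ?_)
    refine lt_of_le_of_lt (lintegral_mono fun x => ?_) (hg.trans ENNReal.one_lt_top)
    rw [← ofReal_norm, Complex.norm_real, Real.norm_of_nonneg (by positivity),
      ENNReal.ofReal_rpow_of_nonneg (by positivity) hp.le, ← Real.rpow_mul (by positivity),
      one_div_mul_cancel hp.ne', Real.rpow_one, ENNReal.ofReal_coe_nnreal]

theorem enorm_integral_mul_le (hpp : p.HolderConjugate p') {f h : α → ℂ}
    (hf : AEStronglyMeasurable f μ) (hh : AEStronglyMeasurable h μ) :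
    ‖∫ x, f x * h x ∂μ‖ₑ ≤
      eLpNorm f (ENNReal.ofReal p) μ * eLpNorm h (ENNReal.ofReal p') μ := by
  refine (enorm_integral_le_lintegral_enorm _).trans ?_
  simp only [enorm_mul]
  rw [eLpNorm_ofReal hpp.pos, eLpNorm_ofReal hpp.symm.pos]
  exact ENNReal.lintegral_mul_le_Lp_mul_Lq μ hpp hf.enorm hh.enorm

/-- A function representing a functional on the bounded multiples of a weight is in `L^{p'}`. -/
theorem eLpNorm_le_of_represents (hpp : p.HolderConjugate p')
    [Fact (1 ≤ ENNReal.ofReal p)] {Λ : StrongDual ℂ (Lp ℂ (ENNReal.ofReal p) μ)} {w : α → ℝ}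
    (hwm : Measurable w) (hw0 : ∀ x, 0 < w x)
    (hw : MemLp (fun x => (w x : ℂ)) (ENNReal.ofReal p) μ) {h y : α → ℂ} (hhm : Measurable h)
    (hyh : ∀ x, y x = w x * h x) (hy : Integrable y μ)
    (hbd : ∀ {φ : α → ℂ} (hφ : StronglyMeasurable φ) {c : ℝ} (hc : ∀ x, ‖φ x‖ ≤ c),
      Λ ((MemLp.mul_of_bound hφ.aestronglyMeasurable hc hw).toLp _) = ∫ x, φ x * y x ∂μ) :
    eLpNorm h (ENNReal.ofReal p') μ ≤ ‖Λ‖ₑ := by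
  have hp := hpp.pos
  have hp' := hpp.symm.pos
  have hp'1 : 0 < p' - 1 := by linarith [hpp.symm.lt]
  have hwC : Measurable fun x => (w x : ℂ) := Complex.measurable_ofReal.comp hwm
  set A : ℕ → Set α := fun n => {x | ‖h x‖ ≤ n ∧ 1 ≤ n * w x} with hA
  have hAm : ∀ n, MeasurableSet (A n) := fun n =>
    (measurableSet_le hhm.norm measurable_const).inter
      (measurableSet_le measurable_const (hwm.const_mul _))
  have hI : ∀ n, ∫⁻ x in A n, ‖h x‖ₑ ^ p' ∂μ ≤ ‖Λ‖ₑ ^ p' := by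
    intro n
    set φ : α → ℂ := (A n).indicator fun x =>
      ((‖h x‖ ^ (p' - 2) : ℝ) : ℂ) * (starRingEnd ℂ) (h x) / w x with hφ
    have hφm : Measurable φ := by
      refine Measurable.indicator ?_ (hAm n)
      exact ((Complex.measurable_ofReal.comp (hhm.norm.pow_const _)).mul
        (Complex.continuous_conj.measurable.comp hhm)).div hwC
    have hnorm : ∀ x, ‖h x‖ ^ (p' - 2) * ‖h x‖ = ‖h x‖ ^ (p' - 1) := fun x => by
      rcases (norm_nonneg (h x)).eq_or_lt' with h0 | h0
      · rw [h0, mul_zero, Real.zero_rpow hp'1.ne']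
      · rw [← Real.rpow_add_one h0.ne']; ring_nf
    have hφn : ∀ x ∈ A n, ‖φ x‖ = ‖h x‖ ^ (p' - 1) / w x := fun x hx => by
      rw [hφ, Set.indicator_of_mem hx, norm_div, norm_mul, Complex.norm_real, RCLike.norm_conj,
        Complex.norm_real, Real.norm_of_nonneg (hw0 x).le, Real.norm_of_nonneg (by positivity),
        hnorm]
    have hφb : ∀ x, ‖φ x‖ ≤ (n : ℝ) ^ (p' - 1) * n := by
      intro x
      by_cases hx : x ∈ A n
      · rw [hφn x hx, div_eq_mul_inv]
        gcongr
        · exact (inv_pos.2 (hw0 x)).le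
        · exact hx.1
        · rw [inv_le_iff_one_le_mul₀ (hw0 x)]
          exact hx.2
      · rw [hφ, Set.indicator_of_notMem hx, norm_zero]
        positivity
    have hval := hbd hφm.stronglyMeasurable hφb
    have hprod : ∀ x, φ x * y x = ((A n).indicator (fun x => ‖h x‖ ^ p') x : ℝ) := by
      intro x
      by_cases hx : x ∈ A n
      · rw [hφ, Set.indicator_of_mem hx, Set.indicator_of_mem hx, hyh]
        have hw' : (w x : ℂ) ≠ 0 := by exact_mod_cast (hw0 x).ne'
        calc ((‖h x‖ ^ (p' - 2) : ℝ) : ℂ) * (starRingEnd ℂ) (h x) / w x * (w x * h x)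
            = ((‖h x‖ ^ (p' - 2) : ℝ) : ℂ) * ((starRingEnd ℂ) (h x) * h x) := by
              field_simp
          _ = ((‖h x‖ ^ (p' - 2) * ‖h x‖ * ‖h x‖ : ℝ) : ℂ) := by
              rw [Complex.conj_mul']; push_cast; ring
          _ = _ := by
              rw [hnorm]
              congr 1
              rcases (norm_nonneg (h x)).eq_or_lt' with h0 | h0
              · rw [h0, mul_zero, Real.zero_rpow hp'.ne']
              · rw [← Real.rpow_add_one h0.ne']; ring_nf
      · rw [hφ, Set.indicator_of_notMem hx, Set.indicator_of_notMem hx]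
        simp
    have hint : Integrable (fun x => φ x * y x) μ :=
      hy.bdd_mul hφm.aestronglyMeasurable (Eventually.of_forall hφb)
    have hI2 : ∫⁻ x in A n, ‖h x‖ₑ ^ p' ∂μ = ‖∫ x, φ x * y x ∂μ‖ₑ := by
      simp only [hprod] at hint ⊢
      rw [integral_complex_ofReal, ← ofReal_norm, Complex.norm_real, Real.norm_of_nonneg
        (integral_nonneg fun x => Set.indicator_nonneg (fun _ _ => by positivity) _),
        ofReal_integral_eq_lintegral_ofReal (by exact_mod_cast hint.re)
          (Eventually.of_forall fun x => Set.indicator_nonneg (fun _ _ => by positivity) _),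
        ← lintegral_indicator (hAm n)]
      refine lintegral_congr fun x => ?_
      by_cases hx : x ∈ A n
      · rw [Set.indicator_of_mem hx, Set.indicator_of_mem hx, ← ofReal_norm,
          ENNReal.ofReal_rpow_of_nonneg (norm_nonneg _) hp'.le]
      · rw [Set.indicator_of_notMem hx, Set.indicator_of_notMem hx, ENNReal.ofReal_zero]
    set I := ∫⁻ x in A n, ‖h x‖ₑ ^ p' ∂μ with hIdef
    have hIt : I ≠ ⊤ := by rw [hI2]; simp
    have hnormφ : eLpNorm (fun x => φ x * w x) (ENNReal.ofReal p) μ = I ^ (1 / p) := by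
      rw [eLpNorm_ofReal hp, hIdef, ← lintegral_indicator (hAm n)]
      congr 1
      refine lintegral_congr fun x => ?_
      by_cases hx : x ∈ A n
      · rw [Set.indicator_of_mem hx, ← ofReal_norm, ← ofReal_norm, norm_mul, hφn x hx,
          Complex.norm_real, Real.norm_of_nonneg (hw0 x).le, div_mul_cancel₀ _ (hw0 x).ne',
          ENNReal.ofReal_rpow_of_nonneg (by positivity) hp.le,
          ENNReal.ofReal_rpow_of_nonneg (by positivity) hp'.le, ← Real.rpow_mul (norm_nonneg _),
          hpp.symm.sub_one_mul_conj]
      · rw [Set.indicator_of_notMem hx, hφ, Set.indicator_of_notMem hx]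
        simp [hp]
    have hle : I ≤ ‖Λ‖ₑ * I ^ (1 / p) := by
      rw [← hnormφ, hI2, ← hval]
      refine (ContinuousLinearMap.le_opENorm _ _).trans ?_
      rw [Lp.enorm_toLp]
    rcases eq_or_ne I 0 with h0 | h0
    · rw [h0]; exact zero_le
    have h1 : I ^ (1 / p') ≤ ‖Λ‖ₑ := by
      have e : I = I ^ (1 / p') * I ^ (1 / p) := by
        rw [← ENNReal.rpow_add _ _ h0 hIt, one_div, one_div, hpp.symm.inv_add_inv_eq_one,
          ENNReal.rpow_one]
      have h2 : I ^ (1 / p') * I ^ (1 / p) ≤ ‖Λ‖ₑ * I ^ (1 / p) := by rwa [← e]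
      refine (ENNReal.mul_le_mul_iff_left ?_ ?_).1 h2
      · simp [ENNReal.rpow_eq_zero_iff, h0, hIt]
      · exact ENNReal.rpow_ne_top_of_nonneg (by positivity) hIt
    rw [one_div] at h1
    exact (ENNReal.rpow_inv_le_iff hp').1 h1
  have hAU : ⋃ n, A n = Set.univ := by
    refine Set.eq_univ_of_forall fun x => Set.mem_iUnion.2 ?_
    obtain ⟨n, hn⟩ := exists_nat_ge (max ‖h x‖ (w x)⁻¹)
    refine ⟨n, (le_max_left _ _).trans hn, ?_⟩
    rw [← inv_le_iff_one_le_mul₀ (hw0 x)]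
    exact (le_max_right _ _).trans hn
  have hAmono : Monotone A := fun n m hnm x hx =>
    ⟨hx.1.trans (by exact_mod_cast hnm), hx.2.trans (by
      have := (hw0 x).le
      gcongr)⟩
  rw [eLpNorm_ofReal hp', one_div, ENNReal.rpow_inv_le_iff hp', ← setLIntegral_univ, ← hAU,
    setLIntegral_iUnion_of_directed _ (hAmono.directed_le)]
  exact iSup_le hI

/-- A function in `L^{p'}` representing a functional on the bounded multiples of a positive weight
represents it on all of `L^p`. -/
theorem eq_integral_of_represents (hpp : p.HolderConjugate p')
    [Fact (1 ≤ ENNReal.ofReal p)] {Λ : StrongDual ℂ (Lp ℂ (ENNReal.ofReal p) μ)} {w : α → ℝ}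
    (hwm : Measurable w) (hw0 : ∀ x, 0 < w x)
    (hw : MemLp (fun x => (w x : ℂ)) (ENNReal.ofReal p) μ) {h y : α → ℂ}
    (hyh : ∀ x, y x = w x * h x) (hhmem : MemLp h (ENNReal.ofReal p') μ)
    (hbd : ∀ {φ : α → ℂ} (hφ : StronglyMeasurable φ) {c : ℝ} (hc : ∀ x, ‖φ x‖ ≤ c),
      Λ ((MemLp.mul_of_bound hφ.aestronglyMeasurable hc hw).toLp _) = ∫ x, φ x * y x ∂μ)
    (f : Lp ℂ (ENNReal.ofReal p) μ) : Λ f = ∫ x, f x * h x ∂μ := by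
  have hp := hpp.pos
  have hpt : ENNReal.ofReal p ≠ ⊤ := by simp
  have hp0 : ENNReal.ofReal p ≠ 0 := by simpa using hp
  have hwC : Measurable fun x => (w x : ℂ) := Complex.measurable_ofReal.comp hwm
  set g := (Lp.aestronglyMeasurable f).mk f with hg
  have hgm : StronglyMeasurable g := (Lp.aestronglyMeasurable f).stronglyMeasurable_mk
  have hfg : f =ᵐ[μ] g := (Lp.aestronglyMeasurable f).ae_eq_mk
  have hgmem : MemLp g (ENNReal.ofReal p) μ := (memLp_congr_ae hfg).1 (Lp.memLp f)
  have hfe : f = hgmem.toLp g := by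
    ext1
    exact hfg.trans hgmem.coeFn_toLp.symm
  set B : ℕ → Set α := fun n => {x | ‖g x‖ ≤ n * w x} with hB
  have hBm : ∀ n, MeasurableSet (B n) := fun n =>
    measurableSet_le hgm.measurable.norm (hwm.const_mul _)
  have hφm : ∀ n, StronglyMeasurable ((B n).indicator fun x => g x / w x) := fun n =>
    ((hgm.measurable.div hwC).indicator (hBm n)).stronglyMeasurable
  have hφb : ∀ n x, ‖(B n).indicator (fun x => g x / w x) x‖ ≤ n := by
    intro n x
    by_cases hx : x ∈ B n
    · rw [Set.indicator_of_mem hx, norm_div, Complex.norm_real, Real.norm_of_nonneg (hw0 x).le,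
        div_le_iff₀ (hw0 x)]
      exact hx
    · rw [Set.indicator_of_notMem hx, norm_zero]
      positivity
  have hφw : ∀ n x, (B n).indicator (fun x => g x / w x) x * w x = (B n).indicator g x := by
    intro n x
    by_cases hx : x ∈ B n
    · rw [Set.indicator_of_mem hx, Set.indicator_of_mem hx, div_mul_cancel₀]
      exact_mod_cast (hw0 x).ne'
    · rw [Set.indicator_of_notMem hx, Set.indicator_of_notMem hx, zero_mul]
  have hev : ∀ x, ∀ᶠ n : ℕ in atTop, (B n).indicator g x = g x := by
    intro x
    obtain ⟨N, hN⟩ := exists_nat_ge (‖g x‖ / w x)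
    filter_upwards [eventually_ge_atTop N] with n hn
    refine Set.indicator_of_mem ?_ _
    have : ‖g x‖ / w x ≤ n := hN.trans (by exact_mod_cast hn)
    rwa [div_le_iff₀ (hw0 x)] at this
  have hBg : ∀ n x, ‖(B n).indicator g x‖ ≤ ‖g x‖ := fun n x => norm_indicator_le_norm_self _ _
  have hval : ∀ n, Λ ((hgmem.indicator (hBm n)).toLp _) = ∫ x, (B n).indicator g x * h x ∂μ := by
    intro n
    have h1 := hbd (hφm n) (hφb n)
    have h2 : (MemLp.mul_of_bound (hφm n).aestronglyMeasurable (hφb n) hw).toLp _ =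
        (hgmem.indicator (hBm n)).toLp _ := by
      congr 1
      exact funext (hφw n)
    rw [← h2, h1]
    congr 1
    ext x
    rw [hyh, ← mul_assoc, hφw]
  have hE : Tendsto (fun n => eLpNorm ((B n).indicator g - g) (ENNReal.ofReal p) μ) atTop
      (𝓝 0) := by
    refine tendsto_eLpNorm_zero_of_dominated hp0 hpt (G := fun x => 2 * g x)
      (fun n => (hgmem.indicator (hBm n)).1.sub hgmem.1) (hgmem.const_mul 2)
      (fun n => Eventually.of_forall fun x => ?_) (Eventually.of_forall fun x => ?_)
    · rw [enorm_le_iff_norm_le, norm_mul, Complex.norm_two]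
      exact (norm_sub_le _ _).trans (by linarith [hBg n x])
    · refine tendsto_const_nhds.congr' ?_
      filter_upwards [hev x] with n hn
      rw [Pi.sub_apply, hn, sub_self]
  have hL : Tendsto (fun n => Λ ((hgmem.indicator (hBm n)).toLp _)) atTop (𝓝 (Λ f)) := by
    have := (Lp.tendsto_Lp_iff_tendsto_eLpNorm'' (fun n => (B n).indicator g)
      (fun n => hgmem.indicator (hBm n)) g hgmem).2 hE
    rw [hfe]
    exact (Λ.continuous.tendsto _).comp this
  have hghi : Integrable (fun x => g x * h x) μ := by
    have : (ENNReal.ofReal p).HolderConjugate (ENNReal.ofReal p') := hpp.ennrealOfReal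
    exact hgmem.integrable_mul hhmem
  have hR : Tendsto (fun n => ∫ x, (B n).indicator g x * h x ∂μ) atTop
      (𝓝 (∫ x, g x * h x ∂μ)) := by
    refine tendsto_integral_of_dominated_convergence (fun x => ‖g x * h x‖)
      (fun n => ((hgmem.indicator (hBm n)).1.mul hhmem.1)) hghi.norm
      (fun n => Eventually.of_forall fun x => ?_) (Eventually.of_forall fun x => ?_)
    · rw [norm_mul, norm_mul]
      gcongr
      exact hBg n x
    · refine tendsto_const_nhds.congr' ?_
      filter_upwards [hev x] with n hn
      rw [hn]
  rw [tendsto_nhds_unique (hL.congr hval) hR]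
  refine integral_congr_ae ?_
  filter_upwards [hfg] with x hx
  rw [hx]

/-- The Riesz representation theorem for the dual of `L^p`, `1 < p < ∞`. -/
theorem exists_dual_representative [SigmaFinite μ] (hpp : p.HolderConjugate p')
    [Fact (1 ≤ ENNReal.ofReal p)] (Λ : StrongDual ℂ (Lp ℂ (ENNReal.ofReal p) μ)) :
    ∃ h : α → ℂ, MemLp h (ENNReal.ofReal p') μ ∧ eLpNorm h (ENNReal.ofReal p') μ ≤ ‖Λ‖ₑ ∧
      ∀ f : Lp ℂ (ENNReal.ofReal p) μ, Λ f = ∫ x, f x * h x ∂μ := by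
  have hp := hpp.pos
  have hp' := hpp.symm.pos
  have hpt : ENNReal.ofReal p ≠ ⊤ := by simp
  have hp0 : ENNReal.ofReal p ≠ 0 := by simpa using hp
  obtain ⟨w, hwm, hw0, hw⟩ := exists_pos_memLp (μ := μ) hp
  obtain ⟨y', hy', hyA'⟩ := exists_density hpt Λ hw
  set y := hy'.1.mk y' with hydef
  have hym : StronglyMeasurable y := hy'.1.stronglyMeasurable_mk
  have hyy : y' =ᵐ[μ] y := hy'.1.ae_eq_mk
  have hy : Integrable y μ := hy'.congr hyy
  have hyA : ∀ (A : Set α) (hA : MeasurableSet A),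
      Λ ((hw.indicator hA).toLp _) = ∫ x in A, y x ∂μ := fun A hA => by
    rw [hyA' A hA]
    exact integral_congr_ae (ae_restrict_of_ae hyy)
  have hbd := fun {φ : α → ℂ} (hφ : StronglyMeasurable φ) {c : ℝ} (hc : ∀ x, ‖φ x‖ ≤ c) =>
    functional_eq_integral_of_bound hpt Λ hw hy hyA hφ hc
  set h : α → ℂ := fun x => y x / w x with hh
  have hwC : Measurable fun x => (w x : ℂ) := Complex.measurable_ofReal.comp hwm
  have hhm : Measurable h := hym.measurable.div hwC
  have hyh : ∀ x, y x = w x * h x := fun x => by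
    rw [hh, mul_div_cancel₀]
    exact_mod_cast (hw0 x).ne'
  have hnormh : eLpNorm h (ENNReal.ofReal p') μ ≤ ‖Λ‖ₑ :=
    eLpNorm_le_of_represents hpp hwm hw0 hw hhm hyh hy hbd
  have hhmem : MemLp h (ENNReal.ofReal p') μ :=
    ⟨hhm.aestronglyMeasurable, hnormh.trans_lt enorm_lt_top⟩
  exact ⟨h, hhmem, hnormh, eq_integral_of_represents hpp hwm hw0 hw hyh hhmem hbd⟩

end LpDualReal

section DistributionNorms

/-! ### Linear functionals and `L^p` norms of distributions -/

open FourierTransform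

/-- The Hahn-Banach theorem, for functionals dominated by the norm of a linear map. -/
theorem exists_strongDual_comp_eq {V E : Type*} [AddCommGroup V] [Module ℂ V]
    [SeminormedAddCommGroup E] [NormedSpace ℂ E] (Φ : V →ₗ[ℂ] E) (g : V →ₗ[ℂ] ℂ) {c : ℝ}
    (hc : 0 ≤ c) (h : ∀ v, ‖g v‖ ≤ c * ‖Φ v‖) :
    ∃ Λ : StrongDual ℂ E, (∀ v, Λ (Φ v) = g v) ∧ ‖Λ‖ ≤ c := by
  obtain ⟨s, hs⟩ := Φ.rangeRestrict.exists_rightInverse_of_surjective Φ.range_rangeRestrict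
  have hs' : ∀ y : LinearMap.range Φ, Φ (s y) = y := fun y =>
    congrArg Subtype.val (LinearMap.congr_fun hs y)
  let f : StrongDual ℂ (LinearMap.range Φ) :=
    LinearMap.mkContinuous (g ∘ₗ s) c fun y => by
      have := h (s y)
      rwa [hs'] at this
  obtain ⟨Λ, hΛ, hn⟩ := exists_extension_norm_eq (LinearMap.range Φ) f
  refine ⟨Λ, fun v => ?_, hn.le.trans (LinearMap.mkContinuous_norm_le _ hc _)⟩
  have h1 := hΛ (Φ.rangeRestrict v)
  have h2 : f (Φ.rangeRestrict v) = g (s (Φ.rangeRestrict v)) := rfl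
  have h3 := h (s (Φ.rangeRestrict v) - v)
  have h4 : ((Φ.rangeRestrict v : LinearMap.range Φ) : E) = Φ v := rfl
  rw [map_sub, map_sub, hs', h4, sub_self, norm_zero, mul_zero] at h3
  rw [← h4, h1, h2]
  exact sub_eq_zero.1 (norm_le_zero_iff.1 h3)

/-- Euclidean space of dimension `d`. -/
abbrev Eu (d : ℕ) := EuclideanSpace ℝ (Fin d)

/-- The Schwartz functions on `ℝ^d`. -/
abbrev TestFn (d : ℕ) := 𝓢(EuclideanSpace ℝ (Fin d), ℂ)

/-- The tempered distributions on `ℝ^d`. -/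
abbrev TDist (d : ℕ) := 𝓢'(EuclideanSpace ℝ (Fin d), ℂ)

variable {d : ℕ} {p p' : ℝ}

/-- The `L^p` norm of a Schwartz function. -/
def sNorm (p : ℝ) (φ : TestFn d) : ℝ≥0∞ := eLpNorm φ (ENNReal.ofReal p) volume

theorem sNorm_ne_top (p : ℝ) (φ : TestFn d) : sNorm p φ ≠ ⊤ :=
  (SchwartzMap.eLpNorm_lt_top φ (ENNReal.ofReal p) volume).ne

theorem sNorm_zero (p : ℝ) : sNorm p (0 : TestFn d) = 0 := by
  have : ((0 : TestFn d) : Eu d → ℂ) = 0 := rfl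
  rw [sNorm, this, eLpNorm_zero]

theorem sNorm_add_le (hp : 1 ≤ p) (φ η : TestFn d) : sNorm p (φ + η) ≤ sNorm p φ + sNorm p η :=
  eLpNorm_add_le φ.continuous.aestronglyMeasurable η.continuous.aestronglyMeasurable
    (ENNReal.one_le_ofReal.2 hp)

theorem sNorm_smul (c : ℂ) (φ : TestFn d) : sNorm p (c • φ) = ‖c‖ₑ * sNorm p φ :=
  eLpNorm_const_smul c φ _ _

theorem sNorm_sum_le (hp : 1 ≤ p) {ι : Type*} (s : Finset ι) (φ : ι → TestFn d) :
    sNorm p (∑ i ∈ s, φ i) ≤ ∑ i ∈ s, sNorm p (φ i) := by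
  classical
  induction s using Finset.induction_on with
  | empty => simp [sNorm_zero]
  | insert i s hi ih =>
    rw [Finset.sum_insert hi, Finset.sum_insert hi]
    exact (sNorm_add_le hp _ _).trans (add_le_add le_rfl ih)

theorem enorm_toLpCLM [Fact (1 ≤ ENNReal.ofReal p)] (φ : TestFn d) :
    ‖SchwartzMap.toLpCLM ℂ ℂ (ENNReal.ofReal p) volume φ‖ₑ = sNorm p φ := by
  rw [SchwartzMap.toLpCLM_apply, SchwartzMap.toLp, Lp.enorm_toLp, sNorm]

theorem continuous_sNorm (hp : 1 ≤ p) : Continuous (sNorm p : TestFn d → ℝ≥0∞) := by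
  have : Fact (1 ≤ ENNReal.ofReal p) := ⟨ENNReal.one_le_ofReal.2 hp⟩
  have h := (SchwartzMap.toLpCLM ℂ ℂ (ENNReal.ofReal p)
    (volume : Measure (Eu d))).continuous.enorm
  exact h.congr fun φ => enorm_toLpCLM φ

/-- A distribution bounded in the norm of `L^{p'}` is a function in `L^p`. -/
theorem lpNorm_le_of_forall (hpp : p.HolderConjugate p') {u : TDist d} {C : ℝ≥0∞} (hC : C ≠ ⊤)
    (h : ∀ φ : TestFn d, ‖u φ‖ₑ ≤ C * sNorm p' φ) : lpNorm p u ≤ C := by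
  have : Fact (1 ≤ ENNReal.ofReal p') := ⟨ENNReal.one_le_ofReal.2 hpp.symm.lt.le⟩
  obtain ⟨Λ, hΛ, hn⟩ := exists_strongDual_comp_eq
    (SchwartzMap.toLpCLM ℂ ℂ (ENNReal.ofReal p') (volume : Measure (Eu d))).toLinearMap
    u.toLinearMap (ENNReal.toReal_nonneg (a := C)) (fun φ => by
      have h1 := h φ
      rw [← enorm_toLpCLM] at h1
      have h2 := ENNReal.toReal_mono (ENNReal.mul_ne_top hC enorm_ne_top) h1
      rwa [ENNReal.toReal_mul, toReal_enorm, toReal_enorm] at h2)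
  obtain ⟨w, hw, hwn, hrep⟩ := exists_dual_representative hpp.symm Λ
  have hΛn : ‖Λ‖ₑ ≤ C := by
    rw [← ofReal_norm, ← ENNReal.ofReal_toReal hC]
    exact ENNReal.ofReal_le_ofReal hn
  refine iInf₂_le_of_le w ⟨hw, fun φ => ?_⟩ (hwn.trans hΛn)
  have h1 := hΛ φ
  have h2 : u φ = Λ (SchwartzMap.toLpCLM ℂ ℂ (ENNReal.ofReal p') volume φ) := h1.symm
  rw [h2, hrep]
  refine integral_congr_ae ?_
  filter_upwards [φ.coeFn_toLp (ENNReal.ofReal p') volume] with x hx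
  rw [SchwartzMap.toLpCLM_apply, hx, smul_eq_mul]

theorem enorm_apply_le_lpNorm (hpp : p.HolderConjugate p') (u : TDist d) (φ : TestFn d) :
    ‖u φ‖ₑ ≤ lpNorm p u * sNorm p' φ := by
  rcases eq_or_ne (sNorm p' φ) 0 with h0 | h0
  · have : φ = 0 := by
      have hz := (eLpNorm_eq_zero_iff φ.continuous.aestronglyMeasurable
        (ENNReal.ofReal_pos.2 hpp.symm.pos).ne').1 h0
      have := (Continuous.ae_eq_iff_eq volume φ.continuous continuous_zero).1 hz
      ext x
      exact congrFun this x
    simp [this]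
  · simp only [lpNorm]
    simp only [ENNReal.iInf_mul_of_ne h0 (sNorm_ne_top p' φ)]
    refine le_iInf₂ fun w hw => ?_
    rw [hw.2 φ, mul_comm]
    exact enorm_integral_mul_le hpp.symm φ.continuous.aestronglyMeasurable hw.1.1

theorem lpNorm_ofSchwartz (hp : 1 ≤ p) (φ : TestFn d) : lpNorm p (ofSchwartz φ) = sNorm p φ := by
  have : Fact (1 ≤ ENNReal.ofReal p) := ⟨ENNReal.one_le_ofReal.2 hp⟩
  refine le_antisymm (iInf₂_le_of_le φ ⟨φ.memLp _, fun η => ?_⟩ le_rfl)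
    (le_iInf₂ fun w hw => ?_)
  · exact SchwartzMap.toTemperedDistributionCLM_apply_apply _ _ _
  · have hk := Lp.ker_toTemperedDistributionCLM_eq_bot (F := ℂ) (p := ENNReal.ofReal p)
      (μ := (volume : Measure (Eu d)))
    have heq : φ.toLp (ENNReal.ofReal p) volume = hw.1.toLp w := by
      refine (LinearMap.ker_eq_bot.1 hk) ?_
      refine DFunLike.ext _ _ fun η => ?_
      have h1 := hw.2 η
      have h2 : ofSchwartz φ η = ∫ x, η x • φ x :=
        SchwartzMap.toTemperedDistributionCLM_apply_apply _ _ _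
      have h3 : ∫ x, η x • (φ.toLp (ENNReal.ofReal p) volume) x = ∫ x, η x • φ x :=
        integral_congr_ae (by
          filter_upwards [φ.coeFn_toLp (ENNReal.ofReal p) volume] with x hx
          rw [hx])
      have h4 : ∫ x, η x • (hw.1.toLp w) x = ∫ x, η x • w x :=
        integral_congr_ae (by
          filter_upwards [hw.1.coeFn_toLp] with x hx
          rw [hx])
      change Lp.toTemperedDistributionCLM ℂ volume (ENNReal.ofReal p) _ η =
        Lp.toTemperedDistributionCLM ℂ volume (ENNReal.ofReal p) _ η
      rw [Lp.toTemperedDistributionCLM_apply, Lp.toTemperedDistributionCLM_apply,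
        Lp.toTemperedDistribution_apply, Lp.toTemperedDistribution_apply]
      exact h3.trans (h2.symm.trans (h1.trans h4.symm))
    rw [← Lp.enorm_toLp (hf := hw.1), ← heq]
    exact (enorm_toLpCLM φ).ge

theorem ofSchwartz_apply (φ η : TestFn d) : ofSchwartz φ η = ∫ x, η x * φ x :=
  SchwartzMap.toTemperedDistributionCLM_apply_apply _ _ _

/-! ### Fourier multipliers on Schwartz functions -/

/-- The Fourier multiplier `𝓕⁻¹ m 𝓕` on Schwartz functions. -/
def mop (m : TestFn d) : TestFn d →L[ℂ] TestFn d := SchwartzMap.fourierMultiplierCLM ℂ (m : Eu d → ℂ)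

theorem fourier_mop (m φ : TestFn d) (ξ : Eu d) : 𝓕 (mop m φ) ξ = m ξ * 𝓕 φ ξ := by
  rw [mop, SchwartzMap.fourierMultiplierCLM_apply, FourierTransform.fourier_fourierInv_eq,
    SchwartzMap.smulLeftCLM_apply_apply (SchwartzMap.hasTemperateGrowth m), smul_eq_mul]

theorem ext_fourier {φ η : TestFn d} (h : ∀ ξ, 𝓕 φ ξ = 𝓕 η ξ) : φ = η := by
  have : 𝓕 φ = 𝓕 η := by ext ξ; exact h ξ
  have h1 : 𝓕⁻ (𝓕 φ) = 𝓕⁻ (𝓕 η) := by rw [this]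
  rwa [FourierTransform.fourierInv_fourier_eq, FourierTransform.fourierInv_fourier_eq] at h1

theorem mop_comm (m m' φ : TestFn d) : mop m (mop m' φ) = mop m' (mop m φ) :=
  ext_fourier fun ξ => by simp only [fourier_mop]; ring

/-- The reflected function. -/
def refl (φ : TestFn d) : TestFn d :=
  SchwartzMap.compCLMOfContinuousLinearEquiv ℂ (ContinuousLinearEquiv.neg ℝ) φ

@[simp]
theorem refl_apply (φ : TestFn d) (x : Eu d) : refl φ x = φ (-x) := rfl

/-- The Fourier multiplier on distributions is the transpose of that with the reflected symbol. -/
theorem fourierMultiplier_apply (m : TestFn d) (u : TDist d) (φ : TestFn d) :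
    TemperedDistribution.fourierMultiplierCLM ℂ (m : Eu d → ℂ) u φ = u (mop (refl m) φ) := by
  rw [TemperedDistribution.fourierMultiplierCLM_apply_apply]
  congr 1
  have hinv : ∀ (η : TestFn d) ξ, 𝓕 η ξ = 𝓕⁻ η (-ξ) := fun η ξ => by
    rw [SchwartzMap.fourier_coe, SchwartzMap.fourierInv_coe, Real.fourierInv_eq_fourier_neg,
      neg_neg]
  have : ∀ η : TestFn d, 𝓕⁻ (refl η) = 𝓕 η := fun η => by
    ext x
    rw [SchwartzMap.fourier_coe, SchwartzMap.fourierInv_coe,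
      Real.fourierInv_eq_fourier_comp_neg]
    refine congrFun (congrArg _ ?_) x
    funext y
    simp
  rw [mop, SchwartzMap.fourierMultiplierCLM_apply, ← this]
  congr 1
  ext ξ
  rw [refl_apply, SchwartzMap.smulLeftCLM_apply_apply (SchwartzMap.hasTemperateGrowth m),
    SchwartzMap.smulLeftCLM_apply_apply (SchwartzMap.hasTemperateGrowth _), refl_apply, hinv]

theorem fourierMultiplier_ofSchwartz (m φ : TestFn d) :
    TemperedDistribution.fourierMultiplierCLM ℂ (m : Eu d → ℂ) (ofSchwartz φ) =
      ofSchwartz (mop m φ) :=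
  TemperedDistribution.fourierMultiplierCLM_toTemperedDistributionCLM_eq
    (SchwartzMap.hasTemperateGrowth m) φ

theorem mop_apply (m φ : TestFn d) (x : Eu d) : mop m φ x = ∫ t, 𝓕⁻ m t * φ (x - t) := by
  have h : mop m φ = SchwartzMap.convolution (ContinuousLinearMap.lsmul ℂ ℂ) (𝓕⁻ m) φ :=
    ext_fourier fun ξ => by
      rw [fourier_mop, SchwartzMap.fourier_convolution, SchwartzMap.pairing_apply_apply,
        FourierTransform.fourier_fourierInv_eq]
      rfl
  rw [h, SchwartzMap.convolution_apply]
  rfl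

/-- The `L^p` norm of the kernel of a Fourier multiplier. -/
def kerNorm (p : ℝ) (m : TestFn d) : ℝ≥0∞ := sNorm p (𝓕⁻ m)

theorem kerNorm_ne_top (p : ℝ) (m : TestFn d) : kerNorm p m ≠ ⊤ := sNorm_ne_top _ _

theorem sNorm_one_eq (φ : TestFn d) : sNorm 1 φ = ∫⁻ x, ‖φ x‖ₑ := by
  rw [sNorm, ENNReal.ofReal_one, eLpNorm_one_eq_lintegral_enorm]

theorem lintegral_mop_mul_le (m φ : TestFn d) {w : Eu d → ℝ≥0∞} (hw : Measurable w) {B : ℝ≥0∞}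
    (hB : ∀ t, ∫⁻ x, ‖φ (x - t)‖ₑ * w x ≤ B) :
    ∫⁻ x, ‖mop m φ x‖ₑ * w x ≤ kerNorm 1 m * B := by
  have hm : Measurable fun t => ‖𝓕⁻ m t‖ₑ := (𝓕⁻ m).continuous.enorm.measurable
  calc ∫⁻ x, ‖mop m φ x‖ₑ * w x
      ≤ ∫⁻ x, ∫⁻ t, ‖𝓕⁻ m t‖ₑ * (‖φ (x - t)‖ₑ * w x) := by
        refine lintegral_mono fun x => ?_
        rw [mop_apply]
        refine (mul_le_mul_left (enorm_integral_le_lintegral_enorm _) _).trans ?_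
        have h1 : Measurable fun t => ‖𝓕⁻ m t * φ (x - t)‖ₑ :=
          ((𝓕⁻ m).continuous.mul
            (φ.continuous.comp (continuous_const.sub continuous_id))).enorm.measurable
        rw [← lintegral_mul_const _ h1]
        exact lintegral_mono fun t => by rw [enorm_mul, mul_assoc]
    _ = ∫⁻ t, ∫⁻ x, ‖𝓕⁻ m t‖ₑ * (‖φ (x - t)‖ₑ * w x) := by
        refine lintegral_lintegral_swap (Measurable.aemeasurable ?_)
        have h2 : Measurable fun z : Eu d × Eu d => ‖φ (z.1 - z.2)‖ₑ :=
          (φ.continuous.comp (continuous_fst.sub continuous_snd)).enorm.measurable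
        exact (hm.comp measurable_snd).mul (h2.mul (hw.comp measurable_fst))
    _ ≤ ∫⁻ t, ‖𝓕⁻ m t‖ₑ * B := by
        refine lintegral_mono fun t => ?_
        rw [lintegral_const_mul' _ _ enorm_ne_top]
        exact mul_le_mul_right (hB t) _
    _ = kerNorm 1 m * B := by
        rw [lintegral_mul_const _ hm, kerNorm, sNorm_one_eq]

theorem eLpNorm_comp_sub (φ : TestFn d) (t : Eu d) (p : ℝ) :
    eLpNorm (fun x => φ (x - t)) (ENNReal.ofReal p) volume = sNorm p φ :=
  eLpNorm_comp_measurePreserving φ.continuous.aestronglyMeasurable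
    (measurePreserving_sub_right volume t)

/-- Young's inequality, `L^1 * L^p ⊆ L^p`. -/
theorem sNorm_mop_le (hpp : p.HolderConjugate p') (m φ : TestFn d) :
    sNorm p (mop m φ) ≤ kerNorm 1 m * sNorm p φ := by
  rw [← lpNorm_ofSchwartz hpp.lt.le]
  refine lpNorm_le_of_forall hpp (ENNReal.mul_ne_top (kerNorm_ne_top _ _) (sNorm_ne_top _ _))
    fun η => ?_
  rw [ofSchwartz_apply, mul_assoc]
  calc ‖∫ x, η x * mop m φ x‖ₑ ≤ ∫⁻ x, ‖η x * mop m φ x‖ₑ := enorm_integral_le_lintegral_enorm _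
    _ = ∫⁻ x, ‖mop m φ x‖ₑ * ‖η x‖ₑ := lintegral_congr fun x => by rw [enorm_mul, mul_comm]
    _ ≤ _ := by
        refine lintegral_mop_mul_le m φ η.continuous.enorm.measurable fun t => ?_
        have h1 : ∀ f h : Eu d → ℂ, AEStronglyMeasurable f volume → AEStronglyMeasurable h volume →
            ∫⁻ x, ‖f x‖ₑ * ‖h x‖ₑ ≤
              eLpNorm f (ENNReal.ofReal p) volume * eLpNorm h (ENNReal.ofReal p') volume := by
          intro f h hf hh
          rw [eLpNorm_ofReal hpp.pos, eLpNorm_ofReal hpp.symm.pos]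
          exact ENNReal.lintegral_mul_le_Lp_mul_Lq volume hpp hf.enorm hh.enorm
        have h2 := h1 (fun x => φ (x - t)) η
          (φ.continuous.comp (continuous_id.sub continuous_const)).aestronglyMeasurable
          η.continuous.aestronglyMeasurable
        rwa [eLpNorm_comp_sub] at h2

/-- Young's inequality, `L^p * L^{p'} ⊆ L^∞`. -/
theorem enorm_mop_apply_le (hpp : p.HolderConjugate p') (m φ : TestFn d) (x : Eu d) :
    ‖mop m φ x‖ₑ ≤ kerNorm p m * sNorm p' φ := by
  have h : sNorm p' φ = eLpNorm (fun t => φ (x - t)) (ENNReal.ofReal p') volume :=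
    (eLpNorm_comp_measurePreserving φ.continuous.aestronglyMeasurable
      (Measure.measurePreserving_sub_left volume x)).symm
  rw [mop_apply, h]
  exact enorm_integral_mul_le hpp (𝓕⁻ m).continuous.aestronglyMeasurable
    (φ.continuous.comp (continuous_const.sub continuous_id)).aestronglyMeasurable

/-- Young's inequality, `L^1 * L^1 ⊆ L^1`. -/
theorem sNorm_one_mop_le (m φ : TestFn d) : sNorm 1 (mop m φ) ≤ kerNorm 1 m * sNorm 1 φ := by
  have h := lintegral_mop_mul_le m φ (measurable_const (a := (1 : ℝ≥0∞))) (B := sNorm 1 φ)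
    fun t => by
      have := eLpNorm_comp_sub φ t 1
      rw [ENNReal.ofReal_one, eLpNorm_one_eq_lintegral_enorm] at this
      simpa using this.le
  simpa [sNorm_one_eq (mop m φ)] using h

end DistributionNorms

/-! ### Dilated and translated symbols -/

section Dilation

open FourierTransform

variable {d : ℕ} {p p' : ℝ}

/-- The function `ξ ↦ m (a ξ - v)`, for `a ≠ 0`. -/
def dil (a : ℝ) (v : Eu d) (m : TestFn d) : TestFn d :=
  if ha : a ≠ 0 then
    SchwartzMap.compCLMOfContinuousLinearEquiv ℂ
      (ContinuousLinearEquiv.smulLeft (Units.mk0 a ha)) (SchwartzMap.compSubConstCLM ℂ v m)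
  else 0

theorem dil_apply {a : ℝ} (ha : a ≠ 0) (v : Eu d) (m : TestFn d) (ξ : Eu d) :
    dil a v m ξ = m (a • ξ - v) := by
  rw [dil, dif_pos ha]
  rfl

theorem fourier_eq_refl_fourierInv (m : TestFn d) : 𝓕 m = refl (𝓕⁻ m) := by
  ext x
  rw [refl_apply, SchwartzMap.fourier_coe, SchwartzMap.fourierInv_coe,
    Real.fourierInv_eq_fourier_neg, neg_neg]

theorem fourierInv_refl (m : TestFn d) : 𝓕⁻ (refl m) = refl (𝓕⁻ m) := by
  rw [← fourier_eq_refl_fourierInv]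
  ext x
  rw [SchwartzMap.fourier_coe, SchwartzMap.fourierInv_coe, Real.fourierInv_eq_fourier_comp_neg]
  refine congrFun (congrArg _ ?_) x
  funext y
  simp

theorem sNorm_refl (φ : TestFn d) : sNorm p (refl φ) = sNorm p φ :=
  eLpNorm_comp_measurePreserving φ.continuous.aestronglyMeasurable
    (Measure.measurePreserving_neg volume)

theorem kerNorm_refl (m : TestFn d) : kerNorm p (refl m) = kerNorm p m := by
  rw [kerNorm, fourierInv_refl, sNorm_refl, kerNorm]

theorem enorm_fourierInv_dil {a : ℝ} (ha : 0 < a) (v : Eu d) (m : TestFn d) (x : Eu d) :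
    ‖𝓕⁻ (dil a v m) x‖ₑ = ENNReal.ofReal a ^ (-(d : ℝ)) * ‖𝓕⁻ m (a⁻¹ • x)‖ₑ := by
  have h1 : 𝓕⁻ (dil a v m) x =
      ∫ ξ, (fun η : Eu d => Real.fourierChar (inner ℝ (a⁻¹ • η) x) • m (η - v)) (a • ξ) := by
    rw [SchwartzMap.fourierInv_coe, Real.fourierInv_eq]
    refine integral_congr_ae (Eventually.of_forall fun ξ => ?_)
    simp only [dil_apply ha.ne', smul_smul, inv_mul_cancel₀ ha.ne', one_smul]
  have h2 : ∫ η, Real.fourierChar (inner ℝ (a⁻¹ • η) x) • m (η - v) =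
      Real.fourierChar (inner ℝ (a⁻¹ • v) x) • 𝓕⁻ m (a⁻¹ • x) := by
    rw [← integral_add_right_eq_self _ v, SchwartzMap.fourierInv_coe, Real.fourierInv_eq,
      Circle.smul_def, ← integral_smul]
    refine integral_congr_ae (Eventually.of_forall fun η => ?_)
    simp only [add_sub_cancel_right, smul_add, inner_add_left, inner_smul_left,
      inner_smul_right, AddChar.map_add_eq_mul, Circle.smul_def, Circle.coe_mul, smul_eq_mul]
    simp only [conj_trivial]
    ring
  have h3 := Measure.integral_comp_smul (volume : Measure (Eu d))
    (fun η : Eu d => Real.fourierChar (inner ℝ (a⁻¹ • η) x) • m (η - v)) a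
  rw [h1, h3, h2, enorm_smul, finrank_euclideanSpace, Fintype.card_fin]
  congr 1
  · rw [Real.enorm_eq_ofReal (abs_nonneg _), abs_of_pos (by positivity),
      ENNReal.ofReal_rpow_of_pos ha, Real.rpow_neg ha.le, Real.rpow_natCast]
  · rw [← ofReal_norm, ← ofReal_norm, Circle.norm_smul]

theorem kerNorm_dil {a : ℝ} (ha : 0 < a) (hp : 0 < p) (v : Eu d) (m : TestFn d) :
    kerNorm p (dil a v m) = ENNReal.ofReal a ^ ((d : ℝ) * (1 / p - 1)) * kerNorm p m := by
  have ha0 : ENNReal.ofReal a ≠ 0 := (ENNReal.ofReal_pos.2 ha).ne'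
  have h0 : ∀ c : ℝ, ENNReal.ofReal a ^ c ≠ ⊤ := fun c =>
    (ENNReal.rpow_ne_top_of_ne_zero ha0 ENNReal.ofReal_ne_top)
  have h1 : ∫⁻ x, ‖𝓕⁻ m (a⁻¹ • x)‖ₑ ^ p = ENNReal.ofReal a ^ (d : ℝ) * ∫⁻ x, ‖𝓕⁻ m x‖ₑ ^ p := by
    have hm : Measurable fun x => ‖𝓕⁻ m x‖ₑ ^ p :=
      ((𝓕⁻ m).continuous.enorm.measurable).pow_const p
    rw [← lintegral_map hm (measurable_const_smul a⁻¹),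
      Measure.map_addHaar_smul _ (inv_ne_zero ha.ne'), lintegral_smul_measure,
      finrank_euclideanSpace, Fintype.card_fin, inv_pow, inv_inv, abs_of_pos (by positivity),
      ENNReal.ofReal_rpow_of_pos ha, Real.rpow_natCast]
    rfl
  rw [kerNorm, sNorm, eLpNorm_ofReal hp, kerNorm, sNorm, eLpNorm_ofReal hp]
  simp only [enorm_fourierInv_dil ha, ENNReal.mul_rpow_of_nonneg _ _ hp.le]
  rw [lintegral_const_mul' _ _ (ENNReal.rpow_ne_top_of_nonneg hp.le (h0 _)), h1, ← mul_assoc,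
    ENNReal.mul_rpow_of_nonneg _ _ (by positivity), ← ENNReal.rpow_mul,
    ← ENNReal.rpow_add _ _ ha0 ENNReal.ofReal_ne_top, ← ENNReal.rpow_mul]
  congr 2
  field_simp
  ring

theorem kerNorm_one_dil {a : ℝ} (ha : 0 < a) (v : Eu d) (m : TestFn d) :
    kerNorm 1 (dil a v m) = kerNorm 1 m := by
  rw [kerNorm_dil ha one_pos]
  simp

end Dilation

/-! ### The partition of unity -/

section Partition

open FourierTransform

variable {d : ℕ}

/-- The integer points at distance at most `R` from `x` in the maximum norm. -/
def nearR (R : ℝ) (x : Fin d → ℝ) : Finset (Fin d → ℤ) :=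
  Fintype.piFinset fun t => Finset.Icc ⌈x t - R⌉ ⌊x t + R⌋

theorem mem_nearR {R : ℝ} {x : Fin d → ℝ} {l : Fin d → ℤ} :
    l ∈ nearR R x ↔ ∀ t, |(l t : ℝ) - x t| ≤ R := by
  simp only [nearR, Fintype.mem_piFinset, Finset.mem_Icc, Int.ceil_le, Int.le_floor, abs_le]
  exact forall_congr' fun t => ⟨fun h => ⟨by linarith, by linarith⟩,
    fun h => ⟨by linarith, by linarith⟩⟩

theorem card_nearR_le {R : ℝ} (hR : 0 ≤ R) (x : Fin d → ℝ) :
    ((nearR R x).card : ℝ) ≤ (2 * R + 1) ^ d := by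
  rw [nearR, Fintype.card_piFinset, Nat.cast_prod]
  calc ∏ t, ((Finset.Icc ⌈x t - R⌉ ⌊x t + R⌋).card : ℝ) ≤ ∏ _t : Fin d, (2 * R + 1) := by
        refine Finset.prod_le_prod (fun _ _ => Nat.cast_nonneg _) fun t _ => ?_
        rw [Int.card_Icc]
        have h1 := Int.floor_le (x t + R)
        have h2 := Int.le_ceil (x t - R)
        have h3 : (((⌊x t + R⌋ + 1 - ⌈x t - R⌉).toNat : ℤ) : ℝ) =
            ((max (⌊x t + R⌋ + 1 - ⌈x t - R⌉) 0 : ℤ) : ℝ) := by rw [Int.toNat_eq_max]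
        rw [Int.cast_natCast] at h3
        rw [h3, Int.cast_max]
        push_cast
        exact max_le (by linarith) (by linarith)
    _ = _ := by simp

/-- The vector with integer coordinates `k`. -/
def intVec (k : Fin d → ℤ) : Eu d := WithLp.toLp 2 fun i => (k i : ℝ)

variable {ψ : Eu d → ℝ}

theorem IsCutoff.abs_le (hψ : IsCutoff ψ) {ξ : Eu d} (h : ψ ξ ≠ 0) (t : Fin d) :
    |ξ t| ≤ 3 / 4 := by
  by_contra! hc
  exact h (hψ.support ξ ⟨t, hc⟩)

theorem IsCutoff.sum_near (hψ : IsCutoff ψ) {ξ : Eu d} {x : Fin d → ℝ}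
    (h : ∀ t, |ξ t - x t| ≤ 5 / 4) : ∑ l ∈ nearR 2 x, ψ (ξ - intVec l) = 1 := by
  refine (hasSum_sum_of_ne_finset_zero fun l hl => ?_).unique (hψ.sum_eq_one ξ)
  by_contra hne
  refine hl (mem_nearR.2 fun t => ?_)
  have h1 := hψ.abs_le hne t
  have h2 := h t
  have h3 : (ξ - intVec l) t = ξ t - l t := rfl
  rw [h3] at h1
  rw [_root_.abs_le] at *
  constructor <;> linarith [h1.1, h1.2, h2.1, h2.2]

theorem IsCutoff.hasCompactSupport (hψ : IsCutoff ψ) : HasCompactSupport fun ξ => (ψ ξ : ℂ) := by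
  refine HasCompactSupport.of_support_subset_isCompact
    (isCompact_closedBall (0 : Eu d) (Real.sqrt d)) fun ξ hξ => ?_
  have h0 : ψ ξ ≠ 0 := fun h => hξ (by simp [h])
  rw [mem_closedBall_zero_iff, EuclideanSpace.norm_eq]
  refine Real.sqrt_le_sqrt ?_
  calc ∑ i, ‖ξ i‖ ^ 2 ≤ ∑ _i : Fin d, (1 : ℝ) := by
        refine Finset.sum_le_sum fun t _ => ?_
        have := hψ.abs_le h0 t
        rw [Real.norm_eq_abs]
        nlinarith [abs_nonneg (ξ t)]
    _ = d := by simp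

/-- The cut-off function as a Schwartz function. -/
def IsCutoff.toTestFn (hψ : IsCutoff ψ) : TestFn d :=
  hψ.hasCompactSupport.toSchwartzMap (Complex.ofRealCLM.contDiff.comp hψ.smooth)

@[simp]
theorem IsCutoff.toTestFn_apply (hψ : IsCutoff ψ) (ξ : Eu d) : hψ.toTestFn ξ = ψ ξ := rfl

/-- The scale of the frequency decomposition at the level `j`. -/
def frq (j : ℤ) : ℝ := (2 : ℝ) ^ (-j) * (2 * Real.pi)

theorem frq_pos (j : ℤ) : 0 < frq j := by
  unfold frq
  positivity

theorem frq_eq (i j : ℤ) : frq i = (2 : ℝ) ^ (j - i) * frq j := by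
  rw [frq, frq, ← mul_assoc ((2 : ℝ) ^ (j - i)), ← zpow_add₀ two_ne_zero]
  congr 2
  ring

/-- The symbol of `□_{j,k}`. -/
def sym (hψ : IsCutoff ψ) (j : ℤ) (k : Fin d → ℤ) : TestFn d := dil (frq j) (intVec k) hψ.toTestFn

theorem sym_apply (hψ : IsCutoff ψ) (j : ℤ) (k : Fin d → ℤ) (ξ : Eu d) :
    sym hψ j k ξ = ψ (frq j • ξ - intVec k) := by
  rw [sym, dil_apply (frq_pos j).ne', hψ.toTestFn_apply]

theorem box_eq (hψ : IsCutoff ψ) (j : ℤ) (k : Fin d → ℤ) :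
    box ψ j k = TemperedDistribution.fourierMultiplierCLM ℂ (sym hψ j k : Eu d → ℂ) := by
  rw [box]
  congr 1
  funext ξ
  rw [sym_apply, smul_smul]
  rfl

theorem box_apply (hψ : IsCutoff ψ) (j : ℤ) (k : Fin d → ℤ) (u : TDist d) (φ : TestFn d) :
    box ψ j k u φ = u (mop (refl (sym hψ j k)) φ) := by
  rw [box_eq hψ, fourierMultiplier_apply]

theorem box_ofSchwartz (hψ : IsCutoff ψ) (j : ℤ) (k : Fin d → ℤ) (φ : TestFn d) :
    box ψ j k (ofSchwartz φ) = ofSchwartz (mop (sym hψ j k) φ) := by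
  rw [box_eq hψ, fourierMultiplier_ofSchwartz]

theorem sym_ne_zero (hψ : IsCutoff ψ) {j : ℤ} {k : Fin d → ℤ} {ξ : Eu d}
    (h : sym hψ j k ξ ≠ 0) (t : Fin d) : |frq j * ξ t - k t| ≤ 3 / 4 := by
  rw [sym_apply] at h
  exact hψ.abs_le (fun h0 => h (by rw [h0, Complex.ofReal_zero])) t

theorem sum_sym (hψ : IsCutoff ψ) {j : ℤ} {ξ : Eu d} {x : Fin d → ℝ}
    (h : ∀ t, |frq j * ξ t - x t| ≤ 5 / 4) : ∑ l ∈ nearR 2 x, sym hψ j l ξ = 1 := by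
  simp only [sym_apply]
  rw [← Complex.ofReal_sum, hψ.sum_near (ξ := frq j • ξ) h, Complex.ofReal_one]

theorem fourier_sum {ι : Type*} (s : Finset ι) (φ : ι → TestFn d) (ξ : Eu d) :
    𝓕 (∑ i ∈ s, φ i) ξ = ∑ i ∈ s, 𝓕 (φ i) ξ := by
  have h : 𝓕 (∑ i ∈ s, φ i) = ∑ i ∈ s, 𝓕 (φ i) :=
    map_sum (FourierTransform.fourierCLM ℂ (TestFn d)) φ s
  rw [h, sum_apply]

/-- A Schwartz function whose frequencies lie near `x`, at the level `j`, is the sum of finitely many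
of its pieces. -/
theorem eq_sum_mop (hψ : IsCutoff ψ) (j : ℤ) (x : Fin d → ℝ) (w : TestFn d)
    (h : ∀ ξ, 𝓕 w ξ ≠ 0 → ∀ t, |frq j * ξ t - x t| ≤ 5 / 4) :
    w = ∑ l ∈ nearR 2 x, mop (sym hψ j l) w := by
  refine ext_fourier fun ξ => ?_
  simp only [fourier_sum, fourier_mop]
  rw [← Finset.sum_mul]
  rcases eq_or_ne (𝓕 w ξ) 0 with h0 | h0
  · rw [h0, mul_zero]
  · rw [sum_sym hψ (h ξ h0), one_mul]

theorem eq_sum_mop_refl (hψ : IsCutoff ψ) (j : ℤ) (x : Fin d → ℝ) (w : TestFn d)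
    (h : ∀ ξ, 𝓕 w ξ ≠ 0 → ∀ t, |frq j * ξ t + x t| ≤ 5 / 4) :
    w = ∑ l ∈ nearR 2 x, mop (refl (sym hψ j l)) w := by
  refine ext_fourier fun ξ => ?_
  simp only [fourier_sum, fourier_mop, refl_apply]
  rw [← Finset.sum_mul]
  rcases eq_or_ne (𝓕 w ξ) 0 with h0 | h0
  · rw [h0, mul_zero]
  · rw [sum_sym hψ (ξ := -ξ) fun t => ?_, one_mul]
    have := h ξ h0 t
    rw [← abs_neg]
    convert this using 2
    have : (-ξ) t = -(ξ t) := rfl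
    rw [this]
    ring

theorem apply_eq_sum_box (hψ : IsCutoff ψ) (j : ℤ) (x : Fin d → ℝ) (u : TDist d) (w : TestFn d)
    (h : ∀ ξ, 𝓕 w ξ ≠ 0 → ∀ t, |frq j * ξ t + x t| ≤ 5 / 4) :
    u w = ∑ l ∈ nearR 2 x, box ψ j l u w := by
  conv_lhs => rw [eq_sum_mop_refl hψ j x w h, map_sum]
  exact Finset.sum_congr rfl fun l _ => (box_apply hψ j l u w).symm

end Partition

/-! ### Truncation of the frequencies -/

section Truncation

open FourierTransform

variable {d : ℕ}

theorem norm_iteratedFDeriv_dil_sub_one_le (η : TestFn d) (hη : η 0 = 1) (i : ℕ) :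
    ∃ A, 0 ≤ A ∧ ∀ c : ℝ, 0 < c → c ≤ 1 → ∀ x,
      ‖iteratedFDeriv ℝ i (fun y => dil c 0 η y - 1) x‖ ≤ A * c * (1 + ‖x‖) := by
  have hdil : ∀ c : ℝ, 0 < c → (dil c 0 η : Eu d → ℂ) = fun y => η (c • y) := fun c hc => by
    funext y
    rw [dil_apply hc.ne', sub_zero]
  rcases Nat.eq_zero_or_pos i with rfl | hi
  · refine ⟨SchwartzMap.seminorm ℝ 0 1 η, apply_nonneg _ _, fun c hc hc1 x => ?_⟩
    rw [norm_iteratedFDeriv_zero, hdil c hc, ← hη]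
    have h1 := convex_univ.norm_image_sub_le_of_norm_fderiv_le (𝕜 := ℝ) (f := (η : Eu d → ℂ))
      (C := SchwartzMap.seminorm ℝ 0 1 η)
      (fun y _ => η.differentiableAt) (fun y _ => by
        have := SchwartzMap.le_seminorm ℝ 0 1 η y
        rwa [pow_zero, one_mul, norm_iteratedFDeriv_one] at this)
      (Set.mem_univ (0 : Eu d)) (Set.mem_univ (c • x))
    refine h1.trans ?_
    rw [sub_zero, norm_smul, Real.norm_eq_abs, abs_of_pos hc, mul_assoc]
    gcongr
    linarith [norm_nonneg x]
  · refine ⟨SchwartzMap.seminorm ℝ 0 i η, apply_nonneg _ _, fun c hc hc1 x => ?_⟩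
    have hs : ContDiff ℝ i fun y => η (c • y) := by
      rw [← hdil c hc]
      exact (dil c 0 η).smooth i
    rw [hdil c hc]
    have h1 : iteratedFDeriv ℝ i (fun y => η (c • y) - 1) x =
        iteratedFDeriv ℝ i (fun y => η (c • y)) x := by
      have := iteratedFDeriv_sub_apply (x := x) hs.contDiffAt
        (contDiff_const (c := (1 : ℂ))).contDiffAt
      rw [iteratedFDeriv_const_of_ne hi.ne', Pi.zero_apply, sub_zero] at this
      exact this
    have h2 := ContinuousLinearMap.iteratedFDeriv_comp_right (c • ContinuousLinearMap.id ℝ (Eu d))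
      (η.smooth i) x le_rfl
    have h3 : (η : Eu d → ℂ) ∘ (c • ContinuousLinearMap.id ℝ (Eu d)) = fun y => η (c • y) := rfl
    have h4 : ‖c • ContinuousLinearMap.id ℝ (Eu d)‖ ≤ c := by
      refine ContinuousLinearMap.opNorm_le_bound _ hc.le fun y => ?_
      rw [_root_.smul_apply, ContinuousLinearMap.id_apply, norm_smul,
        Real.norm_eq_abs, abs_of_pos hc]
    have h5 := SchwartzMap.le_seminorm ℝ 0 i η ((c • ContinuousLinearMap.id ℝ (Eu d)) x)
    rw [pow_zero, one_mul] at h5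
    rw [h1, ← h3, h2]
    refine (ContinuousMultilinearMap.norm_compContinuousLinearMap_le _ _).trans ?_
    rw [Finset.prod_const, Finset.card_univ, Fintype.card_fin]
    have h6 : ‖c • ContinuousLinearMap.id ℝ (Eu d)‖ ^ i ≤ c :=
      (pow_le_pow_left₀ (norm_nonneg _) h4 i).trans (pow_le_of_le_one hc.le hc1 hi.ne')
    calc _ ≤ SchwartzMap.seminorm ℝ 0 i η * c := by
          gcongr
      _ ≤ _ := le_mul_of_one_le_right (by positivity) (by linarith [norm_nonneg x])

/-- Multiplication by `η(c ·)` converges to the identity on Schwartz functions as `c → 0`. -/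
theorem tendsto_smulLeft_dil (η : TestFn d) (hη : η 0 = 1) (u : TestFn d) :
    Tendsto (fun n : ℕ => SchwartzMap.smulLeftCLM ℂ (dil (1 / ((n : ℝ) + 1)) 0 η : Eu d → ℂ) u)
      atTop (𝓝 u) := by
  rw [(schwartz_withSeminorms ℝ (Eu d) ℂ).tendsto_nhds]
  rintro ⟨k, m⟩ ε hε
  choose A hA0 hA using norm_iteratedFDeriv_dil_sub_one_le η hη
  set B := ∑ i ∈ Finset.range (m + 1), (m.choose i : ℝ) * A i *
    (SchwartzMap.seminorm ℝ k (m - i) u + SchwartzMap.seminorm ℝ (k + 1) (m - i) u) with hB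
  have hB0 : 0 ≤ B := Finset.sum_nonneg fun i _ => by
    have := hA0 i
    positivity
  have key : ∀ n : ℕ, SchwartzMap.seminorm ℝ k m
      (SchwartzMap.smulLeftCLM ℂ (dil (1 / ((n : ℝ) + 1)) 0 η : Eu d → ℂ) u - u) ≤
        1 / ((n : ℝ) + 1) * B := by
    intro n
    set c : ℝ := 1 / ((n : ℝ) + 1)
    have hc : 0 < c := by positivity
    have hc1 : c ≤ 1 := by
      rw [div_le_one (by positivity)]
      linarith [n.cast_nonneg (α := ℝ)]
    refine SchwartzMap.seminorm_le_bound ℝ k m _ (by positivity) fun x => ?_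
    have h1 : (⇑(SchwartzMap.smulLeftCLM ℂ (dil c 0 η : Eu d → ℂ) u - u) : Eu d → ℂ) =
        fun y => (dil c 0 η y - 1) * u y := by
      funext y
      rw [_root_.sub_apply,
        SchwartzMap.smulLeftCLM_apply_apply (SchwartzMap.hasTemperateGrowth _), smul_eq_mul]
      ring
    rw [h1]
    have h2 := norm_iteratedFDeriv_mul_le (𝕜 := ℝ) (N := m)
      (((dil c 0 η).smooth m).sub contDiff_const : ContDiff ℝ m fun y => dil c 0 η y - 1)
      (u.smooth m) x le_rfl
    refine (mul_le_mul_of_nonneg_left h2 (by positivity)).trans ?_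
    rw [Finset.mul_sum, hB, Finset.mul_sum]
    refine Finset.sum_le_sum fun i _ => ?_
    have h3 := SchwartzMap.le_seminorm ℝ k (m - i) u x
    have h4 := SchwartzMap.le_seminorm ℝ (k + 1) (m - i) u x
    have h5 := hA i c hc hc1 x
    have h6 := hA0 i
    calc ‖x‖ ^ k * ((m.choose i : ℝ) * ‖iteratedFDeriv ℝ i (fun y => dil c 0 η y - 1) x‖ *
          ‖iteratedFDeriv ℝ (m - i) u x‖)
        ≤ ‖x‖ ^ k * ((m.choose i : ℝ) * (A i * c * (1 + ‖x‖)) *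
          ‖iteratedFDeriv ℝ (m - i) u x‖) := by gcongr
      _ = c * ((m.choose i : ℝ) * A i * (‖x‖ ^ k * ‖iteratedFDeriv ℝ (m - i) u x‖ +
          ‖x‖ ^ (k + 1) * ‖iteratedFDeriv ℝ (m - i) u x‖)) := by ring
      _ ≤ _ := by gcongr
  have hlim : Tendsto (fun n : ℕ => 1 / ((n : ℝ) + 1) * B) atTop (𝓝 0) := by
    simpa using tendsto_one_div_add_atTop_nhds_zero_nat.mul_const B
  filter_upwards [hlim.eventually_lt_const hε] with n hn
  exact (key n).trans_lt hn

theorem tendsto_mop_dil (η : TestFn d) (hη : η 0 = 1) (φ : TestFn d) :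
    Tendsto (fun n : ℕ => mop (dil (1 / ((n : ℝ) + 1)) 0 η) φ) atTop (𝓝 φ) := by
  have h := ((FourierTransform.fourierInvCLM ℂ (TestFn d)).continuous.tendsto _).comp
    (tendsto_smulLeft_dil η hη (𝓕 φ))
  have h2 : FourierTransform.fourierInvCLM ℂ (TestFn d) (𝓕 φ) = φ := by
    rw [FourierTransform.fourierInvCLM_apply, FourierTransform.fourierInv_fourier_eq]
  rw [h2] at h
  exact h

/-- A Schwartz function with compact support and with value `1` at the origin. -/
theorem exists_plateau (d : ℕ) : ∃ η : TestFn d, η 0 = 1 ∧ ∀ ξ, η ξ ≠ 0 → ‖ξ‖ ≤ 2 := by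
  let b : ContDiffBump (0 : Eu d) := ⟨1, 2, one_pos, one_lt_two⟩
  refine ⟨HasCompactSupport.toSchwartzMap (f := fun x => (b x : ℂ))
    (b.hasCompactSupport.comp_left Complex.ofReal_zero)
    (Complex.ofRealCLM.contDiff.comp b.contDiff), ?_, fun ξ hξ => ?_⟩
  · change ((b 0 : ℝ) : ℂ) = 1
    rw [b.one_of_mem_closedBall (by simp [b]), Complex.ofReal_one]
  · by_contra! h
    refine hξ ?_
    change ((b ξ : ℝ) : ℂ) = 0
    rw [b.zero_of_le_dist (by simpa [b] using h.le), Complex.ofReal_zero]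

/-- The Schwartz functions whose Fourier transform has compact support. -/
def BandLimited (φ : TestFn d) : Prop := ∃ R : ℝ, ∀ ξ, 𝓕 φ ξ ≠ 0 → ∀ t, |ξ t| ≤ R

theorem bandLimited_mop_dil {η : TestFn d} (hη : ∀ ξ, η ξ ≠ 0 → ‖ξ‖ ≤ 2) {c : ℝ} (hc : 0 < c)
    (φ : TestFn d) : BandLimited (mop (dil c 0 η) φ) := by
  refine ⟨c⁻¹ * 2, fun ξ hξ t => ?_⟩
  rw [fourier_mop, dil_apply hc.ne', sub_zero] at hξ
  have h1 := hη _ (left_ne_zero_of_mul hξ)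
  rw [norm_smul, Real.norm_eq_abs, abs_of_pos hc] at h1
  rw [le_inv_mul_iff₀ hc]
  refine le_trans ?_ h1
  gcongr
  have := PiLp.norm_apply_le ξ t
  rwa [Real.norm_eq_abs] at this

end Truncation

/-! ### Comparison of levels and the pairing of distributions with test functions -/

section Levels

open FourierTransform

variable {d : ℕ} {p p' q q' : ℝ} {ψ : Eu d → ℝ}

theorem lpNorm_le_mul_of_forall (hpp : p.HolderConjugate p') {u : TDist d} {C : ℝ≥0∞}
    (h : ∀ φ : TestFn d, ‖u φ‖ₑ ≤ C * sNorm p' φ) : lpNorm p u ≤ C := by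
  rcases eq_or_ne C ⊤ with rfl | hC
  · exact le_top
  · exact lpNorm_le_of_forall hpp hC h

/-- A constant bounding the operators `□_{j,k}` on `L^p`. -/
def cutConst (hψ : IsCutoff ψ) : ℝ≥0∞ := 1 + kerNorm 1 hψ.toTestFn

theorem cutConst_ne_top (hψ : IsCutoff ψ) : cutConst hψ ≠ ⊤ :=
  ENNReal.add_ne_top.2 ⟨ENNReal.one_ne_top, kerNorm_ne_top _ _⟩

theorem kerNorm_sym_le (hψ : IsCutoff ψ) (j : ℤ) (k : Fin d → ℤ) :
    kerNorm 1 (sym hψ j k) ≤ cutConst hψ := by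
  rw [sym, kerNorm_one_dil (frq_pos j)]
  exact le_add_self

theorem sNorm_mop_sym_le (hψ : IsCutoff ψ) (hpp : p.HolderConjugate p') (j : ℤ) (k : Fin d → ℤ)
    (φ : TestFn d) : sNorm p (mop (sym hψ j k) φ) ≤ cutConst hψ * sNorm p φ :=
  (sNorm_mop_le hpp _ _).trans (mul_le_mul_left (kerNorm_sym_le hψ j k) _)

theorem sNorm_mop_refl_sym_le (hψ : IsCutoff ψ) (hpp : p.HolderConjugate p') (j : ℤ)
    (k : Fin d → ℤ) (φ : TestFn d) :
    sNorm p (mop (refl (sym hψ j k)) φ) ≤ cutConst hψ * sNorm p φ := by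
  refine (sNorm_mop_le hpp _ _).trans (mul_le_mul_left ?_ _)
  rw [kerNorm_refl]
  exact kerNorm_sym_le hψ j k

theorem lpNorm_box_le (hψ : IsCutoff ψ) (hpp : p.HolderConjugate p') (j : ℤ) (k : Fin d → ℤ)
    (u : TDist d) : lpNorm p (box ψ j k u) ≤ cutConst hψ * lpNorm p u := by
  refine lpNorm_le_mul_of_forall hpp fun φ => ?_
  rw [box_apply hψ, mul_comm (cutConst hψ), mul_assoc]
  exact (enorm_apply_le_lpNorm hpp _ _).trans
    (mul_le_mul_right (sNorm_mop_refl_sym_le hψ hpp.symm j k φ) _)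

theorem ellNorm_comp_equiv {ι κ : Type*} (e : ι ≃ κ) (r : ℝ) (a : κ → ℝ≥0∞) :
    ellNorm r (fun i => a (e i)) = ellNorm r a := by
  rw [ellNorm, ellNorm, e.tsum_eq fun k => a k ^ r]

theorem card_nearR_enorm_le {R c : ℝ} (hR : 0 ≤ R) (hc : 2 * R + 1 ≤ c) (x : Fin d → ℝ) :
    ((nearR R x).card : ℝ≥0∞) ≤ ENNReal.ofReal (c ^ d) := by
  rw [← ENNReal.ofReal_natCast]
  refine ENNReal.ofReal_le_ofReal ((card_nearR_le hR x).trans ?_)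
  gcongr

theorem ellNorm_le_of_near (hq : 1 ≤ q) {i j : ℤ} (hji : j ≤ i) {K : ℝ≥0∞}
    {a b : (Fin d → ℤ) → ℝ≥0∞}
    (h : ∀ k, a k ≤ K * ∑ l ∈ nearR 2 (fun t => (2 : ℝ) ^ (j - i) * k t), b l) :
    ellNorm q a ≤
      K * (5 ^ d * (2 : ℝ≥0∞) ^ (((i : ℝ) - j) * (d / q))) * ellNorm q b := by
  have hq0 : 0 < q := by linarith
  have h2 : (1 : ℝ) ≤ (2 : ℝ) ^ (i - j) := one_le_zpow₀ one_le_two (by omega)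
  have h3 : (2 : ℝ) ^ (i - j) * (2 : ℝ) ^ (j - i) = 1 := by
    rw [← zpow_add₀ two_ne_zero]
    simp
  have key := ellNorm_le_of_overlap hq (C := K) (n := ENNReal.ofReal (5 ^ d))
    (m := ENNReal.ofReal ((5 * (2 : ℝ) ^ (i - j)) ^ d))
    (fun k : Fin d → ℤ => nearR 2 fun t => (2 : ℝ) ^ (j - i) * k t)
    (fun l : Fin d → ℤ => nearR (2 * (2 : ℝ) ^ (i - j)) fun t => (2 : ℝ) ^ (i - j) * l t)
    (fun k => card_nearR_enorm_le two_pos.le (by norm_num) _)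
    (fun l => card_nearR_enorm_le (by positivity) (by linarith) _)
    (fun k l hl => by
      rw [mem_nearR] at hl ⊢
      intro t
      have e : (k t : ℝ) - (2 : ℝ) ^ (i - j) * l t =
          -((2 : ℝ) ^ (i - j) * (l t - (2 : ℝ) ^ (j - i) * k t)) := by
        rw [mul_sub, ← mul_assoc, h3]
        ring
      rw [e, abs_neg, abs_mul, abs_of_pos (by positivity), mul_comm]
      gcongr
      exact hl t) h
  refine key.trans (le_of_eq ?_)
  congr 2
  have e5 : (0 : ℝ) ≤ 5 ^ d := by positivity
  have hz : (0 : ℝ) ≤ (2 : ℝ) ^ (i - j) := by positivity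
  rw [ENNReal.ofReal_rpow_of_nonneg e5 (by linarith), ← ENNReal.ofReal_mul (by positivity),
    ENNReal.ofReal_rpow_of_nonneg (by positivity) (by positivity), mul_pow, ← mul_assoc]
  have e1 : ((5 : ℝ) ^ d) ^ (q - 1) * 5 ^ d = ((5 : ℝ) ^ d) ^ q := by
    rw [Real.rpow_sub_one (by positivity), div_mul_cancel₀ _ (by positivity)]
  rw [e1, Real.mul_rpow (by positivity) (by positivity), ← Real.rpow_mul e5,
    mul_one_div_cancel hq0.ne', Real.rpow_one, ENNReal.ofReal_mul e5, ENNReal.ofReal_pow (by norm_num)]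
  congr 1
  · congr 1
    norm_num
  · rw [← Real.rpow_intCast, ← Real.rpow_natCast, ← Real.rpow_mul (Real.rpow_nonneg two_pos.le _),
      ← Real.rpow_mul two_pos.le, ← ENNReal.ofReal_rpow_of_pos (by norm_num)]
    congr 1
    · norm_num
    · push_cast
      ring

theorem sum_sym_of_subset (hψ : IsCutoff ψ) {j : ℤ} {ξ : Eu d} {S : Finset (Fin d → ℤ)}
    (h : ∀ l : Fin d → ℤ, (∀ t, |frq j * ξ t - l t| ≤ 3 / 4) → l ∈ S) :
    ∑ l ∈ S, sym hψ j l ξ = 1 := by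
  classical
  rw [← sum_sym hψ (j := j) (ξ := ξ) (x := fun t => frq j * ξ t) fun t => by simp; norm_num]
  refine Finset.sum_congr_of_eq_on_inter ?_ ?_ fun _ _ _ => rfl
  · intro l _ hl
    by_contra h0
    refine hl (mem_nearR.2 fun t => ?_)
    have := sym_ne_zero hψ h0 t
    rw [abs_sub_comm]
    linarith
  · intro l _ hl
    by_contra h0
    exact hl (h l (sym_ne_zero hψ h0))

theorem BandLimited.exists_eq_sum (hψ : IsCutoff ψ) (j : ℤ) {φ : TestFn d} (hφ : BandLimited φ) :
    ∃ S : Finset (Fin d → ℤ), ∀ S', S ⊆ S' → φ = ∑ k ∈ S', mop (sym hψ j k) φ := by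
  obtain ⟨R, hR⟩ := hφ
  refine ⟨nearR (frq j * R + 1) 0, fun S' hS => ext_fourier fun ξ => ?_⟩
  simp only [fourier_sum, fourier_mop]
  rw [← Finset.sum_mul]
  rcases eq_or_ne (𝓕 φ ξ) 0 with h0 | h0
  · rw [h0, mul_zero]
  · rw [sum_sym_of_subset hψ fun l hl => hS (mem_nearR.2 fun t => ?_), one_mul]
    have h1 := hl t
    have h2 := mul_le_mul_of_nonneg_left (hR ξ h0 t) (frq_pos j).le
    have h3 : |frq j * ξ t| = frq j * |ξ t| := by rw [abs_mul, abs_of_pos (frq_pos j)]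
    rw [← h3] at h2
    rw [Pi.zero_apply, sub_zero]
    rw [_root_.abs_le] at *
    constructor <;> linarith [h1.1, h1.2, h2.1, h2.2]

theorem fourier_mop_sym_ne_zero (hψ : IsCutoff ψ) {j : ℤ} {k : Fin d → ℤ} {φ : TestFn d} {ξ : Eu d}
    (h : 𝓕 (mop (sym hψ j k) φ) ξ ≠ 0) (t : Fin d) : |frq j * ξ t - k t| ≤ 3 / 4 := by
  rw [fourier_mop] at h
  exact sym_ne_zero hψ (left_ne_zero_of_mul h) t

theorem fourier_mop_refl_sym_ne_zero (hψ : IsCutoff ψ) {j : ℤ} {k : Fin d → ℤ} {φ : TestFn d}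
    {ξ : Eu d} (h : 𝓕 (mop (refl (sym hψ j k)) φ) ξ ≠ 0) (t : Fin d) :
    |frq j * ξ t + k t| ≤ 3 / 4 := by
  rw [fourier_mop, refl_apply] at h
  have := sym_ne_zero hψ (left_ne_zero_of_mul h) t
  have e : (-ξ) t = -(ξ t) := rfl
  rw [e] at this
  rw [← abs_neg]
  convert this using 2
  ring

theorem levelNorm_ofSchwartz (hψ : IsCutoff ψ) (hp : 1 ≤ p) (q : ℝ) (j : ℤ) (φ : TestFn d) :
    levelNorm ψ p q j (ofSchwartz φ) = ellNorm q fun k => sNorm p (mop (sym hψ j k) φ) := by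
  simp only [levelNorm, box_ofSchwartz hψ, lpNorm_ofSchwartz hp]

theorem enorm_apply_le_of_bandLimited (hψ : IsCutoff ψ) (hpp : p.HolderConjugate p')
    (hqq : q.HolderConjugate q') (j : ℤ) (f : TDist d) {φ : TestFn d} (hφ : BandLimited φ) :
    ‖f φ‖ₑ ≤ 5 ^ d * levelNorm ψ p q j f * levelNorm ψ p' q' j (ofSchwartz φ) := by
  obtain ⟨S, hS⟩ := hφ.exists_eq_sum hψ j
  set a : (Fin d → ℤ) → ℝ≥0∞ := fun k =>
    ∑ l ∈ nearR 2 (fun t => -(k t : ℝ)), lpNorm p (box ψ j l f) with ha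
  set b : (Fin d → ℤ) → ℝ≥0∞ := fun k => sNorm p' (mop (sym hψ j k) φ) with hb
  have h1 : ∀ k, ‖f (mop (sym hψ j k) φ)‖ₑ ≤ a k * b k := by
    intro k
    rw [apply_eq_sum_box hψ j (fun t => -(k t : ℝ)) f _ fun ξ hξ t => by
      have := fourier_mop_sym_ne_zero hψ hξ t
      rw [← sub_eq_add_neg]
      linarith]
    refine (enorm_sum_le _ _).trans ?_
    rw [ha, Finset.sum_mul]
    exact Finset.sum_le_sum fun l _ => enorm_apply_le_lpNorm hpp _ _
  have h2 : ellNorm q a ≤ 5 ^ d * levelNorm ψ p q j f := by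
    rw [← ellNorm_comp_equiv (Equiv.neg _) q a]
    have := ellNorm_le_of_near (d := d) hqq.lt.le (i := j) (j := j) le_rfl (K := 1)
      (a := fun k => a (Equiv.neg (Fin d → ℤ) k)) (b := fun l => lpNorm p (box ψ j l f))
      fun k => by simp [ha]
    simpa [levelNorm] using this
  calc ‖f φ‖ₑ = ‖∑ k ∈ S, f (mop (sym hψ j k) φ)‖ₑ := by
        conv_lhs => rw [hS S subset_rfl, map_sum]
    _ ≤ ∑ k ∈ S, a k * b k := (enorm_sum_le _ _).trans (Finset.sum_le_sum fun k _ => h1 k)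
    _ ≤ ∑' k, a k * b k := ENNReal.sum_le_tsum S
    _ ≤ ellNorm q a * ellNorm q' b := tsum_mul_le_ellNorm hqq a b
    _ ≤ _ := by
        rw [levelNorm_ofSchwartz hψ hpp.symm.lt.le]
        exact mul_le_mul_left h2 _

theorem levelNorm_mop_le (hψ : IsCutoff ψ) (hpp : p.HolderConjugate p') (hq : 0 < q) (j : ℤ)
    (m φ : TestFn d) :
    levelNorm ψ p q j (ofSchwartz (mop m φ)) ≤
      kerNorm 1 m * levelNorm ψ p q j (ofSchwartz φ) := by
  rw [levelNorm_ofSchwartz hψ hpp.lt.le, levelNorm_ofSchwartz hψ hpp.lt.le,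
    ← ellNorm_const_mul hq]
  refine ellNorm_mono hq fun k => ?_
  rw [mop_comm]
  exact sNorm_mop_le hpp _ _

/-- Distributions and test functions are paired at each level, with a constant independent of the
level. -/
theorem exists_pairing_const (hψ : IsCutoff ψ) (hpp : p.HolderConjugate p')
    (hqq : q.HolderConjugate q') : ∃ C : ℝ≥0∞, C ≠ ⊤ ∧ ∀ (j : ℤ) (f : TDist d) (φ : TestFn d),
      ‖f φ‖ₑ ≤ C * (levelNorm ψ p q j f * levelNorm ψ p' q' j (ofSchwartz φ)) := by
  obtain ⟨η, h0, hη⟩ := exists_plateau d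
  refine ⟨5 ^ d * kerNorm 1 η, ENNReal.mul_ne_top (by simp) (kerNorm_ne_top _ _),
    fun j f φ => ?_⟩
  have hlim := ((f.continuous.tendsto φ).comp (tendsto_mop_dil η h0 φ)).enorm
  refine le_of_tendsto hlim (Eventually.of_forall fun n => ?_)
  have hn : (0 : ℝ) < 1 / ((n : ℝ) + 1) := by positivity
  refine (enorm_apply_le_of_bandLimited hψ hpp hqq j f
    (bandLimited_mop_dil hη hn φ)).trans ?_
  have h1 := levelNorm_mop_le (q := q') hψ hpp.symm hqq.symm.pos j
    (dil (1 / ((n : ℝ) + 1)) 0 η) φ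
  rw [kerNorm_one_dil hn] at h1
  calc _ ≤ 5 ^ d * levelNorm ψ p q j f *
        (kerNorm 1 η * levelNorm ψ p' q' j (ofSchwartz φ)) := mul_le_mul_right h1 _
    _ = _ := by ring

end Levels

/-! ### Decay of the pieces of a Schwartz function -/

section Decay

open FourierTransform

variable {d : ℕ} {p p' q q' r r' : ℝ} {ψ : Eu d → ℝ}

/-- A finite function on the Schwartz space which is continuous and vanishes at the origin. -/
structure SchwartzBound (σ : TestFn d → ℝ≥0∞) : Prop where
  continuous : Continuous σ
  ne_top : ∀ φ, σ φ ≠ ⊤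
  zero : σ 0 = 0

theorem SchwartzBound.add {σ τ : TestFn d → ℝ≥0∞} (hσ : SchwartzBound σ) (hτ : SchwartzBound τ) :
    SchwartzBound fun φ => σ φ + τ φ :=
  ⟨hσ.continuous.add hτ.continuous, fun φ => ENNReal.add_ne_top.2 ⟨hσ.ne_top φ, hτ.ne_top φ⟩,
    by simp [hσ.zero, hτ.zero]⟩

theorem SchwartzBound.sum {ι : Type*} (s : Finset ι) {σ : ι → TestFn d → ℝ≥0∞}
    (hσ : ∀ i, SchwartzBound (σ i)) : SchwartzBound fun φ => ∑ i ∈ s, σ i φ :=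
  ⟨continuous_finsetSum _ fun i _ => (hσ i).continuous,
    fun φ => ENNReal.sum_ne_top.2 fun i _ => (hσ i).ne_top φ, by simp [(hσ _).zero]⟩

theorem SchwartzBound.const_mul {σ : TestFn d → ℝ≥0∞} (hσ : SchwartzBound σ) {c : ℝ≥0∞}
    (hc : c ≠ ⊤) : SchwartzBound fun φ => c * σ φ :=
  ⟨ENNReal.continuous_const_mul hc |>.comp hσ.continuous,
    fun φ => ENNReal.mul_ne_top hc (hσ.ne_top φ), by simp [hσ.zero]⟩

theorem SchwartzBound.comp {σ : TestFn d → ℝ≥0∞} (hσ : SchwartzBound σ)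
    (T : TestFn d →L[ℂ] TestFn d) : SchwartzBound fun φ => σ (T φ) :=
  ⟨hσ.continuous.comp T.continuous, fun φ => hσ.ne_top _, by simp [hσ.zero]⟩

theorem schwartzBound_sNorm_one : SchwartzBound (sNorm 1 : TestFn d → ℝ≥0∞) :=
  ⟨continuous_sNorm le_rfl, sNorm_ne_top 1, sNorm_zero 1⟩

theorem hasTemperateGrowth_coord (c : ℝ) (t : Fin d) :
    Function.HasTemperateGrowth fun ξ : Eu d => ((c * ξ t : ℝ) : ℂ) := by
  have h : (fun ξ : Eu d => ((c * ξ t : ℝ) : ℂ)) =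
      ((c • Complex.ofRealCLM) ∘L (EuclideanSpace.proj t : Eu d →L[ℝ] ℝ)) := by
    funext ξ
    simp
  rw [h]
  exact ContinuousLinearMap.hasTemperateGrowth _

theorem mop_dil_coord (t : Fin d) (w : TestFn d) (l : Fin d → ℤ) (φ : TestFn d) :
    (l t : ℂ) • mop (dil (frq 0) (intVec l) w) φ =
      mop (dil (frq 0) (intVec l) w)
        (SchwartzMap.fourierMultiplierCLM ℂ (fun ξ : Eu d => ((frq 0 * ξ t : ℝ) : ℂ)) φ) -
      mop (dil (frq 0) (intVec l)
        (SchwartzMap.smulLeftCLM ℂ (fun ξ : Eu d => ((1 * ξ t : ℝ) : ℂ)) w)) φ := by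
  refine ext_fourier fun ξ => ?_
  have h1 : ∀ a b : TestFn d, 𝓕 (a - b) = 𝓕 a - 𝓕 b := fun a b =>
    map_sub (FourierTransform.fourierCLM ℂ (TestFn d)) a b
  have h2 : ∀ (c : ℂ) (a : TestFn d), 𝓕 (c • a) = c • 𝓕 a := fun c a =>
    map_smul (FourierTransform.fourierCLM ℂ (TestFn d)) c a
  have e : (frq 0 • ξ - intVec l) t = frq 0 * ξ t - l t := rfl
  rw [h1, h2, _root_.sub_apply, _root_.smul_apply, fourier_mop, fourier_mop, fourier_mop,
    SchwartzMap.fourierMultiplierCLM_apply, FourierTransform.fourier_fourierInv_eq,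
    SchwartzMap.smulLeftCLM_apply_apply (hasTemperateGrowth_coord _ t),
    dil_apply (frq_pos 0).ne', dil_apply (frq_pos 0).ne',
    SchwartzMap.smulLeftCLM_apply_apply (hasTemperateGrowth_coord _ t), e]
  simp only [smul_eq_mul]
  push_cast
  ring

theorem exists_decay_coord (t : Fin d) (N : ℕ) : ∀ w : TestFn d, ∃ σ : TestFn d → ℝ≥0∞,
    SchwartzBound σ ∧ ∀ (l : Fin d → ℤ) (φ : TestFn d),
      ‖(l t : ℂ)‖ₑ ^ N * sNorm 1 (mop (dil (frq 0) (intVec l) w) φ) ≤ σ φ := by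
  induction N with
  | zero =>
    refine fun w => ⟨fun φ => kerNorm 1 w * sNorm 1 φ,
      schwartzBound_sNorm_one.const_mul (kerNorm_ne_top _ _), fun l φ => ?_⟩
    rw [pow_zero, one_mul, ← kerNorm_one_dil (frq_pos 0) (intVec l) w]
    exact sNorm_one_mop_le _ _
  | succ N ih =>
    intro w
    obtain ⟨σ, hσ, h1⟩ := ih w
    obtain ⟨τ, hτ, h2⟩ := ih (SchwartzMap.smulLeftCLM ℂ (fun ξ : Eu d => ((1 * ξ t : ℝ) : ℂ)) w)
    refine ⟨_, (hσ.comp (SchwartzMap.fourierMultiplierCLM ℂ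
      (fun ξ : Eu d => ((frq 0 * ξ t : ℝ) : ℂ)))).add hτ, fun l φ => ?_⟩
    rw [pow_succ, mul_assoc, ← sNorm_smul, mop_dil_coord, sub_eq_add_neg]
    have h3 : ∀ η : TestFn d, sNorm 1 (-η) = sNorm 1 η := fun η => by
      rw [← neg_one_smul ℂ η, sNorm_smul]
      simp
    refine (mul_le_mul_right (sNorm_add_le le_rfl _ _) _).trans ?_
    rw [h3, mul_add]
    exact add_le_add (h1 l _) (h2 l φ)

theorem tsum_prod_le {ι κ : Type*} [Fintype ι] (f : κ → ℝ≥0∞) :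
    ∑' l : ι → κ, ∏ t, f (l t) ≤ (∑' n, f n) ^ Fintype.card ι := by
  classical
  rw [ENNReal.tsum_eq_iSup_sum]
  refine iSup_le fun s => ?_
  have hs : s ⊆ Fintype.piFinset fun t => s.image fun l => l t := fun l hl =>
    Fintype.mem_piFinset.2 fun t => Finset.mem_image_of_mem _ hl
  calc ∑ l ∈ s, ∏ t, f (l t)
      ≤ ∑ l ∈ Fintype.piFinset fun t => s.image fun l => l t, ∏ t, f (l t) :=
        Finset.sum_le_sum_of_subset hs
    _ = ∏ t, ∑ n ∈ s.image fun l => l t, f n := (Finset.prod_univ_sum _ _).symm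
    _ ≤ ∏ _t : ι, ∑' n, f n := Finset.prod_le_prod' fun t _ => ENNReal.sum_le_tsum _
    _ = _ := by simp

/-- The polynomial weight in one integer coordinate. -/
def coordWeight (n : ℤ) : ℝ≥0∞ := 1 + ‖(n : ℂ)‖ₑ ^ 2

theorem coordWeight_ne_zero (n : ℤ) : coordWeight n ≠ 0 := by simp [coordWeight]

theorem coordWeight_ne_top (n : ℤ) : coordWeight n ≠ ⊤ := by simp [coordWeight]

theorem tsum_inv_coordWeight_ne_top : ∑' n, (coordWeight n)⁻¹ ≠ ⊤ := by
  have h1 : Summable fun n : ℤ => (if n = 0 then (1 : ℝ) else 0) + 1 / (n : ℝ) ^ 2 :=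
    (hasSum_ite_eq 0 (1 : ℝ)).summable.add (Real.summable_one_div_int_pow.2 one_lt_two)
  refine ne_top_of_le_ne_top h1.tsum_ofReal_ne_top (ENNReal.tsum_le_tsum fun n => ?_)
  have h2 : coordWeight n = ENNReal.ofReal (1 + (n : ℝ) ^ 2) := by
    rw [coordWeight, ENNReal.ofReal_add one_pos.le (by positivity), ENNReal.ofReal_one,
      ← ofReal_norm, Complex.norm_intCast, ← ENNReal.ofReal_pow (abs_nonneg _), sq_abs]
  rw [h2, ← ENNReal.ofReal_inv_of_pos (by positivity)]
  refine ENNReal.ofReal_le_ofReal ?_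
  rcases eq_or_ne n 0 with rfl | hn
  · simp
  · have : (0 : ℝ) < (n : ℝ) ^ 2 := by positivity
    rw [if_neg hn, zero_add, one_div]
    exact inv_anti₀ this (by linarith)

theorem coordWeight_pow_le (n : ℤ) (N : ℕ) :
    coordWeight n ^ N ≤ 2 ^ N * (1 + ‖(n : ℂ)‖ₑ ^ (2 * N)) := by
  rw [coordWeight]
  rcases le_total (‖(n : ℂ)‖ₑ ^ 2) 1 with h | h
  · calc (1 + ‖(n : ℂ)‖ₑ ^ 2) ^ N ≤ (1 + 1) ^ N := by gcongr
      _ = 2 ^ N * 1 := by norm_num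
      _ ≤ _ := mul_le_mul_right le_self_add _
  · calc (1 + ‖(n : ℂ)‖ₑ ^ 2) ^ N ≤ (‖(n : ℂ)‖ₑ ^ 2 + ‖(n : ℂ)‖ₑ ^ 2) ^ N := by gcongr
      _ = 2 ^ N * ‖(n : ℂ)‖ₑ ^ (2 * N) := by rw [← two_mul, mul_pow, pow_mul]
      _ ≤ _ := mul_le_mul_right le_add_self _

theorem prod_le_one_add_sum_pow {ι : Type*} [Fintype ι] (a : ι → ℝ≥0∞) :
    ∏ t, a t ≤ 1 + ∑ t, a t ^ Fintype.card ι := by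
  rcases isEmpty_or_nonempty ι with h | h
  · simp
  · obtain ⟨s, -, hs⟩ := Finset.exists_max_image Finset.univ a Finset.univ_nonempty
    calc ∏ t, a t ≤ ∏ _t : ι, a s := Finset.prod_le_prod' fun t ht => hs t ht
      _ = a s ^ Fintype.card ι := by simp
      _ ≤ ∑ t, a t ^ Fintype.card ι :=
        Finset.single_le_sum (f := fun t => a t ^ Fintype.card ι) (fun _ _ => zero_le)
          (Finset.mem_univ s)
      _ ≤ _ := le_add_self

theorem exists_decay (hψ : IsCutoff ψ) : ∃ σ : TestFn d → ℝ≥0∞, SchwartzBound σ ∧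
    ∀ φ, ∑' l, sNorm 1 (mop (sym hψ 0 l) φ) ≤ σ φ := by
  choose σ hσ h using fun t : Fin d => exists_decay_coord t (2 * d) hψ.toTestFn
  set τ : TestFn d → ℝ≥0∞ := fun φ => kerNorm 1 hψ.toTestFn * sNorm 1 φ with hτ
  have hτb : SchwartzBound τ := schwartzBound_sNorm_one.const_mul (kerNorm_ne_top _ _)
  have h0 : ∀ l φ, sNorm 1 (mop (sym hψ 0 l) φ) ≤ τ φ := fun l φ => by
    rw [hτ, ← kerNorm_one_dil (frq_pos 0) (intVec l)]
    exact sNorm_one_mop_le _ _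
  set S : ℝ≥0∞ := (∑' n, (coordWeight n)⁻¹) ^ d with hS
  have hS' : S ≠ ⊤ := ENNReal.pow_ne_top tsum_inv_coordWeight_ne_top
  refine ⟨_, (hτb.add (SchwartzBound.sum Finset.univ fun t =>
    (hτb.add (hσ t)).const_mul (c := 2 ^ d) (by simp))).const_mul hS', fun φ => ?_⟩
  set A := τ φ + ∑ t, 2 ^ d * (τ φ + σ t φ)
  have key : ∀ l, sNorm 1 (mop (sym hψ 0 l) φ) ≤ A * ∏ t, (coordWeight (l t))⁻¹ := by
    intro l
    set W := sNorm 1 (mop (sym hψ 0 l) φ)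
    have hprod : (∏ t, coordWeight (l t)) * ∏ t, (coordWeight (l t))⁻¹ = 1 := by
      rw [← Finset.prod_mul_distrib]
      exact Finset.prod_eq_one fun t _ =>
        ENNReal.mul_inv_cancel (coordWeight_ne_zero _) (coordWeight_ne_top _)
    calc W = W * (∏ t, coordWeight (l t)) * ∏ t, (coordWeight (l t))⁻¹ := by
          rw [mul_assoc, hprod, mul_one]
      _ ≤ A * ∏ t, (coordWeight (l t))⁻¹ := by
          refine mul_le_mul_left ?_ _
          calc W * ∏ t, coordWeight (l t)
              ≤ W * (1 + ∑ t, 2 ^ d * (1 + ‖(l t : ℂ)‖ₑ ^ (2 * d))) := by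
                refine mul_le_mul_right ((prod_le_one_add_sum_pow _).trans ?_) _
                rw [Fintype.card_fin]
                exact add_le_add le_rfl (Finset.sum_le_sum fun t _ => coordWeight_pow_le _ _)
            _ = W + ∑ t, 2 ^ d * (W + ‖(l t : ℂ)‖ₑ ^ (2 * d) * W) := by
                rw [mul_add, mul_one, Finset.mul_sum]
                congr 1
                exact Finset.sum_congr rfl fun t _ => by ring
            _ ≤ A := by
                refine add_le_add (h0 l φ) (Finset.sum_le_sum fun t _ => ?_)
                exact mul_le_mul_right (add_le_add (h0 l φ) (h t l φ)) _
  calc ∑' l, sNorm 1 (mop (sym hψ 0 l) φ) ≤ ∑' l : Fin d → ℤ, A * ∏ t, (coordWeight (l t))⁻¹ :=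
        ENNReal.tsum_le_tsum key
    _ = A * ∑' l : Fin d → ℤ, ∏ t, (coordWeight (l t))⁻¹ := ENNReal.tsum_mul_left
    _ ≤ A * S := by
        refine mul_le_mul_right ?_ _
        have := tsum_prod_le (ι := Fin d) fun n => (coordWeight n)⁻¹
        rwa [Fintype.card_fin] at this
    _ = S * A := mul_comm _ _

theorem ellNorm_le_tsum {ι : Type*} (hq : 1 ≤ q) (a : ι → ℝ≥0∞) : ellNorm q a ≤ ∑' i, a i := by
  have hq0 : 0 < q := by linarith
  rw [ellNorm_le_iff hq0]
  have h1 : ∀ i, a i ^ q ≤ a i * (∑' i, a i) ^ (q - 1) := fun i => by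
    have h2 : a i ^ q = a i * a i ^ (q - 1) := by
      rcases eq_or_ne (a i) 0 with h0 | h0
      · rw [h0, ENNReal.zero_rpow_of_pos hq0, zero_mul]
      · rcases eq_or_ne (a i) ⊤ with ht | ht
        · rw [ht, ENNReal.top_rpow_of_pos hq0, ENNReal.top_mul]
          rcases eq_or_lt_of_le hq with rfl | hq1
          · simp
          · rw [ENNReal.top_rpow_of_pos (by linarith)]
            exact ENNReal.top_ne_zero
        · nth_rewrite 2 [← ENNReal.rpow_one (a i)]
          rw [← ENNReal.rpow_add _ _ h0 ht]
          congr 1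
          ring
    rw [h2]
    exact mul_le_mul_right (ENNReal.rpow_le_rpow (ENNReal.le_tsum i) (by linarith)) _
  refine (ENNReal.tsum_le_tsum h1).trans ?_
  rw [ENNReal.tsum_mul_right]
  rcases eq_or_ne (∑' i, a i) 0 with h0 | h0
  · rw [h0, zero_mul]
    exact zero_le
  · rcases eq_or_ne (∑' i, a i) ⊤ with ht | ht
    · rw [ht, ENNReal.top_rpow_of_pos hq0]
      exact le_top
    · nth_rewrite 1 [← ENNReal.rpow_one (∑' i, a i)]
      rw [← ENNReal.rpow_add _ _ h0 ht]
      exact le_of_eq (by congr 1; ring)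

/-- Young's inequality, `L^p * L^1 ⊆ L^p`. -/
theorem sNorm_mop_le_kerNorm (hpp : p.HolderConjugate p') (m φ : TestFn d) :
    sNorm p (mop m φ) ≤ kerNorm p m * sNorm 1 φ := by
  have h : mop m φ = mop (𝓕 φ) (𝓕⁻ m) := ext_fourier fun ξ => by
    rw [fourier_mop, fourier_mop, FourierTransform.fourier_fourierInv_eq, mul_comm]
  rw [h, mul_comm]
  refine (sNorm_mop_le hpp _ _).trans (le_of_eq ?_)
  rw [kerNorm, kerNorm, FourierTransform.fourierInv_fourier_eq]

theorem kerNorm_sym_le_rpow (hψ : IsCutoff ψ) (hp : 1 ≤ p) (j : ℤ) (k : Fin d → ℤ) :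
    kerNorm p (sym hψ j k) ≤
      (2 : ℝ≥0∞) ^ ((j : ℝ) * (d * (1 - 1 / p))) * kerNorm p hψ.toTestFn := by
  have hp0 : 0 < p := by linarith
  rw [sym, kerNorm_dil (frq_pos j) hp0]
  refine mul_le_mul_left ?_ _
  have h1 : (2 : ℝ≥0∞) ^ (-(j : ℝ)) ≤ ENNReal.ofReal (frq j) := by
    have h2 : (2 : ℝ≥0∞) ^ (-(j : ℝ)) = ENNReal.ofReal ((2 : ℝ) ^ (-j)) := by
      rw [← Real.rpow_intCast, ← ENNReal.ofReal_rpow_of_pos two_pos]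
      norm_num
    rw [h2, frq]
    refine ENNReal.ofReal_le_ofReal (le_mul_of_one_le_right (by positivity) ?_)
    linarith [Real.pi_gt_three]
  have h3 : (d : ℝ) * (1 / p - 1) = -(d * (1 - 1 / p)) := by ring
  have h4 : 0 ≤ (d : ℝ) * (1 - 1 / p) := by
    have : 1 / p ≤ 1 := by rw [div_le_one hp0]; exact hp
    have : 0 ≤ 1 - 1 / p := by linarith
    positivity
  have h5 : (2 : ℝ≥0∞) ^ ((j : ℝ) * (d * (1 - 1 / p))) =
      ((2 : ℝ≥0∞) ^ (-(j : ℝ))) ^ (-((d : ℝ) * (1 - 1 / p))) := by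
    rw [← ENNReal.rpow_mul]
    congr 1
    ring
  rw [h3, h5, ENNReal.rpow_neg, ENNReal.rpow_neg, ENNReal.inv_le_inv]
  exact ENNReal.rpow_le_rpow h1 h4

/-- The exponent of the growth of the norms of a Schwartz function at the level `j`. -/
def levExp (d : ℕ) (p q : ℝ) : ℝ := d * (1 - 1 / p - 1 / q)

theorem mop_sym_eq_sum (hψ : IsCutoff ψ) {i j : ℤ} (hji : j ≤ i) (k : Fin d → ℤ) (φ : TestFn d) :
    mop (sym hψ j k) φ = ∑ l ∈ nearR 2 (fun t => (2 : ℝ) ^ (j - i) * k t),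
      mop (sym hψ j k) (mop (sym hψ i l) φ) := by
  have h := eq_sum_mop hψ i (fun t => (2 : ℝ) ^ (j - i) * k t) (mop (sym hψ j k) φ)
    fun ξ hξ t => by
      have h1 := fourier_mop_sym_ne_zero hψ hξ t
      have h2 : (2 : ℝ) ^ (j - i) ≤ 1 := zpow_le_one_of_nonpos₀ one_le_two (by omega)
      rw [frq_eq i j, mul_assoc, ← mul_sub, abs_mul, abs_of_pos (by positivity)]
      calc _ ≤ 1 * (3 / 4 : ℝ) := by gcongr
        _ ≤ _ := by norm_num
  conv_lhs => rw [h]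
  exact Finset.sum_congr rfl fun l _ => mop_comm _ _ _

theorem exists_levelNorm_schwartz_le (hψ : IsCutoff ψ) (hpp : p.HolderConjugate p') (hq : 1 ≤ q) :
    ∃ σ : TestFn d → ℝ≥0∞, SchwartzBound σ ∧ ∀ j : ℤ, j ≤ 0 → ∀ φ,
      levelNorm ψ p q j (ofSchwartz φ) ≤ (2 : ℝ≥0∞) ^ ((j : ℝ) * levExp d p q) * σ φ := by
  obtain ⟨σ, hσ, h⟩ := exists_decay hψ
  have hK := kerNorm_ne_top p hψ.toTestFn
  refine ⟨_, hσ.const_mul (c := 5 ^ d * kerNorm p hψ.toTestFn)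
    (ENNReal.mul_ne_top (by simp) hK), fun j hj φ => ?_⟩
  rw [levelNorm_ofSchwartz hψ hpp.lt.le]
  refine (ellNorm_le_of_near hq hj
    (K := (2 : ℝ≥0∞) ^ ((j : ℝ) * (d * (1 - 1 / p))) * kerNorm p hψ.toTestFn)
    (b := fun l => sNorm 1 (mop (sym hψ 0 l) φ)) fun k => ?_).trans ?_
  · rw [mop_sym_eq_sum hψ hj, Finset.mul_sum]
    refine (sNorm_sum_le hpp.lt.le _ _).trans (Finset.sum_le_sum fun l _ => ?_)
    exact (sNorm_mop_le_kerNorm hpp _ _).trans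
      (mul_le_mul_left (kerNorm_sym_le_rpow hψ hpp.lt.le j k) _)
  · have h1 := (ellNorm_le_tsum hq fun l => sNorm 1 (mop (sym hψ 0 l) φ)).trans (h φ)
    have h2 : (2 : ℝ≥0∞) ^ ((j : ℝ) * levExp d p q) = (2 : ℝ≥0∞) ^ ((j : ℝ) * (d * (1 - 1 / p))) *
        (2 : ℝ≥0∞) ^ ((((0 : ℤ) : ℝ) - j) * (d / q)) := by
      rw [← ENNReal.rpow_add _ _ two_ne_zero ENNReal.ofNat_ne_top, levExp]
      congr 1
      push_cast
      ring
    rw [h2]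
    calc _ ≤ _ := mul_le_mul_right h1 _
      _ = _ := by ring

end Decay

/-! ### Schwartz functions have finite norms -/

section Finite

variable {d : ℕ} {p p' q q' r r' : ℝ} {ψ : Eu d → ℝ}

/-- The nonpositive integers, enumerated. -/
def natEquivIic : ℕ ≃ Set.Iic (0 : ℤ) where
  toFun n := ⟨-(n : ℤ), by simp⟩
  invFun j := (-(j : ℤ)).toNat
  left_inv n := by simp
  right_inv j := by
    have := j.2
    simp only [Set.mem_Iic] at this
    ext
    simp only [Int.ofNat_toNat]
    omega

theorem ellNorm_geometric_ne_top (hr : 0 < r) {ε : ℝ} (hε : 0 < ε) :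
    ellNorm r (fun j : Set.Iic (0 : ℤ) => (2 : ℝ≥0∞) ^ (((j : ℤ) : ℝ) * ε)) ≠ ⊤ := by
  rw [← ellNorm_comp_equiv natEquivIic]
  refine ENNReal.rpow_ne_top_of_nonneg (by positivity) ?_
  have h : ∀ n : ℕ, ((2 : ℝ≥0∞) ^ ((((natEquivIic n : Set.Iic (0 : ℤ)) : ℤ) : ℝ) * ε)) ^ r =
      ((2 : ℝ≥0∞) ^ (-(ε * r))) ^ n := fun n => by
    have : ((natEquivIic n : Set.Iic (0 : ℤ)) : ℤ) = -(n : ℤ) := rfl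
    rw [this, ← ENNReal.rpow_mul, ← ENNReal.rpow_natCast, ← ENNReal.rpow_mul]
    congr 1
    push_cast
    ring
  simp only [h]
  rw [ENNReal.tsum_geometric]
  refine ENNReal.inv_ne_top.2 (tsub_pos_of_lt ?_).ne'
  exact ENNReal.rpow_lt_one_of_one_lt_of_neg ENNReal.one_lt_two (by simpa using mul_pos hε hr)

theorem exists_frakNorm_schwartz_le (hψ : IsCutoff ψ) (hpp : p.HolderConjugate p') (hq : 1 ≤ q)
    (hr : 1 ≤ r) {s : ℝ} (hs : 0 < s + levExp d p q) :
    ∃ σ : TestFn d → ℝ≥0∞, SchwartzBound σ ∧ ∀ φ,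
      frakNorm ψ s p q r (ofSchwartz φ) ≤ σ φ := by
  obtain ⟨σ, hσ, h⟩ := exists_levelNorm_schwartz_le hψ hpp hq
  have hr0 : 0 < r := by linarith
  have hG := ellNorm_geometric_ne_top hr0 hs
  refine ⟨_, hσ.const_mul hG, fun φ => ?_⟩
  rw [mul_comm, ← ellNorm_const_mul hr0]
  refine ellNorm_mono hr0 fun j => ?_
  refine (mul_le_mul_right (h j j.2 φ) _).trans (le_of_eq ?_)
  rw [← mul_assoc, ← ENNReal.rpow_add _ _ two_ne_zero ENNReal.ofNat_ne_top, mul_add, mul_comm]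

theorem scrNorm_le_levelNorm (hq : 1 ≤ q) (hr : 1 ≤ r) (μ : ℝ) (j : Set.Iic (0 : ℤ)) (h : TDist d) :
    scrNorm ψ μ p q r h ≤ (2 : ℝ≥0∞) ^ (((j : ℤ) : ℝ) * μ) * levelNorm ψ p q j h := by
  classical
  refine iInf₂_le_of_le (fun i => if i = j then h else 0) (hasSum_ite_eq j h) ?_
  have h1 : ∀ i : Set.Iic (0 : ℤ), i ≠ j →
      (2 : ℝ≥0∞) ^ (((i : ℤ) : ℝ) * μ) * levelNorm ψ p q i (if i = j then h else 0) = 0 :=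
    fun i hi => by rw [if_neg hi, levelNorm_zero ψ hq, mul_zero]
  rw [familyNorm, ellNorm, tsum_eq_single j fun i hi => by
    rw [h1 i hi, ENNReal.zero_rpow_of_pos (by linarith)], ← ENNReal.rpow_mul,
    mul_one_div_cancel (by linarith), ENNReal.rpow_one, if_pos rfl]

theorem exists_scrNorm_schwartz_le (hψ : IsCutoff ψ) (hpp : p.HolderConjugate p') (hq : 1 ≤ q)
    (hr : 1 ≤ r) (μ : ℝ) :
    ∃ σ : TestFn d → ℝ≥0∞, SchwartzBound σ ∧ ∀ φ,
      scrNorm ψ μ p q r (ofSchwartz φ) ≤ σ φ := by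
  obtain ⟨σ, hσ, h⟩ := exists_levelNorm_schwartz_le hψ hpp hq
  refine ⟨σ, hσ, fun φ => (scrNorm_le_levelNorm hq hr μ ⟨0, Set.mem_Iic.2 le_rfl⟩ _).trans ?_⟩
  simpa using h 0 le_rfl φ

end Finite

/-! ### Multiplication by slowly varying functions -/

section Multiplication

open FourierTransform

variable {d : ℕ} {p p' q q' r r' : ℝ} {ψ : Eu d → ℝ}

/-- The product of two Schwartz functions. -/
def pmul (χ φ : TestFn d) : TestFn d := SchwartzMap.smulLeftCLM ℂ (χ : Eu d → ℂ) φ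

@[simp]
theorem pmul_apply (χ φ : TestFn d) (x : Eu d) : pmul χ φ x = χ x * φ x := by
  rw [pmul, SchwartzMap.smulLeftCLM_apply_apply (SchwartzMap.hasTemperateGrowth χ), smul_eq_mul]

/-- The product of a Schwartz function and a tempered distribution. -/
def dmul (χ : TestFn d) : TDist d →L[ℂ] TDist d := TemperedDistribution.smulLeftCLM ℂ (χ : Eu d → ℂ)

theorem dmul_apply (χ : TestFn d) (u : TDist d) (φ : TestFn d) : dmul χ u φ = u (pmul χ φ) := rfl

theorem dmul_ofSchwartz (χ φ : TestFn d) : dmul χ (ofSchwartz φ) = ofSchwartz (pmul χ φ) := by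
  refine DFunLike.ext _ _ fun η => ?_
  rw [dmul_apply, ofSchwartz_apply, ofSchwartz_apply]
  refine integral_congr_ae (Eventually.of_forall fun x => ?_)
  simp only [pmul_apply]
  ring

theorem dist_sub_apply (u v : TDist d) (φ : TestFn d) : (u - v) φ = u φ - v φ := rfl

/-- The frequencies of a product are sums of frequencies of the factors. -/
theorem fourier_pmul_ne_zero {χ v : TestFn d} {ξ : Eu d} (h : 𝓕 (pmul χ v) ξ ≠ 0) :
    ∃ t, 𝓕 χ t ≠ 0 ∧ 𝓕 v (ξ - t) ≠ 0 := by
  by_contra! hc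
  refine h ?_
  have h1 : 𝓕⁻ (pmul χ v) = mop χ (𝓕⁻ v) := ext_fourier fun x => by
    rw [fourier_mop, FourierTransform.fourier_fourierInv_eq,
      FourierTransform.fourier_fourierInv_eq, pmul_apply]
  rw [fourier_eq_refl_fourierInv, refl_apply, h1, mop_apply]
  refine integral_eq_zero_of_ae (Eventually.of_forall fun t => ?_)
  have h2 := hc (-t)
  rw [fourier_eq_refl_fourierInv, fourier_eq_refl_fourierInv, refl_apply, refl_apply, neg_neg,
    sub_neg_eq_add, neg_add, ← sub_eq_add_neg] at h2
  simp only [Pi.zero_apply, mul_eq_zero]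
  by_contra! h3
  exact h3.2 (h2 h3.1)

/-- A Schwartz function with value `1` at the origin, all of whose frequencies are small. -/
theorem exists_slow (d : ℕ) : ∃ χ : TestFn d, χ 0 = 1 ∧ ∀ ξ, 𝓕 χ ξ ≠ 0 → ‖ξ‖ ≤ 1 / 16 := by
  let b : ContDiffBump (0 : Eu d) := ⟨1 / 32, 1 / 16, by norm_num, by norm_num⟩
  let β : TestFn d := HasCompactSupport.toSchwartzMap (f := fun x => (b.normed volume x : ℂ))
    (b.hasCompactSupport_normed.comp_left Complex.ofReal_zero)
    (Complex.ofRealCLM.contDiff.comp b.contDiff_normed)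
  have hβ : ∀ x, β x = (b.normed volume x : ℂ) := fun _ => rfl
  refine ⟨𝓕⁻ β, ?_, fun ξ hξ => ?_⟩
  · rw [SchwartzMap.fourierInv_coe, Real.fourierInv_eq]
    simp only [inner_zero_right, AddChar.map_zero_eq_one, one_smul, hβ]
    rw [integral_complex_ofReal, b.integral_normed, Complex.ofReal_one]
  · rw [FourierTransform.fourier_fourierInv_eq] at hξ
    by_contra! h
    refine hξ ?_
    rw [hβ, ContDiffBump.normed_def, b.zero_of_le_dist (by simpa [b] using h.le), zero_div,
      Complex.ofReal_zero]

/-- The function `χ(2^J ·)`. -/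
def slow (χ : TestFn d) (J : ℤ) : TestFn d := dil ((2 : ℝ) ^ J) 0 χ

theorem slow_apply (χ : TestFn d) (J : ℤ) (x : Eu d) : slow χ J x = χ ((2 : ℝ) ^ J • x) := by
  rw [slow, dil_apply (by positivity), sub_zero]

theorem fourier_slow_ne_zero {χ : TestFn d} (hχ : ∀ ξ, 𝓕 χ ξ ≠ 0 → ‖ξ‖ ≤ 1 / 16) {J : ℤ} {ξ : Eu d}
    (h : 𝓕 (slow χ J) ξ ≠ 0) (t : Fin d) : |frq J * ξ t| ≤ 1 / 2 := by
  have hJ : (0 : ℝ) < (2 : ℝ) ^ J := by positivity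
  have h1 : 𝓕 χ (((2 : ℝ) ^ J)⁻¹ • ξ) ≠ 0 := by
    intro h0
    rw [fourier_eq_refl_fourierInv, refl_apply] at h0 h
    have := enorm_fourierInv_dil hJ 0 χ (-ξ)
    rw [smul_neg, h0, enorm_zero, mul_zero, enorm_eq_zero] at this
    exact h this
  have h2 := hχ _ h1
  rw [norm_smul, norm_inv, Real.norm_of_nonneg hJ.le] at h2
  have h3 := PiLp.norm_apply_le ξ t
  rw [Real.norm_eq_abs] at h3
  rw [abs_mul, abs_of_pos (frq_pos J), frq, zpow_neg]
  calc ((2 : ℝ) ^ J)⁻¹ * (2 * Real.pi) * |ξ t| ≤ ((2 : ℝ) ^ J)⁻¹ * (2 * Real.pi) * ‖ξ‖ := by gcongr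
    _ = 2 * Real.pi * (((2 : ℝ) ^ J)⁻¹ * ‖ξ‖) := by ring
    _ ≤ 2 * 4 * (1 / 16) := by
        gcongr
        exact Real.pi_le_four
    _ = 1 / 2 := by norm_num

theorem frq_mul_le {i j : ℤ} (hji : j ≤ i) {a b c : ℝ} (h : |frq j * a + b| ≤ c) :
    |frq i * a + (2 : ℝ) ^ (j - i) * b| ≤ c := by
  have h2 : (2 : ℝ) ^ (j - i) ≤ 1 := zpow_le_one_of_nonpos₀ one_le_two (by omega)
  rw [frq_eq i j, mul_assoc, ← mul_add, abs_mul, abs_of_pos (by positivity)]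
  calc _ ≤ 1 * |frq j * a + b| := by gcongr
    _ ≤ c := by rwa [one_mul]

theorem apply_mop_refl_sym (hψ : IsCutoff ψ) {i j : ℤ} (hji : j ≤ i) (k : Fin d → ℤ) (u : TDist d)
    (φ : TestFn d) :
    u (mop (refl (sym hψ j k)) φ) = ∑ l ∈ nearR 2 (fun t => (2 : ℝ) ^ (j - i) * k t),
      box ψ i l u (mop (refl (sym hψ j k)) φ) := by
  refine apply_eq_sum_box hψ i _ u _ fun ξ hξ t => ?_
  have := frq_mul_le hji (fourier_mop_refl_sym_ne_zero hψ hξ t)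
  linarith

theorem apply_pmul_slow_mop (hψ : IsCutoff ψ) {χ : TestFn d}
    (hχ : ∀ ξ, 𝓕 χ ξ ≠ 0 → ‖ξ‖ ≤ 1 / 16) {i j J : ℤ} (hji : j ≤ i) (hJi : J ≤ i)
    (k : Fin d → ℤ) (u : TDist d) (φ : TestFn d) :
    u (pmul (slow χ J) (mop (refl (sym hψ j k)) φ)) =
      ∑ l ∈ nearR 2 (fun t => (2 : ℝ) ^ (j - i) * k t),
        box ψ i l u (pmul (slow χ J) (mop (refl (sym hψ j k)) φ)) := by
  refine apply_eq_sum_box hψ i _ u _ fun ξ hξ t => ?_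
  obtain ⟨η, h1, h2⟩ := fourier_pmul_ne_zero hξ
  have h3 := frq_mul_le hji (fourier_mop_refl_sym_ne_zero hψ h2 t)
  have h4 := frq_mul_le hJi (b := 0) (by simpa using fourier_slow_ne_zero hχ h1 t)
  have e : (ξ - η) t = ξ t - η t := rfl
  rw [e] at h3
  rw [_root_.abs_le] at *
  constructor <;> linarith [h3.1, h3.2, h4.1, h4.2]

/-- The supremum of a Schwartz function. -/
def supNorm (χ : TestFn d) : ℝ≥0∞ := ⨆ x, ‖χ x‖ₑ

theorem supNorm_ne_top (χ : TestFn d) : supNorm χ ≠ ⊤ := by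
  refine ne_top_of_le_ne_top (ENNReal.ofReal_ne_top (r := SchwartzMap.seminorm ℝ 0 0 χ))
    (iSup_le fun x => ?_)
  rw [← ofReal_norm]
  exact ENNReal.ofReal_le_ofReal (SchwartzMap.norm_le_seminorm ℝ χ x)

theorem enorm_le_supNorm (χ : TestFn d) (x : Eu d) : ‖χ x‖ₑ ≤ supNorm χ :=
  le_iSup (fun x => ‖χ x‖ₑ) x

theorem sNorm_pmul_le_of_left {χ φ : TestFn d} {B : ℝ≥0∞} (hB : B ≠ ⊤) (h : ∀ x, ‖χ x‖ₑ ≤ B) :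
    sNorm p (pmul χ φ) ≤ B * sNorm p φ := by
  lift B to NNReal using hB
  refine eLpNorm_le_nnreal_smul_eLpNorm_of_ae_le_mul (Eventually.of_forall fun x => ?_) _
  rw [pmul_apply, nnnorm_mul]
  gcongr
  exact_mod_cast h x

theorem pmul_comm (χ φ : TestFn d) : pmul χ φ = pmul φ χ := by
  ext x
  rw [pmul_apply, pmul_apply, mul_comm]

theorem sNorm_pmul_slow_le (χ : TestFn d) (J : ℤ) (φ : TestFn d) :
    sNorm p (pmul (slow χ J) φ) ≤ supNorm χ * sNorm p φ :=
  sNorm_pmul_le_of_left (supNorm_ne_top χ) fun x => by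
    rw [slow_apply]
    exact enorm_le_supNorm χ _

theorem sNorm_slow (hp : 0 < p) (χ : TestFn d) (J : ℤ) :
    sNorm p (slow χ J) = (2 : ℝ≥0∞) ^ (-((J : ℝ) * (d / p))) * sNorm p χ := by
  have hJ : (0 : ℝ) < (2 : ℝ) ^ J := by positivity
  have hm : Measurable fun x => ‖χ x‖ₑ ^ p := χ.continuous.enorm.measurable.pow_const p
  have h1 : ∫⁻ x, ‖χ ((2 : ℝ) ^ J • x)‖ₑ ^ p =
      (2 : ℝ≥0∞) ^ (-((J : ℝ) * d)) * ∫⁻ x, ‖χ x‖ₑ ^ p := by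
    rw [← lintegral_map hm (measurable_const_smul ((2 : ℝ) ^ J)),
      Measure.map_addHaar_smul _ hJ.ne', lintegral_smul_measure,
      finrank_euclideanSpace, Fintype.card_fin, abs_of_pos (by positivity), smul_eq_mul]
    congr 1
    have h2 : (((2 : ℝ) ^ J) ^ d)⁻¹ = (2 : ℝ) ^ (-((J : ℝ) * d)) := by
      rw [Real.rpow_neg two_pos.le, Real.rpow_mul two_pos.le, Real.rpow_intCast,
        Real.rpow_natCast]
    rw [h2, ← ENNReal.ofReal_rpow_of_pos two_pos]
    norm_num
  rw [sNorm, eLpNorm_ofReal hp, sNorm, eLpNorm_ofReal hp]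
  simp only [slow_apply]
  rw [h1, ENNReal.mul_rpow_of_nonneg _ _ (by positivity), ← ENNReal.rpow_mul]
  congr 2
  field_simp

theorem sNorm_pmul_mop_le (hpp : p.HolderConjugate p') (χ m φ : TestFn d) :
    sNorm p' (pmul χ (mop m φ)) ≤ sNorm p' χ * (kerNorm p m * sNorm p' φ) := by
  rw [pmul_comm, mul_comm]
  exact sNorm_pmul_le_of_left (ENNReal.mul_ne_top (kerNorm_ne_top _ _) (sNorm_ne_top _ _))
    (enorm_mop_apply_le hpp m φ)

theorem lpNorm_dmul_slow_le (hpp : p.HolderConjugate p') (χ : TestFn d) (J : ℤ) (u : TDist d) :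
    lpNorm p (dmul (slow χ J) u) ≤ supNorm χ * lpNorm p u := by
  refine lpNorm_le_mul_of_forall hpp fun φ => ?_
  rw [dmul_apply, mul_comm (supNorm χ), mul_assoc]
  exact (enorm_apply_le_lpNorm hpp _ _).trans
    (mul_le_mul_right (sNorm_pmul_slow_le χ J φ) _)

theorem lpNorm_sum_le (hp : 1 ≤ p) {ι : Type*} (s : Finset ι) (u : ι → TDist d) :
    lpNorm p (∑ i ∈ s, u i) ≤ ∑ i ∈ s, lpNorm p (u i) := by
  classical
  induction s using Finset.induction_on with
  | empty => simp [lpNorm_zero]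
  | insert i s hi ih =>
    rw [Finset.sum_insert hi, Finset.sum_insert hi]
    exact (lpNorm_add_le hp _ _).trans (add_le_add le_rfl ih)

theorem lpNorm_box_le_sum (hψ : IsCutoff ψ) (hpp : p.HolderConjugate p') {j : ℤ} {k : Fin d → ℤ}
    {u : TDist d} {ι : Type*} {s : Finset ι} {v : ι → TDist d}
    (h : ∀ φ, u (mop (refl (sym hψ j k)) φ) = ∑ l ∈ s, v l (mop (refl (sym hψ j k)) φ)) :
    lpNorm p (box ψ j k u) ≤ cutConst hψ * ∑ l ∈ s, lpNorm p (v l) := by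
  refine lpNorm_le_mul_of_forall hpp fun φ => ?_
  rw [box_apply hψ, h, Finset.mul_sum, Finset.sum_mul]
  refine (enorm_sum_le _ _).trans (Finset.sum_le_sum fun l _ => ?_)
  rw [mul_comm (cutConst hψ), mul_assoc]
  exact (enorm_apply_le_lpNorm hpp _ _).trans
    (mul_le_mul_right (sNorm_mop_refl_sym_le hψ hpp.symm j k φ) _)

theorem lpNorm_box_dmul_sub_le (hψ : IsCutoff ψ) (hpp : p.HolderConjugate p') {χ : TestFn d}
    (hχ : ∀ ξ, 𝓕 χ ξ ≠ 0 → ‖ξ‖ ≤ 1 / 16) {j J : ℤ} (hJ : J ≤ j) (k : Fin d → ℤ) (u : TDist d) :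
    lpNorm p (box ψ j k (dmul (slow χ J) u - u)) ≤ cutConst hψ *
      ∑ l ∈ nearR 2 (fun t => (2 : ℝ) ^ (j - j) * k t),
        lpNorm p (dmul (slow χ J) (box ψ j l u) - box ψ j l u) := by
  refine lpNorm_box_le_sum hψ hpp fun φ => ?_
  simp only [dist_sub_apply]
  rw [Finset.sum_sub_distrib, dmul_apply, apply_pmul_slow_mop hψ hχ le_rfl hJ k u φ,
    apply_mop_refl_sym hψ le_rfl k u φ]
  rfl

/-- Multiplication by a slowly varying function is bounded at the finer levels. -/
theorem levelNorm_dmul_slow_le (hψ : IsCutoff ψ) (hpp : p.HolderConjugate p') (hq : 1 ≤ q)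
    {χ : TestFn d} (hχ : ∀ ξ, 𝓕 χ ξ ≠ 0 → ‖ξ‖ ≤ 1 / 16) {j J : ℤ} (hJ : J ≤ j) (u : TDist d) :
    levelNorm ψ p q j (dmul (slow χ J) u) ≤
      cutConst hψ * supNorm χ * 5 ^ d * levelNorm ψ p q j u := by
  refine (ellNorm_le_of_near hq (i := j) (j := j) le_rfl (K := cutConst hψ * supNorm χ)
    (b := fun l => lpNorm p (box ψ j l u)) fun k => ?_).trans (le_of_eq ?_)
  · rw [mul_assoc, Finset.mul_sum (a := supNorm χ)]
    refine (lpNorm_box_le_sum hψ hpp (v := fun l => dmul (slow χ J) (box ψ j l u)) fun φ =>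
      apply_pmul_slow_mop hψ hχ le_rfl hJ k u φ).trans (mul_le_mul_right ?_ _)
    exact Finset.sum_le_sum fun l _ => lpNorm_dmul_slow_le hpp χ J _
  · simp [levelNorm]

/-- Multiplication by a slowly varying function improves the behaviour at the coarser levels. -/
theorem exists_levelNorm_dmul_slow_le (hψ : IsCutoff ψ) (hpp : p.HolderConjugate p') (hq : 1 ≤ q)
    {χ : TestFn d} (hχ : ∀ ξ, 𝓕 χ ξ ≠ 0 → ‖ξ‖ ≤ 1 / 16) :
    ∃ C : ℝ≥0∞, C ≠ ⊤ ∧ ∀ (j J : ℤ), j ≤ J → ∀ u : TDist d,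
      levelNorm ψ p q j (dmul (slow χ J) u) ≤
        C * (2 : ℝ≥0∞) ^ (((j : ℝ) - J) * levExp d p q) * levelNorm ψ p q J u := by
  refine ⟨sNorm p' χ * kerNorm p hψ.toTestFn * 5 ^ d,
    ENNReal.mul_ne_top (ENNReal.mul_ne_top (sNorm_ne_top _ _) (kerNorm_ne_top _ _)) (by simp),
    fun j J hJ u => ?_⟩
  set K : ℝ≥0∞ := (2 : ℝ≥0∞) ^ (-((J : ℝ) * (d / p'))) * sNorm p' χ *
    ((2 : ℝ≥0∞) ^ ((j : ℝ) * (d * (1 - 1 / p))) * kerNorm p hψ.toTestFn) with hK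
  refine (ellNorm_le_of_near hq hJ (K := K)
    (b := fun l => lpNorm p (box ψ J l u)) fun k => ?_).trans (le_of_eq ?_)
  · refine lpNorm_le_mul_of_forall hpp fun φ => ?_
    rw [box_apply hψ, dmul_apply, apply_pmul_slow_mop hψ hχ hJ le_rfl k u φ, Finset.mul_sum,
      Finset.sum_mul]
    refine (enorm_sum_le _ _).trans (Finset.sum_le_sum fun l _ => ?_)
    rw [mul_comm K, mul_assoc]
    refine (enorm_apply_le_lpNorm hpp _ _).trans (mul_le_mul_right ?_ _)
    refine (sNorm_pmul_mop_le hpp _ _ _).trans ?_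
    rw [sNorm_slow hpp.symm.pos, kerNorm_refl, ← mul_assoc]
    exact mul_le_mul_left (mul_le_mul_right (kerNorm_sym_le_rpow hψ hpp.lt.le j k) _) _
  · have h2 : (2 : ℝ≥0∞) ^ (((j : ℝ) - J) * levExp d p q) = (2 : ℝ≥0∞) ^ (-((J : ℝ) * (d / p'))) *
        (2 : ℝ≥0∞) ^ ((j : ℝ) * (d * (1 - 1 / p))) * (2 : ℝ≥0∞) ^ (((J : ℝ) - j) * (d / q)) := by
      rw [← ENNReal.rpow_add _ _ two_ne_zero ENNReal.ofNat_ne_top,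
        ← ENNReal.rpow_add _ _ two_ne_zero ENNReal.ofNat_ne_top, levExp]
      congr 1
      have h3 := hpp.inv_add_inv_eq_one
      have h4 : p'⁻¹ = 1 - p⁻¹ := by linarith
      simp only [div_eq_mul_inv, one_mul, h4]
      ring
    rw [h2, hK, levelNorm]
    ring

theorem exists_represents {u : TDist d} (h : lpNorm p u ≠ ⊤) :
    ∃ w, MemLp w (ENNReal.ofReal p) volume ∧ Represents w u := by
  by_contra! hc
  refine h ?_
  simp only [lpNorm, iInf_eq_top]
  exact fun w hw => absurd hw.2 (hc w hw.1)

theorem lpNorm_le_eLpNorm {u : TDist d} {w : Eu d → ℂ} (hw : MemLp w (ENNReal.ofReal p) volume)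
    (h : Represents w u) : lpNorm p u ≤ eLpNorm w (ENNReal.ofReal p) volume :=
  iInf₂_le_of_le w ⟨hw, h⟩ le_rfl

theorem tendsto_lpNorm_dmul_slow_sub (hp : 1 ≤ p) {χ : TestFn d} (h0 : χ 0 = 1) {u : TDist d}
    (hu : lpNorm p u ≠ ⊤) :
    Tendsto (fun n : ℕ => lpNorm p (dmul (slow χ (-(n : ℤ))) u - u)) atTop (𝓝 0) := by
  obtain ⟨w, hw, hrep⟩ := exists_represents hu
  have hp0 : ENNReal.ofReal p ≠ 0 := (ENNReal.ofReal_pos.2 (by linarith)).ne'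
  have hbound : ∀ (n : ℕ) x, ‖slow χ (-(n : ℤ)) x - 1‖ ≤ (supNorm χ).toReal + 1 := fun n x => by
    refine (norm_sub_le _ _).trans ?_
    rw [norm_one, slow_apply, ← toReal_enorm]
    gcongr
    · exact supNorm_ne_top χ
    · exact enorm_le_supNorm χ _
  have hmeas : ∀ n : ℕ, AEStronglyMeasurable (fun x => slow χ (-(n : ℤ)) x - 1)
      (volume : Measure (Eu d)) := fun n =>
    ((slow χ (-(n : ℤ))).continuous.sub continuous_const).aestronglyMeasurable
  have hmem : ∀ n : ℕ, MemLp (fun x => (slow χ (-(n : ℤ)) x - 1) * w x) (ENNReal.ofReal p)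
      volume := fun n => MemLp.mul_of_bound (hmeas n) (hbound n) hw
  refine tendsto_of_tendsto_of_tendsto_of_le_of_le tendsto_const_nhds
    (tendsto_eLpNorm_zero_of_dominated hp0 ENNReal.ofReal_ne_top (fun n => (hmem n).1)
      (hw.const_mul ((((supNorm χ).toReal + 1 : ℝ)) : ℂ)) (fun n => Eventually.of_forall fun x => ?_)
      (Eventually.of_forall fun x => ?_))
    (fun _ => zero_le) fun n => lpNorm_le_eLpNorm (hmem n) fun φ => ?_
  · have h1 := hbound n x
    rw [enorm_mul, enorm_mul]
    gcongr
    rw [← ofReal_norm, ← ofReal_norm]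
    refine ENNReal.ofReal_le_ofReal (h1.trans (le_of_eq ?_))
    rw [Complex.norm_real, Real.norm_of_nonneg (by positivity)]
  · have h1 : Tendsto (fun n : ℕ => (2 : ℝ) ^ (-(n : ℤ)) • x) atTop (𝓝 0) := by
      have h2 : Tendsto (fun n : ℕ => ((1 : ℝ) / 2) ^ n) atTop (𝓝 0) :=
        tendsto_pow_atTop_nhds_zero_of_lt_one (by norm_num) (by norm_num)
      have h3 := h2.smul_const x
      rw [zero_smul] at h3
      refine h3.congr fun n => ?_
      rw [zpow_neg, zpow_natCast, one_div, inv_pow]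
    have h2 := (χ.continuous.tendsto 0).comp h1
    have h3 := (h2.sub_const 1).mul_const (w x)
    rw [h0, sub_self, zero_mul] at h3
    refine h3.congr fun n => ?_
    rw [slow_apply]
    rfl
  · rw [dist_sub_apply, dmul_apply, hrep, hrep,
      ← integral_sub (integrable_schwartz_smul hp _ hw) (integrable_schwartz_smul hp _ hw)]
    refine integral_congr_ae (Eventually.of_forall fun x => ?_)
    simp only [pmul_apply, smul_eq_mul]
    ring

end Multiplication

/-! ### Frequency truncation of distributions -/

section TruncationOfDistributions

open FourierTransform

variable {d : ℕ} {p p' q q' r r' : ℝ} {ψ : Eu d → ℝ}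

/-- The sum of the pieces of a distribution at the level `i` with indices in `S`. -/
def trunc (ψ : Eu d → ℝ) (i : ℤ) (S : Finset (Fin d → ℤ)) (u : TDist d) : TDist d :=
  ∑ l ∈ S, box ψ i l u

theorem dist_sum_apply {ι : Type*} (s : Finset ι) (u : ι → TDist d) (φ : TestFn d) :
    (∑ i ∈ s, u i) φ = ∑ i ∈ s, u i φ := by
  classical
  induction s using Finset.induction_on with
  | empty => rfl
  | insert i s hi ih =>
    rw [Finset.sum_insert hi, Finset.sum_insert hi, ← ih]
    rfl

theorem trunc_sub (i : ℤ) (S : Finset (Fin d → ℤ)) (u v : TDist d) :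
    trunc ψ i S (u - v) = trunc ψ i S u - trunc ψ i S v := by
  simp only [trunc, map_sub, Finset.sum_sub_distrib]

theorem box_comm (hψ : IsCutoff ψ) (i j : ℤ) (k l : Fin d → ℤ) (u : TDist d) :
    box ψ j k (box ψ i l u) = box ψ i l (box ψ j k u) := by
  refine DFunLike.ext _ _ fun φ => ?_
  rw [box_apply hψ, box_apply hψ, box_apply hψ, box_apply hψ, mop_comm]

theorem box_trunc (hψ : IsCutoff ψ) (i j : ℤ) (k : Fin d → ℤ) (S : Finset (Fin d → ℤ))
    (u : TDist d) : box ψ j k (trunc ψ i S u) = trunc ψ i S (box ψ j k u) := by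
  simp only [trunc, map_sum]
  exact Finset.sum_congr rfl fun l _ => box_comm hψ i j k l u

theorem box_box_eq_zero (hψ : IsCutoff ψ) {i j : ℤ} (hji : j ≤ i) {k l : Fin d → ℤ}
    (hl : l ∉ nearR 2 fun t => (2 : ℝ) ^ (j - i) * k t) (u : TDist d) :
    box ψ i l (box ψ j k u) = 0 := by
  refine DFunLike.ext _ _ fun φ => ?_
  rw [box_apply hψ, box_apply hψ]
  have : mop (refl (sym hψ j k)) (mop (refl (sym hψ i l)) φ) = 0 := ext_fourier fun ξ => by
    have h0 : 𝓕 (0 : TestFn d) ξ = 0 := by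
      have : 𝓕 (0 : TestFn d) = 0 := map_zero (FourierTransform.fourierCLM ℂ (TestFn d))
      rw [this]
      rfl
    rw [h0]
    by_contra hne
    refine hl (mem_nearR.2 fun t => ?_)
    have h1 := frq_mul_le hji (fourier_mop_refl_sym_ne_zero hψ hne t)
    rw [mop_comm] at hne
    have h2 := fourier_mop_refl_sym_ne_zero hψ hne t
    rw [_root_.abs_le] at *
    constructor <;> linarith [h1.1, h1.2, h2.1, h2.2]
  rw [this, map_zero]
  rfl

theorem box_eq_sum_box (hψ : IsCutoff ψ) {i j : ℤ} (hji : j ≤ i) (k : Fin d → ℤ) (u : TDist d) :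
    box ψ j k u = ∑ l ∈ nearR 2 (fun t => (2 : ℝ) ^ (j - i) * k t), box ψ i l (box ψ j k u) := by
  refine DFunLike.ext _ _ fun φ => ?_
  rw [dist_sum_apply, box_apply hψ, apply_mop_refl_sym hψ hji]
  refine Finset.sum_congr rfl fun l _ => ?_
  rw [← box_apply hψ, box_comm hψ]

theorem trunc_box_of_subset (hψ : IsCutoff ψ) {i j : ℤ} (hji : j ≤ i) {k : Fin d → ℤ}
    {S : Finset (Fin d → ℤ)} (hS : nearR 2 (fun t => (2 : ℝ) ^ (j - i) * k t) ⊆ S) (u : TDist d) :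
    trunc ψ i S (box ψ j k u) = box ψ j k u := by
  conv_rhs => rw [box_eq_sum_box hψ hji]
  exact (Finset.sum_subset hS fun l _ hl => box_box_eq_zero hψ hji hl u).symm

theorem lpNorm_trunc_box_le (hψ : IsCutoff ψ) (hpp : p.HolderConjugate p') {i j : ℤ} (hji : j ≤ i)
    (k : Fin d → ℤ) (S : Finset (Fin d → ℤ)) (u : TDist d) :
    lpNorm p (trunc ψ i S (box ψ j k u)) ≤ 5 ^ d * cutConst hψ * lpNorm p (box ψ j k u) := by
  classical
  set N := nearR 2 (fun t => (2 : ℝ) ^ (j - i) * k t) with hN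
  have h1 : trunc ψ i S (box ψ j k u) = ∑ l ∈ S ∩ N, box ψ i l (box ψ j k u) := by
    refine (Finset.sum_subset Finset.inter_subset_left fun l hlS hl => ?_).symm
    exact box_box_eq_zero hψ hji (fun h => hl (Finset.mem_inter.2 ⟨hlS, h⟩)) u
  rw [h1]
  refine (lpNorm_sum_le hpp.lt.le _ _).trans
    ((Finset.sum_le_sum fun l _ => lpNorm_box_le hψ hpp i l _).trans ?_)
  rw [Finset.sum_const, nsmul_eq_mul, ← mul_assoc]
  refine mul_le_mul_left (mul_le_mul_left ?_ _) _
  have h2 := card_nearR_enorm_le (c := 5) two_pos.le (by norm_num)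
    (fun t => (2 : ℝ) ^ (j - i) * k t)
  rw [ENNReal.ofReal_pow (by norm_num)] at h2
  calc ((S ∩ N).card : ℝ≥0∞) ≤ (N.card : ℝ≥0∞) := by
        exact_mod_cast Finset.card_le_card Finset.inter_subset_right
    _ ≤ 5 ^ d := by simpa using h2

theorem levelNorm_trunc_le (hψ : IsCutoff ψ) (hpp : p.HolderConjugate p') (hq : 0 < q) {i j : ℤ}
    (hji : j ≤ i) (S : Finset (Fin d → ℤ)) (u : TDist d) :
    levelNorm ψ p q j (trunc ψ i S u) ≤ 5 ^ d * cutConst hψ * levelNorm ψ p q j u := by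
  rw [levelNorm, levelNorm, ← ellNorm_const_mul hq]
  refine ellNorm_mono hq fun k => ?_
  rw [box_trunc hψ]
  exact lpNorm_trunc_box_le hψ hpp hji k S u

theorem neg_one_smul_dist (u : TDist d) : (-1 : ℂ) • u = -u := by
  refine DFunLike.ext _ _ fun φ => ?_
  change (-1 : ℂ) • u φ = -(u φ)
  rw [neg_smul, one_smul]

theorem levelNorm_neg (hq : 1 ≤ q) (j : ℤ) (u : TDist d) :
    levelNorm ψ p q j (-u) ≤ levelNorm ψ p q j u := by
  have h := levelNorm_smul_le (p := p) ψ hq j (-1) u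
  rw [neg_one_smul_dist] at h
  simpa using h

theorem levelNorm_sub_le (hp : 1 ≤ p) (hq : 1 ≤ q) (j : ℤ) (u v : TDist d) :
    levelNorm ψ p q j (u - v) ≤ levelNorm ψ p q j u + levelNorm ψ p q j v := by
  rw [sub_eq_add_neg]
  exact (levelNorm_add_le ψ hp hq j _ _).trans (add_le_add le_rfl (levelNorm_neg hq j v))

/-- A constant for the truncation operators. -/
def truncConst (hψ : IsCutoff ψ) : ℝ≥0∞ := 1 + 5 ^ d * cutConst hψ

theorem truncConst_ne_top (hψ : IsCutoff ψ) : truncConst hψ ≠ ⊤ :=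
  ENNReal.add_ne_top.2 ⟨ENNReal.one_ne_top, ENNReal.mul_ne_top (by simp) (cutConst_ne_top hψ)⟩

theorem levelNorm_sub_trunc_le (hψ : IsCutoff ψ) (hpp : p.HolderConjugate p') (hq : 1 ≤ q) {i j : ℤ}
    (hji : j ≤ i) (S : Finset (Fin d → ℤ)) (u : TDist d) :
    levelNorm ψ p q j (u - trunc ψ i S u) ≤ truncConst hψ * levelNorm ψ p q j u := by
  refine (levelNorm_sub_le hpp.lt.le hq j _ _).trans ?_
  rw [truncConst, add_mul, one_mul]
  exact add_le_add le_rfl (levelNorm_trunc_le hψ hpp (by linarith) hji S u)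

theorem tendsto_levelNorm_sub_trunc (hψ : IsCutoff ψ) (hpp : p.HolderConjugate p') (hq : 1 ≤ q)
    {i j : ℤ} (hji : j ≤ i) {u : TDist d} (hu : levelNorm ψ p q j u ≠ ⊤) :
    Tendsto (fun S => levelNorm ψ p q j (u - trunc ψ i S u)) atTop (𝓝 0) := by
  have hq0 : 0 < q := by linarith
  have hK := truncConst_ne_top hψ
  refine tendsto_ellNorm_zero hq0 (b := fun k => truncConst hψ * lpNorm p (box ψ j k u)) ?_
    (Eventually.of_forall fun S k => ?_) fun k => ?_
  · rw [ellNorm_const_mul hq0]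
    exact ENNReal.mul_ne_top hK hu
  · rw [map_sub, box_trunc hψ, sub_eq_add_neg]
    refine (lpNorm_add_le hpp.lt.le _ _).trans ?_
    rw [truncConst, add_mul, one_mul]
    refine add_le_add le_rfl (le_trans ?_ (lpNorm_trunc_box_le hψ hpp hji k S u))
    have h := lpNorm_smul_le (p := p) (-1) (trunc ψ i S (box ψ j k u))
    rw [neg_one_smul_dist] at h
    simpa using h
  · refine tendsto_const_nhds.congr' ?_
    filter_upwards [eventually_ge_atTop (nearR 2 fun t => (2 : ℝ) ^ (j - i) * k t)] with S hS
    rw [map_sub, box_trunc hψ, trunc_box_of_subset hψ hji hS, sub_self, lpNorm_zero]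

/-- Band-limited parts of functions in `L^p` have finite norms at all coarser levels. -/
theorem levelNorm_trunc_le_lpNorm (hψ : IsCutoff ψ) (hpp : p.HolderConjugate p') (hq : 1 ≤ q)
    {i j : ℤ} (hji : j ≤ i) (S : Finset (Fin d → ℤ)) (u : TDist d) :
    levelNorm ψ p q j (trunc ψ i S u) ≤ cutConst hψ * cutConst hψ * S.card *
      (5 ^ d * (2 : ℝ≥0∞) ^ (((i : ℝ) - j) * (d / q))) * lpNorm p u := by
  classical
  have h := ellNorm_le_of_near hq hji (K := cutConst hψ)
    (a := fun k => lpNorm p (box ψ j k (trunc ψ i S u)))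
    (b := fun l => if l ∈ S then lpNorm p (box ψ i l u) else 0) fun k => by
      have h1 : box ψ j k (trunc ψ i S u) = ∑ l ∈ nearR 2 (fun t => (2 : ℝ) ^ (j - i) * k t),
          if l ∈ S then box ψ j k (box ψ i l u) else 0 := by
        rw [box_trunc hψ, Finset.sum_ite_mem, Finset.inter_comm]
        refine Eq.trans ?_ (Finset.sum_congr rfl fun l _ => (box_comm hψ i j k l u).symm)
        refine (Finset.sum_subset Finset.inter_subset_left fun l hlS hl => ?_).symm
        exact box_box_eq_zero hψ hji (fun h => hl (Finset.mem_inter.2 ⟨hlS, h⟩)) u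
      rw [h1, Finset.mul_sum]
      refine (lpNorm_sum_le hpp.lt.le _ _).trans (Finset.sum_le_sum fun l _ => ?_)
      split_ifs
      · exact lpNorm_box_le hψ hpp j k _
      · rw [lpNorm_zero]
        exact zero_le
  refine h.trans ?_
  have h2 : ellNorm q (fun l => if l ∈ S then lpNorm p (box ψ i l u) else 0) ≤
      S.card * (cutConst hψ * lpNorm p u) := by
    refine (ellNorm_le_tsum hq _).trans ?_
    rw [tsum_eq_sum (s := S) fun l hl => if_neg hl, ← nsmul_eq_mul, ← Finset.sum_const]
    refine Finset.sum_le_sum fun l hl => ?_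
    rw [if_pos hl]
    exact lpNorm_box_le hψ hpp i l u
  calc _ ≤ _ := mul_le_mul_right h2 _
    _ = _ := by ring

theorem lpNorm_box_le_levelNorm (hq : 0 < q) (j : ℤ) (k : Fin d → ℤ) (u : TDist d) :
    lpNorm p (box ψ j k u) ≤ levelNorm ψ p q j u :=
  le_ellNorm hq (fun k => lpNorm p (box ψ j k u)) k

theorem lpNorm_trunc_ne_top (hp : 1 ≤ p) (hq : 0 < q) {i : ℤ} {u : TDist d}
    (hu : levelNorm ψ p q i u ≠ ⊤) (S : Finset (Fin d → ℤ)) : lpNorm p (trunc ψ i S u) ≠ ⊤ :=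
  ne_top_of_le_ne_top (ENNReal.sum_ne_top.2 fun l _ =>
    ne_top_of_le_ne_top hu (lpNorm_box_le_levelNorm hq i l u)) (lpNorm_sum_le hp S _)

/-- The Schwartz functions are dense in `L^p`. -/
theorem exists_schwartz_lpNorm_sub_le (hp : 1 ≤ p) {u : TDist d} (hu : lpNorm p u ≠ ⊤) {ε : ℝ}
    (hε : 0 < ε) : ∃ φ : TestFn d, lpNorm p (u - ofSchwartz φ) ≤ ENNReal.ofReal ε := by
  obtain ⟨w, hw, hrep⟩ := exists_represents hu
  obtain ⟨g, hg1, hg2, hg3⟩ := MemLp.exist_eLpNorm_sub_le ENNReal.ofReal_ne_top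
    (ENNReal.one_le_ofReal.2 hp) hw hε
  set φ : TestFn d := hg1.toSchwartzMap hg2 with hφ
  have hφm := φ.memLp (ENNReal.ofReal p) volume
  refine ⟨φ, (lpNorm_le_eLpNorm (hw.sub hφm) fun η => ?_).trans hg3⟩
  have h1 : ofSchwartz φ η = ∫ x, η x • φ x := ofSchwartz_apply φ η
  rw [dist_sub_apply, hrep, h1,
    ← integral_sub (integrable_schwartz_smul hp _ hw) (integrable_schwartz_smul hp _ hφm)]
  refine integral_congr_ae (Eventually.of_forall fun x => ?_)
  simp only [Pi.sub_apply, smul_eq_mul]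
  ring

theorem trunc_ofSchwartz (hψ : IsCutoff ψ) (i : ℤ) (S : Finset (Fin d → ℤ)) (φ : TestFn d) :
    trunc ψ i S (ofSchwartz φ) = ofSchwartz (∑ l ∈ S, mop (sym hψ i l) φ) := by
  simp only [trunc, box_ofSchwartz hψ, map_sum]

theorem levelNorm_sub_trunc_trunc_le (hψ : IsCutoff ψ) (hpp : p.HolderConjugate p') (hq : 1 ≤ q)
    {i j : ℤ} (hji : j ≤ i) (S : Finset (Fin d → ℤ)) (u : TDist d) :
    levelNorm ψ p q j (u - trunc ψ i S (trunc ψ i S u)) ≤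
      truncConst hψ * levelNorm ψ p q j (u - trunc ψ i S u) := by
  have h : u - trunc ψ i S (trunc ψ i S u) =
      (u - trunc ψ i S u) + trunc ψ i S (u - trunc ψ i S u) := by
    rw [trunc_sub]
    abel
  rw [h, truncConst, add_mul, one_mul]
  exact (levelNorm_add_le ψ hpp.lt.le hq j _ _).trans
    (add_le_add le_rfl (levelNorm_trunc_le hψ hpp (by linarith) hji S _))

theorem exists_mul_ofReal_le {C ε : ℝ≥0∞} (hC : C ≠ ⊤) (hε : ε ≠ 0) :
    ∃ δ : ℝ, 0 < δ ∧ C * ENNReal.ofReal δ ≤ ε := by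
  have hC1 : C + 1 ≠ ⊤ := ENNReal.add_ne_top.2 ⟨hC, ENNReal.one_ne_top⟩
  have hC0 : C + 1 ≠ 0 := by simp
  have hm : min ε 1 ≠ 0 := by
    rw [← pos_iff_ne_zero]
    exact lt_min (pos_iff_ne_zero.2 hε) one_pos
  have hm' : min ε 1 ≠ ⊤ := ne_top_of_le_ne_top ENNReal.one_ne_top (min_le_right _ _)
  have hx : min ε 1 / (C + 1) ≠ ⊤ := ENNReal.div_ne_top hm' hC0
  refine ⟨(min ε 1 / (C + 1)).toReal, ENNReal.toReal_pos (ENNReal.div_ne_zero.2 ⟨hm, hC1⟩) hx, ?_⟩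
  rw [ENNReal.ofReal_toReal hx]
  calc C * (min ε 1 / (C + 1)) ≤ (C + 1) * (min ε 1 / (C + 1)) := mul_le_mul_left le_self_add _
    _ = min ε 1 := ENNReal.mul_div_cancel hC0 hC1
    _ ≤ ε := min_le_left _ _

/-- The Schwartz functions are dense for the norm of each level. -/
theorem exists_schwartz_levelNorm_sub_le (hψ : IsCutoff ψ) (hpp : p.HolderConjugate p')
    (hq : 1 ≤ q) {j : ℤ} {u : TDist d} (hu : levelNorm ψ p q j u ≠ ⊤) {ε : ℝ≥0∞} (hε : ε ≠ 0) :
    ∃ φ : TestFn d, levelNorm ψ p q j (u - ofSchwartz φ) ≤ ε := by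
  have hq0 : 0 < q := by linarith
  have hε2 : ε / 2 ≠ 0 := by simpa using hε
  have hlim := ENNReal.Tendsto.const_mul (a := truncConst hψ)
    (tendsto_levelNorm_sub_trunc hψ hpp hq (le_refl j) hu) (Or.inr (truncConst_ne_top hψ))
  rw [mul_zero] at hlim
  obtain ⟨S, hS⟩ := (hlim.eventually_le_const (pos_iff_ne_zero.2 hε2)).exists
  set v := trunc ψ j S u with hv
  have hvp : lpNorm p v ≠ ⊤ := lpNorm_trunc_ne_top hpp.lt.le hq0 hu S
  set C : ℝ≥0∞ := cutConst hψ * cutConst hψ * S.card *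
      (5 ^ d * (2 : ℝ≥0∞) ^ (((j : ℝ) - j) * (d / q)))
  have hC : C ≠ ⊤ := by
    have := cutConst_ne_top hψ
    refine ENNReal.mul_ne_top (ENNReal.mul_ne_top (ENNReal.mul_ne_top this this)
      (ENNReal.natCast_ne_top _)) ?_
    simp
  obtain ⟨δ, hδ, hCδ⟩ := exists_mul_ofReal_le hC hε2
  obtain ⟨η, hη⟩ := exists_schwartz_lpNorm_sub_le hpp.lt.le hvp hδ
  refine ⟨∑ l ∈ S, mop (sym hψ j l) η, ?_⟩
  rw [← trunc_ofSchwartz hψ]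
  have h : u - trunc ψ j S (ofSchwartz η) =
      (u - trunc ψ j S v) + trunc ψ j S (v - ofSchwartz η) := by
    rw [trunc_sub]
    abel
  rw [h]
  calc _ ≤ levelNorm ψ p q j (u - trunc ψ j S v) +
        levelNorm ψ p q j (trunc ψ j S (v - ofSchwartz η)) := levelNorm_add_le ψ hpp.lt.le hq j _ _
    _ ≤ ε / 2 + ε / 2 := by
        refine add_le_add ((levelNorm_sub_trunc_trunc_le hψ hpp hq le_rfl S u).trans hS) ?_
        exact (levelNorm_trunc_le_lpNorm hψ hpp hq le_rfl S _).trans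
          ((mul_le_mul_right hη _).trans hCδ)
    _ = ε := ENNReal.add_halves ε

end TruncationOfDistributions

/-! ### Density of the Schwartz functions -/

section Density

open FourierTransform

variable {d : ℕ} {p p' q q' r r' : ℝ} {ψ : Eu d → ℝ}

theorem schwartzDense_of_forall {N : ExtSeminorm (TDist d)}
    (h1 : ∀ φ : TestFn d, N.toFun (ofSchwartz φ) < ⊤)
    (h2 : ∀ f, N.toFun f ≠ ⊤ → ∀ ε : ℝ≥0∞, ε ≠ 0 → ∃ φ : TestFn d, N.toFun (f - ofSchwartz φ) ≤ ε) :
    SchwartzDense N := by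
  refine ⟨h1, fun f => Metric.mem_closure_iff.2 fun ε hε => ?_⟩
  obtain ⟨φ, hφ⟩ := h2 (N.incl f) (N.incl_lt_top f).ne (ENNReal.ofReal (ε / 2))
    (ENNReal.ofReal_pos.2 (by linarith)).ne'
  refine ⟨N.ofLt (ofSchwartz φ) (h1 φ), ⟨φ, rfl⟩, ?_⟩
  rw [dist_eq_norm, ExtSeminorm.norm_def, map_sub, ExtSeminorm.incl_ofLt]
  refine lt_of_le_of_lt (ENNReal.toReal_le_of_le_ofReal (by linarith) hφ) (by linarith)

theorem weight_ne_zero (x : ℝ) : (2 : ℝ≥0∞) ^ x ≠ 0 := by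
  simp [ENNReal.rpow_eq_zero_iff]

theorem weight_ne_top (x : ℝ) : (2 : ℝ≥0∞) ^ x ≠ ⊤ :=
  ENNReal.rpow_ne_top_of_ne_zero two_ne_zero ENNReal.ofNat_ne_top

theorem levelNorm_ne_top_of_familyNorm {s : ℝ} (hr : 0 < r)
    {F : Set.Iic (0 : ℤ) → TDist d} (hF : familyNorm ψ s p q r F ≠ ⊤) (j : Set.Iic (0 : ℤ)) :
    levelNorm ψ p q j (F j) ≠ ⊤ := by
  intro h
  have := le_ellNorm hr (fun j : Set.Iic (0 : ℤ) =>
    (2 : ℝ≥0∞) ^ (((j : ℤ) : ℝ) * s) * levelNorm ψ p q j (F j)) j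
  simp only [h, ENNReal.mul_top (weight_ne_zero _), top_le_iff] at this
  exact hF this

theorem frakNorm_sub_trunc_tendsto (hψ : IsCutoff ψ) (hpp : p.HolderConjugate p') (hq : 1 ≤ q)
    (hr : 0 < r) {s : ℝ} {u : TDist d} (hu : frakNorm ψ s p q r u ≠ ⊤) :
    Tendsto (fun S => frakNorm ψ s p q r (u - trunc ψ 0 S u)) atTop (𝓝 0) := by
  refine tendsto_ellNorm_zero hr (b := fun j : Set.Iic (0 : ℤ) => truncConst hψ *
    ((2 : ℝ≥0∞) ^ (((j : ℤ) : ℝ) * s) * levelNorm ψ p q j u)) ?_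
    (Eventually.of_forall fun S j => ?_) fun j => ?_
  · rw [ellNorm_const_mul hr]
    exact ENNReal.mul_ne_top (truncConst_ne_top hψ) hu
  · rw [mul_left_comm]
    exact mul_le_mul_right (levelNorm_sub_trunc_le hψ hpp hq j.2 S u) _
  · have := ENNReal.Tendsto.const_mul (a := (2 : ℝ≥0∞) ^ (((j : ℤ) : ℝ) * s))
      (tendsto_levelNorm_sub_trunc hψ hpp hq j.2 (levelNorm_ne_top_of_familyNorm hr hu j))
      (Or.inr (weight_ne_top _))
    rwa [mul_zero] at this

theorem frakNorm_trunc_le (hψ : IsCutoff ψ) (hpp : p.HolderConjugate p') (hq : 1 ≤ q)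
    (hr : 0 < r) (s : ℝ) (S : Finset (Fin d → ℤ)) (u : TDist d) :
    frakNorm ψ s p q r (trunc ψ 0 S u) ≤ truncConst hψ * frakNorm ψ s p q r u := by
  rw [frakNorm, frakNorm, familyNorm, familyNorm, ← ellNorm_const_mul hr]
  refine ellNorm_mono hr fun j => ?_
  rw [mul_left_comm]
  refine mul_le_mul_right ((levelNorm_trunc_le hψ hpp (by linarith) j.2 S u).trans ?_) _
  exact mul_le_mul_left le_add_self _

theorem frakNorm_sub_trunc_trunc_le (hψ : IsCutoff ψ) (hpp : p.HolderConjugate p') (hq : 1 ≤ q)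
    (hr : 0 < r) (s : ℝ) (S : Finset (Fin d → ℤ)) (u : TDist d) :
    frakNorm ψ s p q r (u - trunc ψ 0 S (trunc ψ 0 S u)) ≤
      truncConst hψ * frakNorm ψ s p q r (u - trunc ψ 0 S u) := by
  rw [frakNorm, frakNorm, familyNorm, familyNorm, ← ellNorm_const_mul hr]
  refine ellNorm_mono hr fun j => ?_
  rw [mul_left_comm]
  exact mul_le_mul_right (levelNorm_sub_trunc_trunc_le hψ hpp hq j.2 S u) _

theorem ellNorm_shift_le (hr : 0 < r) (a : ℤ → ℝ≥0∞) (n : ℕ) :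
    ellNorm r (fun j : Set.Iic (0 : ℤ) => if (j : ℤ) ≤ -(n : ℤ) then a (j + n) else 0) ≤
      ellNorm r fun j : Set.Iic (0 : ℤ) => a j := by
  refine ENNReal.rpow_le_rpow ?_ (by positivity)
  have h1 : ∀ j : Set.Iic (0 : ℤ), j ∉ Set.range (fun i : Set.Iic (0 : ℤ) =>
      (⟨(i : ℤ) - n, by have := i.2; simp only [Set.mem_Iic] at this ⊢; omega⟩ : Set.Iic (0 : ℤ))) →
      (if (j : ℤ) ≤ -(n : ℤ) then a (j + n) else 0) ^ r = 0 := fun j hj => by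
    rw [if_neg, ENNReal.zero_rpow_of_pos hr]
    intro h
    refine hj ⟨⟨j + n, by simp only [Set.mem_Iic]; omega⟩, ?_⟩
    ext
    simp
  rw [← tsum_subtype_eq_of_support_subset (s := Set.range (fun i : Set.Iic (0 : ℤ) =>
      (⟨(i : ℤ) - n, by have := i.2; simp only [Set.mem_Iic] at this ⊢; omega⟩ : Set.Iic (0 : ℤ))))
    fun j hj => by_contra fun h => hj (h1 j h)]
  rw [tsum_range (g := fun i : Set.Iic (0 : ℤ) =>
      (⟨(i : ℤ) - n, by have := i.2; simp only [Set.mem_Iic] at this ⊢; omega⟩ : Set.Iic (0 : ℤ)))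
    (fun j : Set.Iic (0 : ℤ) => (if (j : ℤ) ≤ -(n : ℤ) then a (j + n) else 0) ^ r)
    fun i i' h => by
      have := congrArg Subtype.val h
      ext
      simpa using this]
  refine ENNReal.tsum_le_tsum fun i => ENNReal.rpow_le_rpow ?_ hr.le
  have hi := i.2
  simp only [Set.mem_Iic] at hi
  rw [if_pos (by change (i : ℤ) - (n : ℤ) ≤ -(n : ℤ); omega)]
  simp

end Density

section FrakDensity

open FourierTransform

variable {d : ℕ} {p p' q q' r r' : ℝ} {ψ : Eu d → ℝ}

theorem tendsto_levelNorm_dmul_slow_sub (hψ : IsCutoff ψ) (hpp : p.HolderConjugate p')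
    (hq : 1 ≤ q) {χ : TestFn d} (h0 : χ 0 = 1) (hχ : ∀ ξ, 𝓕 χ ξ ≠ 0 → ‖ξ‖ ≤ 1 / 16) {j : ℤ}
    {u : TDist d} (hu : levelNorm ψ p q j u ≠ ⊤) :
    Tendsto (fun n : ℕ => levelNorm ψ p q j (dmul (slow χ (-(n : ℤ))) u - u)) atTop (𝓝 0) := by
  have hq0 : 0 < q := by linarith
  have hC := cutConst_ne_top hψ
  have hev : ∀ᶠ n : ℕ in atTop, -(n : ℤ) ≤ j := by
    filter_upwards [eventually_ge_atTop (-j).toNat] with n hn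
    omega
  have hle : ∀ (J : ℤ) (v : TDist d), lpNorm p (dmul (slow χ J) v - v) ≤
      (supNorm χ + 1) * lpNorm p v := fun J v => by
    rw [sub_eq_add_neg, add_mul, one_mul]
    refine (lpNorm_add_le hpp.lt.le _ _).trans (add_le_add (lpNorm_dmul_slow_le hpp χ J v) ?_)
    have h := lpNorm_smul_le (p := p) (-1) v
    rw [neg_one_smul_dist] at h
    simpa using h
  refine tendsto_ellNorm_zero hq0 (b := fun k => cutConst hψ * (supNorm χ + 1) *
      ∑ l ∈ nearR 2 (fun t => (2 : ℝ) ^ (j - j) * k t), lpNorm p (box ψ j l u)) ?_ ?_ fun k => ?_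
  · refine ne_top_of_le_ne_top ?_ (ellNorm_le_of_near hq (i := j) (j := j) le_rfl
      (K := cutConst hψ * (supNorm χ + 1)) (b := fun l => lpNorm p (box ψ j l u)) fun k => le_rfl)
    have := supNorm_ne_top χ
    refine ENNReal.mul_ne_top (ENNReal.mul_ne_top (ENNReal.mul_ne_top hC
      (ENNReal.add_ne_top.2 ⟨this, ENNReal.one_ne_top⟩)) ?_) hu
    simp
  · filter_upwards [hev] with n hn k
    refine (lpNorm_box_dmul_sub_le hψ hpp hχ hn k u).trans ?_
    rw [mul_assoc, Finset.mul_sum (a := supNorm χ + 1)]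
    exact mul_le_mul_right (Finset.sum_le_sum fun l _ => hle _ _) _
  · have h1 : Tendsto (fun n : ℕ => cutConst hψ *
        ∑ l ∈ nearR 2 (fun t => (2 : ℝ) ^ (j - j) * k t),
          lpNorm p (dmul (slow χ (-(n : ℤ))) (box ψ j l u) - box ψ j l u)) atTop (𝓝 0) := by
      have h2 := ENNReal.Tendsto.const_mul (a := cutConst hψ)
        (tendsto_finsetSum (nearR 2 (fun t => (2 : ℝ) ^ (j - j) * k t)) fun l _ =>
          tendsto_lpNorm_dmul_slow_sub hpp.lt.le h0
            (ne_top_of_le_ne_top hu (lpNorm_box_le_levelNorm hq0 j l u))) (Or.inr hC)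
      simpa using h2
    refine tendsto_of_tendsto_of_tendsto_of_le_of_le' tendsto_const_nhds h1
      (Eventually.of_forall fun _ => zero_le) ?_
    filter_upwards [hev] with n hn
    exact lpNorm_box_dmul_sub_le hψ hpp hχ hn k u

theorem tendsto_weighted_level_zero (hr : 0 < r) {s : ℝ} {u : TDist d}
    (hu : frakNorm ψ s p q r u ≠ ⊤) :
    Tendsto (fun n : ℕ => (2 : ℝ≥0∞) ^ (((-(n : ℤ) : ℤ) : ℝ) * s) * levelNorm ψ p q (-(n : ℤ)) u)
      atTop (𝓝 0) := by
  set w : Set.Iic (0 : ℤ) → ℝ≥0∞ := fun j =>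
    (2 : ℝ≥0∞) ^ (((j : ℤ) : ℝ) * s) * levelNorm ψ p q j u with hw
  have h1 : ellNorm r (fun n : ℕ => w (natEquivIic n)) ≠ ⊤ := by
    rw [ellNorm_comp_equiv]
    exact hu
  have h2 : ∑' n : ℕ, w (natEquivIic n) ^ r ≠ ⊤ := by
    intro h
    refine h1 ?_
    rw [ellNorm, h, ENNReal.top_rpow_of_pos (by positivity)]
  have h3 := ENNReal.tendsto_atTop_zero_of_tsum_ne_top h2
  have h4 := (ENNReal.continuous_rpow_const (y := 1 / r)).tendsto 0 |>.comp h3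
  rw [ENNReal.zero_rpow_of_pos (by positivity)] at h4
  refine h4.congr fun n => ?_
  simp only [Function.comp]
  rw [← ENNReal.rpow_mul, mul_one_div_cancel hr.ne', ENNReal.rpow_one]
  rfl

theorem frakNorm_dmul_slow_sub_tendsto (hψ : IsCutoff ψ) (hpp : p.HolderConjugate p')
    (hq : 1 ≤ q) (hr : 1 ≤ r) {s : ℝ} (hs : 0 < s + levExp d p q) {χ : TestFn d} (h0 : χ 0 = 1)
    (hχ : ∀ ξ, 𝓕 χ ξ ≠ 0 → ‖ξ‖ ≤ 1 / 16) {u : TDist d} (hu : frakNorm ψ s p q r u ≠ ⊤) :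
    Tendsto (fun n : ℕ => frakNorm ψ s p q r (dmul (slow χ (-(n : ℤ))) u - u)) atTop (𝓝 0) := by
  have hr0 : 0 < r := by linarith
  obtain ⟨C, hC, hCle⟩ := exists_levelNorm_dmul_slow_le hψ hpp hq hχ
  set w : ℤ → ℝ≥0∞ := fun j => (2 : ℝ≥0∞) ^ ((j : ℝ) * s) * levelNorm ψ p q j u with hw
  set K : ℝ≥0∞ := cutConst hψ * supNorm χ * 5 ^ d + 1 with hK
  have hKt : K ≠ ⊤ := ENNReal.add_ne_top.2 ⟨ENNReal.mul_ne_top (ENNReal.mul_ne_top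
    (cutConst_ne_top hψ) (supNorm_ne_top χ)) (by simp), ENNReal.one_ne_top⟩
  set A : ℕ → Set.Iic (0 : ℤ) → ℝ≥0∞ := fun n j => if -(n : ℤ) ≤ j then
    (2 : ℝ≥0∞) ^ (((j : ℤ) : ℝ) * s) * levelNorm ψ p q j (dmul (slow χ (-(n : ℤ))) u - u)
    else w j with hA
  set a : ℤ → ℝ≥0∞ := fun j => (2 : ℝ≥0∞) ^ ((j : ℝ) * (s + levExp d p q)) with ha
  set B : ℕ → Set.Iic (0 : ℤ) → ℝ≥0∞ := fun n j =>
    C * w (-(n : ℤ)) * if (j : ℤ) ≤ -(n : ℤ) then a (j + n) else 0 with hB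
  have hAlim : Tendsto (fun n => ellNorm r (A n)) atTop (𝓝 0) := by
    refine tendsto_ellNorm_zero hr0 (b := fun j => K * w j) ?_
      (Eventually.of_forall fun n j => ?_) fun j => ?_
    · rw [ellNorm_const_mul hr0]
      exact ENNReal.mul_ne_top hKt hu
    · simp only [hA]
      split_ifs with h
      · rw [hw, mul_left_comm, hK, add_mul, one_mul]
        exact mul_le_mul_right ((levelNorm_sub_le hpp.lt.le hq _ _ _).trans
          (add_le_add (levelNorm_dmul_slow_le hψ hpp hq hχ h u) le_rfl)) _
      · rw [hK, add_mul, one_mul]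
        exact le_add_self
    · have h1 := ENNReal.Tendsto.const_mul (a := (2 : ℝ≥0∞) ^ (((j : ℤ) : ℝ) * s))
        (tendsto_levelNorm_dmul_slow_sub hψ hpp hq h0 hχ
          (levelNorm_ne_top_of_familyNorm hr0 hu j)) (Or.inr (weight_ne_top _))
      rw [mul_zero] at h1
      refine h1.congr' ?_
      filter_upwards [eventually_ge_atTop (-(j : ℤ)).toNat] with n hn
      simp only [hA]
      rw [if_pos (by omega)]
  have hBlim : Tendsto (fun n => ellNorm r (B n)) atTop (𝓝 0) := by
    have hG := ellNorm_geometric_ne_top hr0 hs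
    have h1 := ENNReal.Tendsto.mul_const
      (ENNReal.Tendsto.const_mul (a := C) (tendsto_weighted_level_zero hr0 hu) (Or.inr hC))
      (Or.inr hG)
    rw [mul_zero, zero_mul] at h1
    refine tendsto_of_tendsto_of_tendsto_of_le_of_le tendsto_const_nhds h1
      (fun _ => zero_le) fun n => ?_
    simp only [hB]
    rw [ellNorm_const_mul hr0]
    exact mul_le_mul_right (ellNorm_shift_le hr0 a n) _
  have hsum := hAlim.add hBlim
  rw [add_zero] at hsum
  refine tendsto_of_tendsto_of_tendsto_of_le_of_le tendsto_const_nhds hsum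
    (fun _ => zero_le) fun n => (ellNorm_mono hr0 fun j => ?_).trans (ellNorm_add_le hr _ _)
  simp only [hA, hB]
  by_cases h : -(n : ℤ) ≤ (j : ℤ)
  · rw [if_pos h]
    exact le_self_add
  · rw [if_neg h, if_pos (by omega)]
    have hj : (j : ℤ) ≤ -(n : ℤ) := by omega
    have h2 := hCle j (-(n : ℤ)) hj u
    have h3 : (2 : ℝ≥0∞) ^ (((j : ℤ) : ℝ) * s) *
        (2 : ℝ≥0∞) ^ ((((j : ℤ) : ℝ) - ((-(n : ℤ) : ℤ) : ℝ)) * levExp d p q) =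
        (2 : ℝ≥0∞) ^ (((-(n : ℤ) : ℤ) : ℝ) * s) *
          (2 : ℝ≥0∞) ^ ((((j : ℤ) + (n : ℤ) : ℤ) : ℝ) * (s + levExp d p q)) := by
      rw [← ENNReal.rpow_add _ _ two_ne_zero ENNReal.ofNat_ne_top,
        ← ENNReal.rpow_add _ _ two_ne_zero ENNReal.ofNat_ne_top]
      congr 1
      push_cast
      ring
    calc (2 : ℝ≥0∞) ^ (((j : ℤ) : ℝ) * s) * levelNorm ψ p q j (dmul (slow χ (-(n : ℤ))) u - u)
        ≤ (2 : ℝ≥0∞) ^ (((j : ℤ) : ℝ) * s) *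
          (C * (2 : ℝ≥0∞) ^ ((((j : ℤ) : ℝ) - ((-(n : ℤ) : ℤ) : ℝ)) * levExp d p q) *
            levelNorm ψ p q (-(n : ℤ)) u + levelNorm ψ p q j u) :=
          mul_le_mul_right ((levelNorm_sub_le hpp.lt.le hq _ _ _).trans
            (add_le_add h2 le_rfl)) _
      _ = w j + C * ((2 : ℝ≥0∞) ^ (((j : ℤ) : ℝ) * s) *
          (2 : ℝ≥0∞) ^ ((((j : ℤ) : ℝ) - ((-(n : ℤ) : ℤ) : ℝ)) * levExp d p q)) *
            levelNorm ψ p q (-(n : ℤ)) u := by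
          rw [hw]
          ring
      _ = _ := by
          rw [h3, hw, ha]
          ring

theorem exists_frakNorm_dmul_trunc_le (hψ : IsCutoff ψ) (hpp : p.HolderConjugate p')
    (hq : 1 ≤ q) (hr : 1 ≤ r) {s : ℝ} (hs : 0 < s + levExp d p q) {χ : TestFn d}
    (hχ : ∀ ξ, 𝓕 χ ξ ≠ 0 → ‖ξ‖ ≤ 1 / 16) (n : ℕ) (S : Finset (Fin d → ℤ)) :
    ∃ C : ℝ≥0∞, C ≠ ⊤ ∧ ∀ h : TDist d,
      frakNorm ψ s p q r (dmul (slow χ (-(n : ℤ))) (trunc ψ 0 S h)) ≤ C * lpNorm p h := by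
  have hr0 : 0 < r := by linarith
  obtain ⟨C₃, hC₃, h3⟩ := exists_levelNorm_dmul_slow_le hψ hpp hq hχ
  set C₁ : ℝ≥0∞ := cutConst hψ * supNorm χ * 5 ^ d with hC₁
  set C₂ : ℝ≥0∞ := cutConst hψ * cutConst hψ * S.card * 5 ^ d with hC₂
  set e : ℝ := d / q + levExp d p q with he
  have he0 : 0 ≤ e := by
    have h1 : 1 / p ≤ 1 := by rw [div_le_one hpp.pos]; exact hpp.lt.le
    have h2 : e = d * (1 - 1 / p) := by rw [he, levExp]; ring
    rw [h2]
    have : 0 ≤ 1 - 1 / p := by linarith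
    positivity
  set M : ℝ≥0∞ := (C₁ + C₃) * C₂ * (2 : ℝ≥0∞) ^ ((n : ℝ) * e) with hM
  have hct := cutConst_ne_top hψ
  have hC₁t : C₁ ≠ ⊤ := ENNReal.mul_ne_top (ENNReal.mul_ne_top hct (supNorm_ne_top χ)) (by simp)
  have hC₂t : C₂ ≠ ⊤ := ENNReal.mul_ne_top (ENNReal.mul_ne_top (ENNReal.mul_ne_top hct hct)
    (ENNReal.natCast_ne_top _)) (by simp)
  have hMt : M ≠ ⊤ := ENNReal.mul_ne_top (ENNReal.mul_ne_top
    (ENNReal.add_ne_top.2 ⟨hC₁t, hC₃⟩) hC₂t) (weight_ne_top _)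
  have htr : ∀ (j : ℤ), j ≤ 0 → ∀ h : TDist d, levelNorm ψ p q j (trunc ψ 0 S h) ≤
      C₂ * (2 : ℝ≥0∞) ^ (-(j : ℝ) * (d / q)) * lpNorm p h := fun j hj h => by
    have := levelNorm_trunc_le_lpNorm hψ hpp hq hj S h
    rw [← mul_assoc, ← hC₂] at this
    simpa using this
  have key : ∀ (j : ℤ), j ≤ 0 → ∀ h : TDist d,
      levelNorm ψ p q j (dmul (slow χ (-(n : ℤ))) (trunc ψ 0 S h)) ≤
        M * (2 : ℝ≥0∞) ^ ((j : ℝ) * levExp d p q) * lpNorm p h := by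
    intro j hj h
    rcases le_total (-(n : ℤ)) j with hn | hn
    · refine (levelNorm_dmul_slow_le hψ hpp hq hχ hn _).trans ?_
      refine (mul_le_mul_right (htr j hj h) _).trans ?_
      rw [← mul_assoc]
      refine mul_le_mul_left ?_ _
      have h1 : (2 : ℝ≥0∞) ^ (-(j : ℝ) * (d / q)) ≤
          (2 : ℝ≥0∞) ^ ((n : ℝ) * e) * (2 : ℝ≥0∞) ^ ((j : ℝ) * levExp d p q) := by
        rw [← ENNReal.rpow_add _ _ two_ne_zero ENNReal.ofNat_ne_top]
        refine ENNReal.rpow_le_rpow_of_exponent_le one_le_two ?_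
        have h2 : -(n : ℝ) ≤ j := by exact_mod_cast hn
        have h3 : 0 ≤ ((n : ℝ) + j) * e := mul_nonneg (by linarith) he0
        have h4 : -(j : ℝ) * (d / q) = -(j : ℝ) * (e - levExp d p q) := by rw [he]; ring
        rw [h4]
        linarith
      calc C₁ * (C₂ * (2 : ℝ≥0∞) ^ (-(j : ℝ) * (d / q)))
          ≤ (C₁ + C₃) * (C₂ * ((2 : ℝ≥0∞) ^ ((n : ℝ) * e) *
              (2 : ℝ≥0∞) ^ ((j : ℝ) * levExp d p q))) :=
            mul_le_mul' le_self_add (mul_le_mul_right h1 _)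
        _ = _ := by rw [hM]; ring
    · refine (h3 j _ hn _).trans ((mul_le_mul_right (htr _ (by omega) h) _).trans ?_)
      rw [← mul_assoc]
      refine mul_le_mul_left ?_ _
      have h1 : (2 : ℝ≥0∞) ^ (((j : ℝ) - ((-(n : ℤ) : ℤ) : ℝ)) * levExp d p q) *
          (2 : ℝ≥0∞) ^ (-((-(n : ℤ) : ℤ) : ℝ) * (d / q)) =
          (2 : ℝ≥0∞) ^ ((n : ℝ) * e) * (2 : ℝ≥0∞) ^ ((j : ℝ) * levExp d p q) := by
        rw [← ENNReal.rpow_add _ _ two_ne_zero ENNReal.ofNat_ne_top,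
          ← ENNReal.rpow_add _ _ two_ne_zero ENNReal.ofNat_ne_top, he]
        congr 1
        push_cast
        ring
      calc _ = C₃ * C₂ * ((2 : ℝ≥0∞) ^ (((j : ℝ) - ((-(n : ℤ) : ℤ) : ℝ)) * levExp d p q) *
          (2 : ℝ≥0∞) ^ (-((-(n : ℤ) : ℤ) : ℝ) * (d / q))) := by ring
        _ ≤ (C₁ + C₃) * C₂ * ((2 : ℝ≥0∞) ^ ((n : ℝ) * e) *
              (2 : ℝ≥0∞) ^ ((j : ℝ) * levExp d p q)) := by
            rw [h1]
            exact mul_le_mul_left (mul_le_mul_left le_add_self _) _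
        _ = _ := by rw [hM]; ring
  refine ⟨_, ENNReal.mul_ne_top hMt (ellNorm_geometric_ne_top hr0 hs), fun h => ?_⟩
  rw [mul_right_comm, ← ellNorm_const_mul hr0]
  refine ellNorm_mono hr0 fun j => (mul_le_mul_right (key j j.2 h) _).trans (le_of_eq ?_)
  rw [mul_add, ENNReal.rpow_add _ _ two_ne_zero ENNReal.ofNat_ne_top]
  ring

theorem schwartzDense_frak (hψ : IsCutoff ψ) (hpp : p.HolderConjugate p')
    (hp1 : 1 ≤ p) (hq : 1 ≤ q) (hr : 1 ≤ r) {s : ℝ} (hs : 0 < s + levExp d p q) :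
    SchwartzDense (frakSeminorm ψ s hp1 hq hr) := by
  have hr0 : 0 < r := by linarith
  have hq0 : 0 < q := by linarith
  obtain ⟨σ, hσ, hσle⟩ := exists_frakNorm_schwartz_le (r := r) hψ hpp hq hr hs
  refine schwartzDense_of_forall (fun φ => (hσle φ).trans_lt (hσ.ne_top φ).lt_top)
    fun f hf ε hε => ?_
  change frakNorm ψ s p q r f ≠ ⊤ at hf
  obtain ⟨χ, h0, hχ⟩ := exists_slow d
  have hε3 : ε / 3 ≠ 0 := by simpa using hε
  have hlim := ENNReal.Tendsto.const_mul (a := truncConst hψ)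
    (frakNorm_sub_trunc_tendsto hψ hpp hq hr0 hf) (Or.inr (truncConst_ne_top hψ))
  rw [mul_zero] at hlim
  obtain ⟨S, hS⟩ := (hlim.eventually_le_const (pos_iff_ne_zero.2 hε3)).exists
  set v := trunc ψ 0 S f with hv
  set u := trunc ψ 0 S v with hu
  have hut : frakNorm ψ s p q r u ≠ ⊤ := by
    have hK := truncConst_ne_top hψ
    refine ne_top_of_le_ne_top (ENNReal.mul_ne_top hK (ENNReal.mul_ne_top hK hf))
      ((frakNorm_trunc_le hψ hpp hq hr0 s S v).trans (mul_le_mul_right ?_ _))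
    exact frakNorm_trunc_le hψ hpp hq hr0 s S f
  have hvp : lpNorm p v ≠ ⊤ := lpNorm_trunc_ne_top hp1 hq0
    (levelNorm_ne_top_of_familyNorm hr0 hf ⟨0, Set.mem_Iic.2 le_rfl⟩) S
  obtain ⟨n, hn⟩ := ((frakNorm_dmul_slow_sub_tendsto hψ hpp hq hr hs h0 hχ
    hut).eventually_le_const (pos_iff_ne_zero.2 hε3)).exists
  obtain ⟨C, hC, hCle⟩ := exists_frakNorm_dmul_trunc_le hψ hpp hq hr hs hχ n S
  obtain ⟨δ, hδ, hCδ⟩ := exists_mul_ofReal_le hC hε3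
  obtain ⟨η, hη⟩ := exists_schwartz_lpNorm_sub_le hp1 hvp hδ
  refine ⟨pmul (slow χ (-(n : ℤ))) (∑ l ∈ S, mop (sym hψ 0 l) η), ?_⟩
  rw [← dmul_ofSchwartz, ← trunc_ofSchwartz hψ]
  set D := dmul (slow χ (-(n : ℤ))) with hD
  have h : f - D (trunc ψ 0 S (ofSchwartz η)) =
      ((f - u) + -(D u - u)) + D (trunc ψ 0 S (v - ofSchwartz η)) := by
    rw [trunc_sub, map_sub, ← hu]
    abel
  rw [h]
  calc _ ≤ (frakNorm ψ s p q r (f - u) + frakNorm ψ s p q r (D u - u)) +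
        frakNorm ψ s p q r (D (trunc ψ 0 S (v - ofSchwartz η))) := by
        refine ((frakSeminorm ψ s hp1 hq hr).add_le' _ _).trans (add_le_add ?_ le_rfl)
        refine ((frakSeminorm ψ s hp1 hq hr).add_le' _ _).trans (add_le_add le_rfl ?_)
        exact (frakSeminorm ψ s hp1 hq hr).neg_le _
    _ ≤ (ε / 3 + ε / 3) + ε / 3 := by
        refine add_le_add (add_le_add ?_ hn) ?_
        · exact (frakNorm_sub_trunc_trunc_le hψ hpp hq hr0 s S f).trans hS
        · exact (hCle _).trans ((mul_le_mul_right hη _).trans hCδ)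
    _ = ε := ENNReal.add_thirds ε

end FrakDensity

section ScrDensity

variable {d : ℕ} {p p' q q' r r' : ℝ} {ψ : Eu d → ℝ}

theorem exists_family_of_scrNorm_lt {μ : ℝ} {f : TDist d} {c : ℝ≥0∞}
    (hf : scrNorm ψ μ p q r f < c) :
    ∃ F : Set.Iic (0 : ℤ) → TDist d, HasSum F f ∧ familyNorm ψ μ p q r F < c := by
  simp only [scrNorm, iInf_lt_iff] at hf
  obtain ⟨F, hF, h⟩ := hf
  exact ⟨F, hF, h⟩

theorem scrNorm_sum_le (hp : 1 ≤ p) (hq : 1 ≤ q) (hr : 1 ≤ r) (μ : ℝ) {ι : Type*} (s : Finset ι)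
    (u : ι → TDist d) : scrNorm ψ μ p q r (∑ i ∈ s, u i) ≤ ∑ i ∈ s, scrNorm ψ μ p q r (u i) := by
  classical
  induction s using Finset.induction_on with
  | empty => exact (scrSeminorm ψ μ hp hq hr).zero'.le
  | insert i s hi ih =>
    rw [Finset.sum_insert hi, Finset.sum_insert hi]
    exact ((scrSeminorm ψ μ hp hq hr).add_le' _ _).trans (add_le_add le_rfl ih)

theorem tendsto_scrNorm_sub_sum (hq : 1 ≤ q) (hr : 1 ≤ r) {μ : ℝ} {f : TDist d}
    {F : Set.Iic (0 : ℤ) → TDist d} (hF : HasSum F f) (hFt : familyNorm ψ μ p q r F ≠ ⊤) :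
    Tendsto (fun A => scrNorm ψ μ p q r (f - ∑ j ∈ A, F j)) atTop (𝓝 0) := by
  classical
  have hr0 : 0 < r := by linarith
  have h1 : Tendsto (fun A : Finset (Set.Iic (0 : ℤ)) =>
      familyNorm ψ μ p q r fun j => if j ∈ A then 0 else F j) atTop (𝓝 0) := by
    refine tendsto_ellNorm_zero hr0 (b := fun j : Set.Iic (0 : ℤ) =>
      (2 : ℝ≥0∞) ^ (((j : ℤ) : ℝ) * μ) * levelNorm ψ p q j (F j)) hFt
      (Eventually.of_forall fun A j => ?_) fun j => ?_
    · dsimp only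
      split_ifs
      · rw [levelNorm_zero ψ hq, mul_zero]
        exact zero_le
      · exact le_rfl
    · refine tendsto_const_nhds.congr' ?_
      filter_upwards [eventually_ge_atTop {j}] with A hA
      rw [if_pos (hA (Finset.mem_singleton_self j)), levelNorm_zero ψ hq, mul_zero]
  refine tendsto_of_tendsto_of_tendsto_of_le_of_le tendsto_const_nhds h1
    (fun _ => zero_le) fun A => iInf₂_le_of_le _ ?_ le_rfl
  have h2 : HasSum (fun j => if j ∈ A then F j else 0) (∑ j ∈ A, F j) := by
    have : HasSum (fun j => if j ∈ A then F j else 0) (∑ j ∈ A, if j ∈ A then F j else 0) :=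
      hasSum_sum_of_ne_finset_zero fun j hj => if_neg hj
    rwa [Finset.sum_congr rfl fun j hj => if_pos hj] at this
  convert hF.sub h2 using 1
  funext j
  split_ifs <;> simp

theorem schwartzDense_scr (hψ : IsCutoff ψ) (hpp : p.HolderConjugate p')
    (hp1 : 1 ≤ p) (hq : 1 ≤ q) (hr : 1 ≤ r) (μ : ℝ) :
    SchwartzDense (scrSeminorm ψ μ hp1 hq hr) := by
  obtain ⟨σ, hσ, hσle⟩ := exists_scrNorm_schwartz_le (r := r) hψ hpp hq hr μ
  refine schwartzDense_of_forall (fun φ => (hσle φ).trans_lt (hσ.ne_top φ).lt_top)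
    fun f hf ε hε => ?_
  change scrNorm ψ μ p q r f ≠ ⊤ at hf
  have hε2 : ε / 2 ≠ 0 := by simpa using hε
  obtain ⟨F, hF, hFt⟩ := exists_family_of_scrNorm_lt hf.lt_top
  obtain ⟨A, hA⟩ := ((tendsto_scrNorm_sub_sum hq hr hF hFt.ne).eventually_le_const
    (pos_iff_ne_zero.2 hε2)).exists
  set δ : ℝ≥0∞ := ε / 2 / (A.card + 1) with hδ
  have hcard : (A.card : ℝ≥0∞) + 1 ≠ ⊤ :=
    ENNReal.add_ne_top.2 ⟨ENNReal.natCast_ne_top _, ENNReal.one_ne_top⟩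
  have hδ0 : δ ≠ 0 := ENNReal.div_ne_zero.2 ⟨hε2, hcard⟩
  have hφ : ∀ j : Set.Iic (0 : ℤ), ∃ φ : TestFn d,
      (2 : ℝ≥0∞) ^ (((j : ℤ) : ℝ) * μ) * levelNorm ψ p q j (F j - ofSchwartz φ) ≤ δ := fun j => by
    obtain ⟨φ, h⟩ := exists_schwartz_levelNorm_sub_le hψ hpp hq
      (levelNorm_ne_top_of_familyNorm (by linarith) hFt.ne j)
      (ENNReal.div_ne_zero.2 ⟨hδ0, weight_ne_top (((j : ℤ) : ℝ) * μ)⟩)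
    exact ⟨φ, (mul_le_mul_right h _).trans ENNReal.mul_div_le⟩
  choose φ hφ using hφ
  refine ⟨∑ j ∈ A, φ j, ?_⟩
  have h : f - ofSchwartz (∑ j ∈ A, φ j) =
      (f - ∑ j ∈ A, F j) + ∑ j ∈ A, (F j - ofSchwartz (φ j)) := by
    have h1 : ofSchwartz (∑ j ∈ A, φ j) = ∑ j ∈ A, ofSchwartz (φ j) :=
      map_sum (SchwartzMap.toTemperedDistributionCLM (Eu d) ℂ volume) φ A
    rw [Finset.sum_sub_distrib, h1]
    abel
  rw [h]
  calc _ ≤ scrNorm ψ μ p q r (f - ∑ j ∈ A, F j) +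
        scrNorm ψ μ p q r (∑ j ∈ A, (F j - ofSchwartz (φ j))) :=
        (scrSeminorm ψ μ hp1 hq hr).add_le' _ _
    _ ≤ ε / 2 + ε / 2 := by
        refine add_le_add hA ((scrNorm_sum_le hp1 hq hr μ A _).trans
          ((Finset.sum_le_sum fun j _ => (scrNorm_le_levelNorm hq hr μ j _).trans (hφ j)).trans ?_))
        rw [Finset.sum_const, nsmul_eq_mul, hδ]
        calc (A.card : ℝ≥0∞) * (ε / 2 / (A.card + 1)) ≤
            (A.card + 1 : ℝ≥0∞) * (ε / 2 / (A.card + 1)) := mul_le_mul_left le_self_add _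
          _ ≤ ε / 2 := ENNReal.mul_div_le
    _ = ε := ENNReal.add_halves ε

end ScrDensity

/-! ### A criterion for duality -/

section Criterion

variable {d : ℕ} {N L : ExtSeminorm (TDist d)}

/-- The Schwartz functions as elements of a space of tempered distributions. -/
def schwartzIncl (N : ExtSeminorm (TDist d)) (h : ∀ φ : TestFn d, N.toFun (ofSchwartz φ) < ⊤) :
    TestFn d →ₗ[ℂ] N.Space where
  toFun φ := N.ofLt (ofSchwartz φ) (h φ)
  map_add' φ η := N.incl_injective (by simp)
  map_smul' c φ := N.incl_injective (by simp)

theorem norm_schwartzIncl (h : ∀ φ : TestFn d, N.toFun (ofSchwartz φ) < ⊤) (φ : TestFn d) :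
    ‖schwartzIncl N h φ‖ = (N.toFun (ofSchwartz φ)).toReal := rfl

theorem SchwartzDense.denseRange (hd : SchwartzDense N) : DenseRange (schwartzIncl N hd.1) := by
  refine hd.2.mono ?_
  rintro f ⟨φ, hφ⟩
  exact ⟨φ, N.incl_injective hφ.symm⟩

theorem SchwartzDense.strongDual_ext (hd : SchwartzDense N) {ℓ ℓ' : StrongDual ℂ N.Space}
    (h : ∀ φ, ℓ (schwartzIncl N hd.1 φ) = ℓ' (schwartzIncl N hd.1 φ)) : ℓ = ℓ' :=
  DFunLike.coe_injective (hd.denseRange.equalizer ℓ.continuous ℓ'.continuous (funext h))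

theorem SchwartzDense.exists_sub_le (hd : SchwartzDense N) {f : TDist d} (hf : N.toFun f ≠ ⊤)
    {ε : ℝ≥0∞} (hε : ε ≠ 0) : ∃ φ : TestFn d, N.toFun (f - ofSchwartz φ) ≤ ε := by
  have h1 : min ε 1 ≠ ⊤ := ne_top_of_le_ne_top ENNReal.one_ne_top (min_le_right _ _)
  have h0 : 0 < (min ε 1).toReal := ENNReal.toReal_pos (by simp [hε]) h1
  obtain ⟨y, ⟨φ, hφ⟩, hy⟩ := Metric.mem_closure_iff.1 (hd.2 (N.ofLt f hf.lt_top)) _ h0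
  refine ⟨φ, ?_⟩
  rw [dist_eq_norm, ExtSeminorm.norm_def, map_sub, ExtSeminorm.incl_ofLt, hφ] at hy
  have h2 : N.toFun (f - ofSchwartz φ) ≠ ⊤ := by
    rw [← hφ, ← N.incl_ofLt f hf.lt_top, ← map_sub]
    exact (N.incl_lt_top _).ne
  exact ((ENNReal.toReal_le_toReal h2 h1).1 hy.le).trans (min_le_left _ _)

theorem SchwartzDense.exists_extension (hd : SchwartzDense N) {g : TDist d} {c : ℝ≥0∞} (hc : c ≠ ⊤)
    (h : ∀ φ, ‖g φ‖ₑ ≤ c * N.toFun (ofSchwartz φ)) :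
    ∃ ℓ : StrongDual ℂ N.Space, (∀ φ, ℓ (schwartzIncl N hd.1 φ) = g φ) ∧ ‖ℓ‖ ≤ c.toReal := by
  refine exists_strongDual_comp_eq (schwartzIncl N hd.1)
    { toFun := fun φ => g φ
      map_add' := map_add g
      map_smul' := fun a φ => map_smul g a φ } ENNReal.toReal_nonneg fun φ => ?_
  rw [norm_schwartzIncl, ← ENNReal.toReal_mul, ← toReal_enorm]
  exact ENNReal.toReal_mono (ENNReal.mul_ne_top hc (hd.1 φ).ne) (h φ)

theorem dualEq_of (hd : SchwartzDense N) {C D : ℝ≥0∞} (hC : C ≠ ⊤) (hD : D ≠ ⊤)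
    (hb : ∀ g : TDist d, L.toFun g ≠ ⊤ →
      ∀ φ, ‖g φ‖ₑ ≤ C * (L.toFun g * N.toFun (ofSchwartz φ)))
    (hs : ∀ ℓ : StrongDual ℂ N.Space, ∃ g : TDist d, L.toFun g ≤ D * ‖ℓ‖ₑ ∧
      ∀ φ, ℓ (schwartzIncl N hd.1 φ) = g φ) : DualEq N L := by
  refine ⟨hd, ?_⟩
  choose g hg hgφ using hs
  have hlt : ∀ ℓ, L.toFun (g ℓ) < ⊤ := fun ℓ =>
    (hg ℓ).trans_lt (ENNReal.mul_lt_top hD.lt_top enorm_lt_top)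
  let R : StrongDual ℂ N.Space →ₗ[ℂ] L.Space :=
    { toFun := fun ℓ => L.ofLt (g ℓ) (hlt ℓ)
      map_add' := fun ℓ ℓ' => L.incl_injective <| by
        rw [map_add]
        simp only [ExtSeminorm.incl_ofLt]
        refine DFunLike.ext _ _ fun φ => ?_
        change g (ℓ + ℓ') φ = g ℓ φ + g ℓ' φ
        rw [← hgφ, ← hgφ, ← hgφ]
        rfl
      map_smul' := fun c ℓ => L.incl_injective <| by
        rw [map_smul]
        simp only [ExtSeminorm.incl_ofLt]
        refine DFunLike.ext _ _ fun φ => ?_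
        change g (c • ℓ) φ = c • g ℓ φ
        rw [← hgφ, ← hgφ]
        rfl }
  have hR : ∀ ℓ φ, L.incl (R ℓ) φ = ℓ (schwartzIncl N hd.1 φ) := fun ℓ φ => (hgφ ℓ φ).symm
  have hext : ∀ h : L.Space, ∃ ℓ : StrongDual ℂ N.Space, R ℓ = h ∧ ‖ℓ‖ ≤ C.toReal * ‖h‖ := by
    intro h
    obtain ⟨ℓ, h1, h2⟩ := hd.exists_extension (ENNReal.mul_ne_top hC (L.incl_lt_top h).ne)
      fun φ => (hb (L.incl h) (L.incl_lt_top h).ne φ).trans_eq (mul_assoc _ _ _).symm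
    refine ⟨ℓ, L.incl_injective (DFunLike.ext _ _ fun φ => by rw [hR, h1]), ?_⟩
    rwa [ENNReal.toReal_mul] at h2
  have hinj : Function.Injective R := fun ℓ ℓ' h =>
    hd.strongDual_ext fun φ => by rw [← hR, ← hR, h]
  have hsurj : Function.Surjective R := fun h => (hext h).imp fun ℓ hℓ => hℓ.1
  let T := (LinearEquiv.ofBijective R ⟨hinj, hsurj⟩).toContinuousLinearEquivOfBounds
    D.toReal C.toReal
    (fun ℓ => by
      have := ENNReal.toReal_mono (ENNReal.mul_ne_top hD enorm_ne_top) (hg ℓ)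
      rwa [ENNReal.toReal_mul, toReal_enorm] at this)
    (fun h => by
      obtain ⟨ℓ, h1, h2⟩ := hext h
      have h3 : (LinearEquiv.ofBijective R ⟨hinj, hsurj⟩).symm h = ℓ := by
        rw [LinearEquiv.symm_apply_eq]
        exact h1.symm
      rwa [h3])
  refine ⟨T.symm, fun h f φ hf => ?_⟩
  have h1 : f = schwartzIncl N hd.1 φ := N.incl_injective hf
  have h2 : R (T.symm h) = h := T.apply_symm_apply h
  rw [h1, ← hR, h2]

end Criterion

/-! ### The pairing of the two spaces -/

section Pairing

variable {d : ℕ} {p p' q q' r r' : ℝ} {ψ : Eu d → ℝ}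

theorem ofSchwartz_apply_comm (φ η : TestFn d) : ofSchwartz φ η = ofSchwartz η φ := by
  simp only [ofSchwartz_apply, mul_comm]

theorem levelNorm_le_frakNorm (hr : 0 < r) (s : ℝ) (u : TDist d) :
    levelNorm ψ p q 0 u ≤ frakNorm ψ s p q r u := by
  have := le_ellNorm hr (fun j : Set.Iic (0 : ℤ) =>
    (2 : ℝ≥0∞) ^ (((j : ℤ) : ℝ) * s) * levelNorm ψ p q j u) ⟨0, Set.mem_Iic.2 le_rfl⟩
  simpa [frakNorm, familyNorm] using this

theorem exists_enorm_apply_le_scr_mul_frak (hψ : IsCutoff ψ) (hpp : p.HolderConjugate p')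
    (hqq : q.HolderConjugate q') (hrr : r.HolderConjugate r') (μ : ℝ) :
    ∃ C : ℝ≥0∞, C ≠ ⊤ ∧ ∀ (f : TDist d) (φ : TestFn d), scrNorm ψ μ p q r f ≠ ⊤ →
      frakNorm ψ (-μ) p' q' r' (ofSchwartz φ) ≠ ⊤ →
      ‖f φ‖ₑ ≤ C * (scrNorm ψ μ p q r f * frakNorm ψ (-μ) p' q' r' (ofSchwartz φ)) := by
  obtain ⟨C, hC, h⟩ := exists_pairing_const (d := d) hψ hpp hqq
  refine ⟨C, hC, fun f φ hf hφ => ?_⟩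
  set B := frakNorm ψ (-μ) p' q' r' (ofSchwartz φ) with hB
  have key : ∀ F : Set.Iic (0 : ℤ) → TDist d, HasSum F f →
      ‖f φ‖ₑ ≤ C * B * familyNorm ψ μ p q r F := by
    intro F hF
    have h1 : HasSum (fun j => F j φ) (f φ) := by
      have := (PointwiseConvergenceCLM.tendsto_iff_forall_tendsto.1 hF) φ
      simpa only [HasSum, dist_sum_apply] using this
    have h2 : ‖f φ‖ₑ ≤ ∑' j, ‖F j φ‖ₑ := by
      rw [← h1.tsum_eq]
      exact enorm_tsum_le_tsum_enorm
    refine h2.trans ?_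
    have h3 : ∀ j : Set.Iic (0 : ℤ), ‖F j φ‖ₑ ≤
        C * (((2 : ℝ≥0∞) ^ (((j : ℤ) : ℝ) * μ) * levelNorm ψ p q j (F j)) *
          ((2 : ℝ≥0∞) ^ (((j : ℤ) : ℝ) * (-μ)) * levelNorm ψ p' q' j (ofSchwartz φ))) := by
      intro j
      refine (h j (F j) φ).trans_eq ?_
      rw [mul_mul_mul_comm, mul_neg, ENNReal.rpow_neg,
        ENNReal.mul_inv_cancel (weight_ne_zero _) (weight_ne_top _), one_mul]
    refine (ENNReal.tsum_le_tsum h3).trans ?_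
    rw [ENNReal.tsum_mul_left, mul_assoc, mul_comm B]
    exact mul_le_mul_right (tsum_mul_le_ellNorm hrr _ _) C
  have hCB : C * B ≠ ⊤ := ENNReal.mul_ne_top hC hφ
  rw [mul_comm (scrNorm ψ μ p q r f), ← mul_assoc]
  rcases eq_or_ne (C * B) 0 with h0 | h0
  · obtain ⟨F, hF, -⟩ := exists_family_of_scrNorm_lt hf.lt_top
    have := key F hF
    rwa [h0, zero_mul] at this ⊢
  · rw [scrNorm]
    simp only [ENNReal.mul_iInf_of_ne h0 hCB]
    exact le_iInf₂ key

theorem exists_enorm_apply_le_frak_mul_scr (hψ : IsCutoff ψ) (hpp : p.HolderConjugate p')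
    (hqq : q.HolderConjugate q') (hrr : r.HolderConjugate r') {μ : ℝ}
    (hμ : 0 < -μ + levExp d p' q') :
    ∃ C : ℝ≥0∞, C ≠ ⊤ ∧ ∀ (g : TDist d) (φ : TestFn d), frakNorm ψ (-μ) p' q' r' g ≠ ⊤ →
      ‖g φ‖ₑ ≤ C * (frakNorm ψ (-μ) p' q' r' g * scrNorm ψ μ p q r (ofSchwartz φ)) := by
  obtain ⟨C₀, hC₀, h₀⟩ := exists_pairing_const (d := d) hψ hpp.symm hqq.symm
  obtain ⟨C, hC, h⟩ := exists_enorm_apply_le_scr_mul_frak (d := d) hψ hpp hqq hrr μ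
  obtain ⟨σ, hσ, hσle⟩ := exists_scrNorm_schwartz_le (r := r) hψ hpp hqq.lt.le hrr.lt.le μ
  obtain ⟨τ, hτ, hτle⟩ := exists_levelNorm_schwartz_le hψ hpp hqq.lt.le
  have hd := schwartzDense_frak (r := r') hψ hpp.symm hpp.symm.lt.le hqq.symm.lt.le hrr.symm.lt.le hμ
  refine ⟨C, hC, fun g φ hg => ?_⟩
  set A := frakNorm ψ (-μ) p' q' r' g with hA
  set S := scrNorm ψ μ p q r (ofSchwartz φ) with hS
  have hSt : S ≠ ⊤ := ne_top_of_le_ne_top (hσ.ne_top φ) (hσle φ)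
  set ℓ := levelNorm ψ p q 0 (ofSchwartz φ) with hℓ
  have hℓt : ℓ ≠ ⊤ := ne_top_of_le_ne_top (hτ.ne_top φ) (by simpa using hτle 0 le_rfl φ)
  have key : ∀ n : ℕ, ‖g φ‖ₑ ≤ C * (S * (A + (n : ℝ≥0∞)⁻¹)) + C₀ * ((n : ℝ≥0∞)⁻¹ * ℓ) := by
    intro n
    have hn : (n : ℝ≥0∞)⁻¹ ≠ 0 := ENNReal.inv_ne_zero.2 (ENNReal.natCast_ne_top n)
    obtain ⟨η, hη⟩ := hd.exists_sub_le hg hn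
    change frakNorm ψ (-μ) p' q' r' (g - ofSchwartz η) ≤ _ at hη
    have h1 : g φ = ofSchwartz φ η + (g - ofSchwartz η) φ := by
      rw [dist_sub_apply, ofSchwartz_apply_comm φ η]
      ring
    have h2 : frakNorm ψ (-μ) p' q' r' (ofSchwartz η) ≤ A + (n : ℝ≥0∞)⁻¹ := by
      have e : ofSchwartz η = g + (-1 : ℂ) • (g - ofSchwartz η) := by
        rw [neg_one_smul_dist]
        abel
      rw [e]
      have h3 := (frakSeminorm ψ (-μ) hpp.symm.lt.le hqq.symm.lt.le hrr.symm.lt.le).add_le' g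
        ((-1 : ℂ) • (g - ofSchwartz η))
      have h4 := (frakSeminorm ψ (-μ) hpp.symm.lt.le hqq.symm.lt.le hrr.symm.lt.le).smul_le' (-1)
        (g - ofSchwartz η)
      refine h3.trans (add_le_add le_rfl (h4.trans ?_))
      rw [enorm_neg, enorm_one, one_mul]
      exact hη
    rw [h1]
    refine (enorm_add_le _ _).trans (add_le_add ?_ ?_)
    · exact (h _ _ hSt (hd.1 η).ne).trans (mul_le_mul_right (mul_le_mul_right h2 _) _)
    · exact (h₀ 0 _ φ).trans (mul_le_mul_right (mul_le_mul_left
        ((levelNorm_le_frakNorm hrr.symm.pos _ _).trans hη) _) _)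
  have hlim : Tendsto (fun n : ℕ => C * (S * (A + (n : ℝ≥0∞)⁻¹)) + C₀ * ((n : ℝ≥0∞)⁻¹ * ℓ)) atTop
      (𝓝 (C * (S * (A + 0)) + C₀ * (0 * ℓ))) := by
    have hi := ENNReal.tendsto_inv_nat_nhds_zero
    exact (ENNReal.Tendsto.const_mul (ENNReal.Tendsto.const_mul (tendsto_const_nhds.add hi)
      (Or.inr hSt)) (Or.inr hC)).add
      (ENNReal.Tendsto.const_mul (ENNReal.Tendsto.mul_const hi (Or.inr hℓt)) (Or.inr hC₀))
  have := ge_of_tendsto' hlim key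
  simpa [mul_comm S] using this

end Pairing

/-! ### Synthesis from frequency pieces -/

section Synthesis

open FourierTransform

variable {d : ℕ} {p p' q q' r r' : ℝ} {ψ : Eu d → ℝ}

theorem exists_dist_of_schwartzBound (g : TestFn d →ₗ[ℂ] ℂ) {σ : TestFn d → ℝ≥0∞}
    (hσ : SchwartzBound σ) (h : ∀ φ, ‖g φ‖ₑ ≤ σ φ) : ∃ u : TDist d, ∀ φ, u φ = g φ := by
  have hc : Continuous g := by
    refine continuous_of_continuousAt_zero g ?_
    rw [ContinuousAt, map_zero, tendsto_zero_iff_enorm_tendsto_zero]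
    have h0 := hσ.continuous.tendsto 0
    rw [hσ.zero] at h0
    exact tendsto_of_tendsto_of_tendsto_of_le_of_le tendsto_const_nhds h0 (fun _ => zero_le) h
  exact ⟨ContinuousLinearMap.toPointwiseConvergenceCLM _ _ _ _ ⟨g, hc⟩, fun φ => rfl⟩

theorem mop_sym_mop_refl_sym_eq_zero (hψ : IsCutoff ψ) {j : ℤ} {k l : Fin d → ℤ}
    (h : ¬ ∀ t, |(k t : ℝ) + l t| ≤ 2) (φ : TestFn d) :
    mop (sym hψ j k) (mop (refl (sym hψ j l)) φ) = 0 := ext_fourier fun ξ => by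
  have h0 : 𝓕 (0 : TestFn d) ξ = 0 := by
    have : 𝓕 (0 : TestFn d) = 0 := map_zero (FourierTransform.fourierCLM ℂ (TestFn d))
    rw [this]
    rfl
  rw [h0]
  by_contra hne
  refine h fun t => ?_
  have h1 := fourier_mop_sym_ne_zero hψ hne t
  rw [mop_comm] at hne
  have h2 := fourier_mop_refl_sym_ne_zero hψ hne t
  rw [_root_.abs_le] at *
  constructor <;> linarith [h1.1, h1.2, h2.1, h2.2]

/-- A bound for the synthesis of functions from pieces at one level. -/
def synthConst (hψ : IsCutoff ψ) : ℝ≥0∞ := cutConst hψ ^ 2 * 5 ^ d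

theorem synthConst_ne_top (hψ : IsCutoff ψ) : synthConst hψ ≠ ⊤ :=
  ENNReal.mul_ne_top (ENNReal.pow_ne_top (cutConst_ne_top hψ)) (by simp)

theorem sNorm_mop_sym_mop_refl_sym_le (hψ : IsCutoff ψ) (hpp : p.HolderConjugate p') (j : ℤ)
    (k l : Fin d → ℤ) (φ : TestFn d) :
    sNorm p (mop (sym hψ j k) (mop (refl (sym hψ j l)) φ)) ≤ cutConst hψ ^ 2 * sNorm p φ := by
  rw [sq, mul_assoc]
  exact (sNorm_mop_sym_le hψ hpp j k _).trans
    (mul_le_mul_right (sNorm_mop_refl_sym_le hψ hpp j l φ) _)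

theorem ellNorm_le_of_near_neg (hψ : IsCutoff ψ) (hq : 1 ≤ q) {a b : (Fin d → ℤ) → ℝ≥0∞}
    (h : ∀ k, a (-k) ≤ cutConst hψ ^ 2 * ∑ l ∈ nearR 2 (fun t => (k t : ℝ)), b l) :
    ellNorm q a ≤ synthConst hψ * ellNorm q b := by
  rw [← ellNorm_comp_equiv (Equiv.neg _) q a]
  have := ellNorm_le_of_near (d := d) hq (i := 0) (j := 0) le_rfl (K := cutConst hψ ^ 2)
    (a := fun k => a (Equiv.neg (Fin d → ℤ) k)) (b := b) fun k => by simpa using h k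
  simpa [synthConst] using this

theorem levelNorm_synthesis_le (hψ : IsCutoff ψ) (hpp : p.HolderConjugate p') (hq : 1 ≤ q) (j : ℤ)
    (t : Finset (Fin d → ℤ)) (x : (Fin d → ℤ) → TestFn d) :
    levelNorm ψ p q j (ofSchwartz (∑ k ∈ t, mop (refl (sym hψ j k)) (x k))) ≤
      synthConst hψ * ellNorm q fun k => sNorm p (x k) := by
  classical
  rw [levelNorm_ofSchwartz hψ hpp.lt.le]
  refine ellNorm_le_of_near_neg hψ hq fun k => ?_
  set A := nearR 2 (fun i => (k i : ℝ)) with hA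
  have h1 : mop (sym hψ j (-k)) (∑ l ∈ t, mop (refl (sym hψ j l)) (x l)) =
      ∑ l ∈ t ∩ A, mop (sym hψ j (-k)) (mop (refl (sym hψ j l)) (x l)) := by
    rw [map_sum]
    refine (Finset.sum_subset Finset.inter_subset_left fun l hlt hl => ?_).symm
    refine mop_sym_mop_refl_sym_eq_zero hψ (fun h => hl (Finset.mem_inter.2 ⟨hlt, ?_⟩)) _
    refine mem_nearR.2 fun i => ?_
    have := h i
    rw [Pi.neg_apply, Int.cast_neg] at this
    convert this using 2
    ring
  rw [h1]
  refine (sNorm_sum_le hpp.lt.le _ _).trans ?_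
  rw [Finset.mul_sum]
  exact (Finset.sum_le_sum fun l _ => sNorm_mop_sym_mop_refl_sym_le hψ hpp j _ l _).trans
    (Finset.sum_le_sum_of_subset Finset.inter_subset_right)

theorem ExtSeminorm.enorm_def {V : Type*} [AddCommGroup V] [Module ℂ V] (N : ExtSeminorm V)
    (f : N.Space) : ‖f‖ₑ = N.toFun (N.incl f) := by
  rw [← ofReal_norm, N.norm_def, ENNReal.ofReal_toReal (N.incl_lt_top f).ne]

theorem enorm_strongDual_le {V : Type*} [AddCommGroup V] [Module ℂ V] {N : ExtSeminorm V}
    (ℓ : StrongDual ℂ N.Space) (f : N.Space) : ‖ℓ f‖ₑ ≤ ‖ℓ‖ₑ * N.toFun (N.incl f) := by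
  rw [← N.enorm_def]
  exact ℓ.le_opENorm f

theorem weight_inv (x s : ℝ) : ((2 : ℝ≥0∞) ^ (x * s))⁻¹ = (2 : ℝ≥0∞) ^ (x * -s) := by
  rw [mul_neg, ENNReal.rpow_neg]

theorem exists_frak_representation (hψ : IsCutoff ψ) (hpp : p.HolderConjugate p')
    (hqq : q.HolderConjugate q') (hrr : r.HolderConjugate r') (μ : ℝ)
    (h1 : ∀ φ : TestFn d,
      (scrSeminorm ψ μ hpp.lt.le hqq.lt.le hrr.lt.le).toFun (ofSchwartz φ) < ⊤)
    (ℓ : StrongDual ℂ (scrSeminorm ψ μ hpp.lt.le hqq.lt.le hrr.lt.le).Space) :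
    ∃ g : TDist d, frakNorm ψ (-μ) p' q' r' g ≤ synthConst hψ * ‖ℓ‖ₑ ∧
      ∀ φ, ℓ (schwartzIncl _ h1 φ) = g φ := by
  obtain ⟨σ, hσ, hσle⟩ := exists_scrNorm_schwartz_le (r := r) hψ hpp hqq.lt.le hrr.lt.le μ
  set Φ := schwartzIncl _ h1
  have hℓ : ∀ φ, ‖ℓ (Φ φ)‖ₑ ≤ ‖ℓ‖ₑ * scrNorm ψ μ p q r (ofSchwartz φ) := fun φ =>
    enorm_strongDual_le ℓ (Φ φ)
  obtain ⟨g, hg⟩ := exists_dist_of_schwartzBound (ℓ.toLinearMap ∘ₗ Φ)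
    (hσ.const_mul (c := ‖ℓ‖ₑ) enorm_ne_top) fun φ => (hℓ φ).trans (mul_le_mul_right (hσle φ) _)
  refine ⟨g, ?_, fun φ => (hg φ).symm⟩
  set Λ : Set.Iic (0 : ℤ) → (Fin d → ℤ) → TestFn d →ₗ[ℂ] ℂ := fun j k =>
    (ℓ.toLinearMap ∘ₗ Φ) ∘ₗ (mop (refl (sym hψ j k))).toLinearMap with hΛ
  have key := mixed_dualNorm_le (ν := sNorm p) (Λ := Λ) (q := q) (q' := q') (r := r) (r' := r')
    (w := fun j : Set.Iic (0 : ℤ) => (2 : ℝ≥0∞) ^ (((j : ℤ) : ℝ) * μ))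
    (C := synthConst hψ * ‖ℓ‖ₑ) (sNorm_ne_top p) (fun c v => (sNorm_smul c v).le)
    (fun _ => weight_ne_zero _) (fun _ => weight_ne_top _) hqq hrr
    (ENNReal.mul_ne_top (synthConst_ne_top hψ) enorm_ne_top) fun s t x hx => by
      set y : Set.Iic (0 : ℤ) → TestFn d := fun j => ∑ k ∈ t, mop (refl (sym hψ j k)) (x j k) with hy
      have e1 : ∑ j ∈ s, ∑ k ∈ t, Λ j k (x j k) = ℓ (Φ (∑ j ∈ s, y j)) := by
        simp only [hy, map_sum]
        rfl
      have e2 : HasSum (fun j => ofSchwartz (y j)) (ofSchwartz (∑ j ∈ s, y j)) := by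
        have e3 : ofSchwartz (∑ j ∈ s, y j) = ∑ j ∈ s, ofSchwartz (y j) :=
          map_sum (SchwartzMap.toTemperedDistributionCLM (Eu d) ℂ volume) y s
        rw [e3]
        refine hasSum_sum_of_ne_finset_zero fun j hj => ?_
        have : y j = 0 := Finset.sum_eq_zero fun k _ => by rw [hx j k (Or.inl hj), map_zero]
        rw [this]
        exact map_zero (SchwartzMap.toTemperedDistributionCLM (Eu d) ℂ volume)
      rw [e1]
      refine (hℓ _).trans ?_
      rw [mul_comm (synthConst hψ), mul_assoc, ← ellNorm_const_mul hrr.pos]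
      have e4 : scrNorm ψ μ p q r (ofSchwartz (∑ j ∈ s, y j)) ≤
          familyNorm ψ μ p q r fun j => ofSchwartz (y j) := iInf₂_le_of_le _ e2 le_rfl
      refine mul_le_mul_right (e4.trans (ellNorm_mono hrr.pos fun j => ?_)) _
      rw [mul_left_comm]
      exact mul_le_mul_right (levelNorm_synthesis_le hψ hpp hqq.lt.le j t (x j)) _
  refine le_trans (ellNorm_mono hrr.symm.pos fun j => ?_) key.2
  rw [weight_inv]
  refine mul_le_mul_right (ellNorm_mono hqq.symm.pos fun k => ?_) _
  refine lpNorm_le_mul_of_forall hpp.symm fun φ => ?_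
  rw [box_apply hψ, hg]
  exact key.1 j k φ

end Synthesis

/-! ### Functionals on the space `𝔐` -/

section FrakFunctionals

open FourierTransform

variable {d : ℕ} {p p' q q' r r' : ℝ} {ψ : Eu d → ℝ}

/-- The weighted mixed norm of a family of Schwartz functions. -/
def mixedSeminorm (d : ℕ) (s : ℝ) {p q r : ℝ} (hp : 1 ≤ p) (hq : 1 ≤ q) (hr : 1 ≤ r) :
    ExtSeminorm (Set.Iic (0 : ℤ) → (Fin d → ℤ) → TestFn d) where
  toFun x := ellNorm r fun j : Set.Iic (0 : ℤ) => (2 : ℝ≥0∞) ^ (((j : ℤ) : ℝ) * s) *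
    ellNorm q fun k => sNorm p (x j k)
  zero' := by
    have hq0 : 0 < q := by linarith
    simp only [Pi.zero_apply, sNorm_zero, ellNorm_zero hq0, mul_zero]
    exact ellNorm_zero (by linarith)
  add_le' x y := by
    refine le_trans (ellNorm_mono (by linarith) fun j => ?_) (ellNorm_add_le hr _ _)
    rw [← mul_add]
    refine mul_le_mul_right (le_trans (ellNorm_mono (by linarith) fun k => ?_)
      (ellNorm_add_le hq _ _)) _
    exact sNorm_add_le hp _ _
  smul_le' c x := by
    have hq0 : 0 < q := by linarith
    have hr0 : 0 < r := by linarith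
    simp only [Pi.smul_apply, sNorm_smul, ellNorm_const_mul hq0, mul_left_comm _ ‖c‖ₑ,
      ellNorm_const_mul hr0]
    exact le_rfl

variable {s : ℝ} {hp : 1 ≤ p} {hq : 1 ≤ q} {hr : 1 ≤ r}

theorem mixedSeminorm_single_lt_top (j : Set.Iic (0 : ℤ)) (k : Fin d → ℤ) (φ : TestFn d) :
    (mixedSeminorm d s hp hq hr).toFun (Pi.single j (Pi.single k φ)) < ⊤ := by
  have hq0 : 0 < q := by linarith
  have hr0 : 0 < r := by linarith
  change ellNorm r _ < ⊤
  rw [ellNorm_eq_of_support hr0 {j}, Finset.sum_singleton, Pi.single_eq_same,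
    ellNorm_eq_of_support hq0 {k}, Finset.sum_singleton, Pi.single_eq_same]
  · have := sNorm_ne_top p φ
    have := weight_ne_top (((j : ℤ) : ℝ) * s)
    finiteness
  · intro l hl
    rw [Pi.single_eq_of_ne (by simpa using hl), sNorm_zero]
  · intro i hi
    rw [Pi.single_eq_of_ne (by simpa using hi)]
    simp only [Pi.zero_apply, sNorm_zero, ellNorm_zero hq0, mul_zero]

/-- The embedding of a single function into the space of families. -/
def mixedSingle (d : ℕ) (s : ℝ) {p q r : ℝ} (hp : 1 ≤ p) (hq : 1 ≤ q) (hr : 1 ≤ r)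
    (j : Set.Iic (0 : ℤ)) (k : Fin d → ℤ) :
    TestFn d →ₗ[ℂ] (mixedSeminorm d s hp hq hr).Space where
  toFun φ := (mixedSeminorm d s hp hq hr).ofLt _ (mixedSeminorm_single_lt_top j k φ)
  map_add' φ η := ExtSeminorm.incl_injective _ <| by
    rw [map_add]
    simp only [ExtSeminorm.incl_ofLt, Pi.single_add]
  map_smul' c φ := ExtSeminorm.incl_injective _ <| by
    rw [map_smul]
    simp only [ExtSeminorm.incl_ofLt, Pi.single_smul, RingHom.id_apply]

theorem incl_sum_mixedSingle (x : Set.Iic (0 : ℤ) → (Fin d → ℤ) → TestFn d)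
    (A : Finset (Set.Iic (0 : ℤ) × (Fin d → ℤ))) (j : Set.Iic (0 : ℤ)) (k : Fin d → ℤ) :
    (mixedSeminorm d s hp hq hr).incl
      (∑ a ∈ A, mixedSingle d s hp hq hr a.1 a.2 (x a.1 a.2)) j k =
      if (j, k) ∈ A then x j k else 0 := by
  classical
  have h : ∀ a : Set.Iic (0 : ℤ) × (Fin d → ℤ),
      (mixedSeminorm d s hp hq hr).incl (mixedSingle d s hp hq hr a.1 a.2 (x a.1 a.2)) j k =
        if a = (j, k) then x j k else 0 := by
    rintro ⟨i, l⟩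
    change (Pi.single i (Pi.single l (x i l)) : Set.Iic (0 : ℤ) → (Fin d → ℤ) → TestFn d) j k = _
    rcases eq_or_ne i j with rfl | hij
    · rw [Pi.single_eq_same]
      rcases eq_or_ne l k with rfl | hlk
      · simp
      · rw [Pi.single_eq_of_ne hlk.symm, if_neg (by simp [hlk])]
    · rw [Pi.single_eq_of_ne hij.symm, if_neg (by simp [hij])]
      rfl
  rw [map_sum, Finset.sum_apply, Finset.sum_apply]
  simp only [h, Finset.sum_ite_eq']

theorem tendsto_mixedSeminorm_sub_sum (x : (mixedSeminorm d s hp hq hr).Space) :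
    Tendsto (fun A : Finset (Set.Iic (0 : ℤ) × (Fin d → ℤ)) =>
      (mixedSeminorm d s hp hq hr).toFun ((mixedSeminorm d s hp hq hr).incl
        (x - ∑ a ∈ A, mixedSingle d s hp hq hr a.1 a.2
          ((mixedSeminorm d s hp hq hr).incl x a.1 a.2)))) atTop (𝓝 0) := by
  classical
  have hq0 : 0 < q := by linarith
  have hr0 : 0 < r := by linarith
  let M := mixedSeminorm d s hp hq hr
  let y := M.incl x
  have hyt : ellNorm r (fun j : Set.Iic (0 : ℤ) => (2 : ℝ≥0∞) ^ (((j : ℤ) : ℝ) * s) *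
    ellNorm q fun k => sNorm p (y j k)) ≠ ⊤ := (M.incl_lt_top x).ne
  have e : ∀ A : Finset (Set.Iic (0 : ℤ) × (Fin d → ℤ)), ∀ j k,
      M.incl (x - ∑ a ∈ A, mixedSingle d s hp hq hr a.1 a.2 (y a.1 a.2)) j k =
        if (j, k) ∈ A then 0 else y j k := fun A j k => by
    rw [map_sub, Pi.sub_apply, Pi.sub_apply, incl_sum_mixedSingle]
    split_ifs <;> simp [y, M]
  have hle : ∀ (A : Finset (Set.Iic (0 : ℤ) × (Fin d → ℤ))) j k,
      sNorm p (M.incl (x - ∑ a ∈ A, mixedSingle d s hp hq hr a.1 a.2 (y a.1 a.2)) j k) ≤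
        sNorm p (y j k) := fun A j k => by
    rw [e]
    split_ifs
    · rw [sNorm_zero]
      exact zero_le
    · exact le_rfl
  refine tendsto_ellNorm_zero hr0 hyt (Eventually.of_forall fun A j =>
    mul_le_mul_right (ellNorm_mono hq0 fun k => hle A j k) _) fun j => ?_
  have hj : ellNorm q (fun k => sNorm p (y j k)) ≠ ⊤ := fun h => hyt <| by
    have := le_ellNorm hr0 (fun j : Set.Iic (0 : ℤ) => (2 : ℝ≥0∞) ^ (((j : ℤ) : ℝ) * s) *
      ellNorm q fun k => sNorm p (y j k)) j
    simpa only [h, ENNReal.mul_top (weight_ne_zero _), top_le_iff] using this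
  have h1 := tendsto_ellNorm_zero (l := atTop) hq0 hj
    (a := fun (A : Finset (Set.Iic (0 : ℤ) × (Fin d → ℤ))) k => sNorm p
      (M.incl (x - ∑ a ∈ A, mixedSingle d s hp hq hr a.1 a.2 (y a.1 a.2)) j k))
    (Eventually.of_forall fun A k => hle A j k) fun k => by
      refine tendsto_const_nhds.congr' ?_
      filter_upwards [eventually_ge_atTop {(j, k)}] with A hA
      rw [e, if_pos (hA (Finset.mem_singleton_self _)), sNorm_zero]
  have h2 := ENNReal.Tendsto.const_mul (a := (2 : ℝ≥0∞) ^ (((j : ℤ) : ℝ) * s)) h1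
    (Or.inr (weight_ne_top _))
  rwa [mul_zero] at h2

end FrakFunctionals

section FrakRepresentation

variable {d : ℕ} {p p' q q' r r' : ℝ} {ψ : Eu d → ℝ}

/-- The frequency pieces of a Schwartz function. -/
def analysis (hψ : IsCutoff ψ) :
    TestFn d →ₗ[ℂ] Set.Iic (0 : ℤ) → (Fin d → ℤ) → TestFn d where
  toFun φ j k := mop (sym hψ j k) φ
  map_add' φ η := by
    funext j k
    exact map_add _ _ _
  map_smul' c φ := by
    funext j k
    exact map_smul _ _ _

theorem mixedSeminorm_analysis (hψ : IsCutoff ψ) {s : ℝ} (hp : 1 ≤ p) (hq : 1 ≤ q) (hr : 1 ≤ r)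
    (φ : TestFn d) :
    (mixedSeminorm d s hp hq hr).toFun (analysis hψ φ) = frakNorm ψ s p q r (ofSchwartz φ) := by
  simp only [frakNorm, familyNorm, levelNorm_ofSchwartz hψ hp]
  rfl

theorem exists_frak_coefficients (hψ : IsCutoff ψ) (hpp : p.HolderConjugate p')
    (hqq : q.HolderConjugate q') (hrr : r.HolderConjugate r') (s : ℝ)
    (h1 : ∀ φ : TestFn d,
      (frakSeminorm ψ s hpp.lt.le hqq.lt.le hrr.lt.le).toFun (ofSchwartz φ) < ⊤)
    (ℓ : StrongDual ℂ (frakSeminorm ψ s hpp.lt.le hqq.lt.le hrr.lt.le).Space) :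
    ∃ Λ : Set.Iic (0 : ℤ) → (Fin d → ℤ) → TestFn d →ₗ[ℂ] ℂ,
      (∀ j k v, ‖Λ j k v‖ₑ ≤ dualNorm (sNorm p) (Λ j k) * sNorm p v) ∧
      ellNorm r' (fun j : Set.Iic (0 : ℤ) => (2 : ℝ≥0∞) ^ (((j : ℤ) : ℝ) * -s) *
        ellNorm q' fun k => dualNorm (sNorm p) (Λ j k)) ≤ ‖ℓ‖ₑ ∧
      ∀ φ, HasSum (fun a : Set.Iic (0 : ℤ) × (Fin d → ℤ) =>
        Λ a.1 a.2 (mop (sym hψ a.1 a.2) φ)) (ℓ (schwartzIncl _ h1 φ)) := by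
  set Φ := schwartzIncl _ h1
  let M := mixedSeminorm d s hpp.lt.le hqq.lt.le hrr.lt.le
  have hM : ∀ φ, M.toFun (analysis hψ φ) = frakNorm ψ s p q r (ofSchwartz φ) :=
    mixedSeminorm_analysis hψ _ _ _
  have hMt : ∀ φ, M.toFun (analysis hψ φ) < ⊤ := fun φ => (hM φ).trans_lt (h1 φ)
  let Θ : TestFn d →ₗ[ℂ] M.Space :=
    { toFun := fun φ => M.ofLt (analysis hψ φ) (hMt φ)
      map_add' := fun φ η => M.incl_injective (by simp)
      map_smul' := fun c φ => M.incl_injective (by simp) }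
  obtain ⟨Γ, hΓ, hΓn⟩ := exists_strongDual_comp_eq Θ (ℓ.toLinearMap ∘ₗ Φ) (norm_nonneg ℓ)
    fun φ => by
      have h2 : ‖Θ φ‖ = ‖Φ φ‖ := by
        rw [norm_schwartzIncl]
        exact congrArg ENNReal.toReal (hM φ)
      rw [h2]
      exact ℓ.le_opNorm (Φ φ)
  have hΓe : ‖Γ‖ₑ ≤ ‖ℓ‖ₑ := by
    rw [← ofReal_norm, ← ofReal_norm]
    exact ENNReal.ofReal_le_ofReal hΓn
  let S := mixedSingle d s hpp.lt.le hqq.lt.le hrr.lt.le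
  let Λ : Set.Iic (0 : ℤ) → (Fin d → ℤ) → TestFn d →ₗ[ℂ] ℂ := fun j k => Γ.toLinearMap ∘ₗ S j k
  have hsum : ∀ (x : Set.Iic (0 : ℤ) → (Fin d → ℤ) → TestFn d)
      (A : Finset (Set.Iic (0 : ℤ) × (Fin d → ℤ))),
      ∑ a ∈ A, Λ a.1 a.2 (x a.1 a.2) = Γ (∑ a ∈ A, S a.1 a.2 (x a.1 a.2)) := fun x A => by
    rw [map_sum]
    rfl
  have key := mixed_dualNorm_le (ν := sNorm p) (Λ := Λ) (q := q) (q' := q') (r := r) (r' := r')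
    (w := fun j : Set.Iic (0 : ℤ) => (2 : ℝ≥0∞) ^ (((j : ℤ) : ℝ) * s))
    (C := ‖ℓ‖ₑ) (sNorm_ne_top p) (fun c v => (sNorm_smul c v).le)
    (fun _ => weight_ne_zero _) (fun _ => weight_ne_top _) hqq hrr enorm_ne_top fun A B x hx => by
      rw [← Finset.sum_product', hsum x]
      refine (enorm_strongDual_le Γ _).trans (mul_le_mul' hΓe (le_of_eq ?_))
      have h3 : M.incl (∑ a ∈ A ×ˢ B, S a.1 a.2 (x a.1 a.2)) = x := by
        funext j k
        rw [incl_sum_mixedSingle x]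
        split_ifs with h
        · rfl
        · rw [hx j k]
          rwa [Finset.mem_product, not_and_or] at h
      exact congrArg M.toFun h3
  refine ⟨Λ, key.1, ?_, fun φ => ?_⟩
  · simpa only [weight_inv] using key.2
  · have h4 := tendsto_mixedSeminorm_sub_sum (Θ φ)
    have h5 := ENNReal.Tendsto.const_mul (a := ‖Γ‖ₑ) h4 (Or.inr enorm_ne_top)
    rw [mul_zero] at h5
    have h6 : Tendsto (fun A : Finset (Set.Iic (0 : ℤ) × (Fin d → ℤ)) =>
        ‖ℓ (Φ φ) - ∑ a ∈ A, Λ a.1 a.2 (mop (sym hψ a.1 a.2) φ)‖ₑ) atTop (𝓝 0) := by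
      refine tendsto_of_tendsto_of_tendsto_of_le_of_le tendsto_const_nhds h5
        (fun _ => zero_le) fun A => ?_
      have h7 : ℓ (Φ φ) = Γ (Θ φ) := (hΓ φ).symm
      have h8 := hsum (analysis hψ φ) A
      change ∑ a ∈ A, Λ a.1 a.2 (mop (sym hψ a.1 a.2) φ) = _ at h8
      rw [h7, h8, ← map_sub]
      exact enorm_strongDual_le Γ _
    rw [← tendsto_zero_iff_enorm_tendsto_zero] at h6
    have h9 := (tendsto_const_nhds (x := ℓ (Φ φ))).sub h6
    simp only [sub_sub_cancel, sub_zero] at h9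
    rwa [HasSum, SummationFilter.unconditional_filter]

theorem exists_dist_of_coefficients (hψ : IsCutoff ψ) (hpp : p.HolderConjugate p')
    (hqq : q.HolderConjugate q') {j : ℤ} (hj : j ≤ 0) {Λ : (Fin d → ℤ) → TestFn d →ₗ[ℂ] ℂ}
    {β : (Fin d → ℤ) → ℝ≥0∞} (hΛ : ∀ k v, ‖Λ k v‖ₑ ≤ β k * sNorm p v) (hβ : ellNorm q' β ≠ ⊤) :
    ∃ F : TDist d, (∀ φ, HasSum (fun k => Λ k (mop (sym hψ j k) φ)) (F φ)) ∧
      levelNorm ψ p' q' j F ≤ synthConst hψ * ellNorm q' β := by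
  obtain ⟨σ, hσ, hσle⟩ := exists_levelNorm_schwartz_le hψ hpp hqq.lt.le
  set c := (2 : ℝ≥0∞) ^ ((j : ℝ) * levExp d p q) with hc
  have hct : c ≠ ⊤ := weight_ne_top _
  have hb : ∀ φ, ∑' k, ‖Λ k (mop (sym hψ j k) φ)‖ₑ ≤ ellNorm q' β * c * σ φ := fun φ => by
    rw [mul_assoc]
    refine (ENNReal.tsum_le_tsum fun k => hΛ k _).trans ((tsum_mul_le_ellNorm hqq.symm _ _).trans ?_)
    rw [← levelNorm_ofSchwartz hψ hpp.lt.le]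
    exact mul_le_mul_right (hσle j hj φ) _
  have hbt : ellNorm q' β * c ≠ ⊤ := ENNReal.mul_ne_top hβ hct
  have hs : ∀ φ, Summable fun k => Λ k (mop (sym hψ j k) φ) := fun φ => by
    refine Summable.of_enorm ?_
    exact ne_top_of_le_ne_top (ENNReal.mul_ne_top hbt (hσ.ne_top φ)) (hb φ)
  let G : TestFn d →ₗ[ℂ] ℂ :=
    { toFun := fun φ => ∑' k, Λ k (mop (sym hψ j k) φ)
      map_add' := fun φ η => by
        rw [← (hs φ).tsum_add (hs η)]
        simp only [map_add]
      map_smul' := fun a φ => by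
        simp only [map_smul, RingHom.id_apply]
        exact tsum_const_smul'' a }
  obtain ⟨F, hF⟩ := exists_dist_of_schwartzBound G (hσ.const_mul hbt) fun φ =>
    enorm_tsum_le_tsum_enorm.trans (hb φ)
  refine ⟨F, fun φ => by rw [hF]; exact (hs φ).hasSum, ?_⟩
  refine ellNorm_le_of_near_neg hψ hqq.symm.lt.le fun k => ?_
  refine lpNorm_le_mul_of_forall hpp.symm fun φ => ?_
  rw [box_apply hψ, hF]
  change ‖∑' l, Λ l (mop (sym hψ j l) (mop (refl (sym hψ j (-k))) φ))‖ₑ ≤ _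
  rw [tsum_eq_sum (s := nearR 2 fun t => (k t : ℝ)) fun l hl => ?_]
  · refine (enorm_sum_le _ _).trans ?_
    rw [Finset.mul_sum, Finset.sum_mul]
    refine Finset.sum_le_sum fun l _ => (hΛ l _).trans ?_
    rw [mul_comm (cutConst hψ ^ 2), mul_assoc]
    exact mul_le_mul_right (sNorm_mop_sym_mop_refl_sym_le hψ hpp j l _ φ) _
  · rw [mop_sym_mop_refl_sym_eq_zero hψ (fun h => hl (mem_nearR.2 fun t => ?_)), map_zero]
    have := h t
    rwa [Pi.neg_apply, Int.cast_neg, ← sub_eq_add_neg] at this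

theorem exists_scr_representation (hψ : IsCutoff ψ) (hpp : p.HolderConjugate p')
    (hqq : q.HolderConjugate q') (hrr : r.HolderConjugate r') {s : ℝ}
    (hs : 0 < s + levExp d p q)
    (h1 : ∀ φ : TestFn d,
      (frakSeminorm ψ s hpp.lt.le hqq.lt.le hrr.lt.le).toFun (ofSchwartz φ) < ⊤)
    (ℓ : StrongDual ℂ (frakSeminorm ψ s hpp.lt.le hqq.lt.le hrr.lt.le).Space) :
    ∃ f : TDist d, scrNorm ψ (-s) p' q' r' f ≤ synthConst hψ * ‖ℓ‖ₑ ∧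
      ∀ φ, ℓ (schwartzIncl _ h1 φ) = f φ := by
  obtain ⟨σ, hσ, hσle⟩ := exists_frakNorm_schwartz_le hψ hpp hqq.lt.le hrr.lt.le hs
  obtain ⟨Λ, hΛ, hΛn, hΛs⟩ := exists_frak_coefficients hψ hpp hqq hrr s h1 ℓ
  set Φ := schwartzIncl _ h1
  obtain ⟨f, hf⟩ := exists_dist_of_schwartzBound (ℓ.toLinearMap ∘ₗ Φ)
    (hσ.const_mul (c := ‖ℓ‖ₑ) enorm_ne_top) fun φ =>
      (enorm_strongDual_le ℓ (Φ φ)).trans (mul_le_mul_right (hσle φ) _)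
  refine ⟨f, ?_, fun φ => (hf φ).symm⟩
  have hβ : ∀ j : Set.Iic (0 : ℤ), ellNorm q' (fun k => dualNorm (sNorm p) (Λ j k)) ≠ ⊤ :=
    fun j h => by
      have h2 := (le_ellNorm hrr.symm.pos (fun j : Set.Iic (0 : ℤ) =>
        (2 : ℝ≥0∞) ^ (((j : ℤ) : ℝ) * -s) * ellNorm q' fun k => dualNorm (sNorm p) (Λ j k)) j).trans
          hΛn
      simp only [h, ENNReal.mul_top (weight_ne_zero _), top_le_iff] at h2
      exact enorm_ne_top h2
  choose F hF hFn using fun j : Set.Iic (0 : ℤ) =>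
    exists_dist_of_coefficients hψ hpp hqq j.2 (hΛ j) (hβ j)
  have hsum : HasSum F f := by
    refine PointwiseConvergenceCLM.tendsto_iff_forall_tendsto.2 fun φ => ?_
    have h3 : HasSum (fun j => F j φ) (f φ) := by
      rw [hf]
      exact (hΛs φ).prod_fiberwise fun j => hF j φ
    simpa only [HasSum, dist_sum_apply] using h3
  have h4 : scrNorm ψ (-s) p' q' r' f ≤ familyNorm ψ (-s) p' q' r' F :=
    iInf₂_le_of_le _ hsum le_rfl
  refine h4.trans (le_trans ?_ (mul_le_mul_right hΛn (synthConst hψ)))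
  rw [← ellNorm_const_mul hrr.symm.pos]
  refine ellNorm_mono hrr.symm.pos fun j => ?_
  rw [mul_left_comm]
  exact mul_le_mul_right (hFn j) _

end FrakRepresentation

section Duality

variable {d : ℕ} {p p' q q' r r' : ℝ} {ψ : Eu d → ℝ}

theorem dualEq_scr_frak (hψ : IsCutoff ψ) (hp : p.HolderConjugate p')
    (hq : q.HolderConjugate q') (hr : r.HolderConjugate r') {μ : ℝ}
    (hμ : 0 < -μ + levExp d p' q') :
    DualEq (scrSeminorm ψ μ hp.lt.le hq.lt.le hr.lt.le)
      (frakSeminorm ψ (-μ) hp.symm.lt.le hq.symm.lt.le hr.symm.lt.le) := by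
  obtain ⟨C, hC, h⟩ := exists_enorm_apply_le_frak_mul_scr hψ hp hq hr hμ
  exact dualEq_of (schwartzDense_scr hψ hp _ _ _ μ) hC (synthConst_ne_top hψ)
    (fun g hg φ => h g φ hg) fun ℓ => exists_frak_representation hψ hp hq hr μ _ ℓ

theorem dualEq_frak_scr (hψ : IsCutoff ψ) (hp : p.HolderConjugate p')
    (hq : q.HolderConjugate q') (hr : r.HolderConjugate r') {μ : ℝ}
    (hμ : 0 < -μ + levExp d p' q') :
    DualEq (frakSeminorm ψ (-μ) hp.symm.lt.le hq.symm.lt.le hr.symm.lt.le)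
      (scrSeminorm ψ μ hp.lt.le hq.lt.le hr.lt.le) := by
  obtain ⟨C, hC, h⟩ := exists_enorm_apply_le_scr_mul_frak (d := d) hψ hp hq hr μ
  have hd := schwartzDense_frak hψ hp.symm hp.symm.lt.le hq.symm.lt.le hr.symm.lt.le hμ
  refine dualEq_of hd hC (synthConst_ne_top hψ) (fun f hf φ => h f φ hf (hd.1 φ).ne) fun ℓ => ?_
  have := exists_scr_representation hψ hp.symm hq.symm hr.symm hμ hd.1 ℓ
  rwa [neg_neg] at this

theorem levExp_conj (hp : p.HolderConjugate p') (hq : q.HolderConjugate q') :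
    levExp d p' q' = d * (1 / p + 1 / q - 1) := by
  have h1 := hp.inv_add_inv_eq_one
  have h2 := hq.inv_add_inv_eq_one
  rw [levExp]
  congr 1
  simp only [one_div]
  linarith

end Duality

end ScalingLimit

end

/-- Duality of `𝓜^μ_{p,q,r}` and `𝔐^{-μ}_{p',q',r'}`.  (`p.HolderConjugate p'` says that
`1 < p, p' < ∞` and `1/p + 1/p' = 1`.) -/
theorem proposition4p3 {d : ℕ} (ψ : EuclideanSpace ℝ (Fin d) → ℝ)
    (hψ : ScalingLimit.IsCutoff ψ) {p q r p' q' r' : ℝ}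
    (hp : p.HolderConjugate p') (hq : q.HolderConjugate q') (hr : r.HolderConjugate r')
    (μ : ℝ) (hμ_lower : min 0 ((d : ℝ) * (1 / q - 1 / p)) ≤ μ)
    (hμ : μ < (d : ℝ) * (1 / p + 1 / q - 1)) :
    ScalingLimit.DualEq
        (ScalingLimit.scrSeminorm ψ μ hp.lt.le hq.lt.le hr.lt.le)
        (ScalingLimit.frakSeminorm ψ (-μ) hp.symm.lt.le hq.symm.lt.le hr.symm.lt.le) ∧
      ScalingLimit.DualEq
        (ScalingLimit.frakSeminorm ψ (-μ) hp.symm.lt.le hq.symm.lt.le hr.symm.lt.le)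
        (ScalingLimit.scrSeminorm ψ μ hp.lt.le hq.lt.le hr.lt.le) := by
  have h : 0 < -μ + ScalingLimit.levExp d p' q' := by
    rw [ScalingLimit.levExp_conj hp hq]
    linarith
  exact ⟨ScalingLimit.dualEq_scr_frak hψ hp hq hr h, ScalingLimit.dualEq_frak_scr hψ hp hq hr h⟩
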